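/- **Setting.** Let $\theta_n=e^{2\pi i/n}$. In $\mathrm{SU}_2$ let $C_n=\langle \mathrm{diag}(\theta_n^{-1},\theta_n)\rangle$ be the cyclic group of order $n$, let $D_n=\langle \mathrm{diag}(\theta_{2n}^{-1},\theta_{2n}),\,y\rangle$ be the binary dihedral group of order $4n$, and let $T=\langle \mathrm{diag}(i,-i),y,z\rangle$ and $O=\langle \mathrm{diag}(\theta_8,\theta_8^{-1}),y,z\rangle$ be the binary tetrahedral and octahedral groups, where $y=\begin{pmatrix}0&i\\ i&0\end{pmatrix}$ and $z=\frac1{\sqrt2}\begin{pmatrix}\theta_8^{-1}&\theta_8^{-1}\\-\theta_8&\theta_8\end{pmatrix}$. Let $V=\mathbb C^2$ be the natural module. The distinguished pairs $N\lhd G\le \mathrm{SU}_2$, each with an affine type $X$ and finite type $X_0$ (for restriction) and an affine type $Y$ and finite type $Y_0$ (for induction), are | $(G,N)$ | $X$ | $X_0$ | $Y$ | $Y_0$ | |---|---|---|---|---| | $(D_{2(n-1)},D_{n-1})$, $n\ge 3$ | $A_{2n-1}^{(2)}$ | $C_n$ | $B_n^{(1)}$ | $B_n$ | | $(D_n,C_{2n})$,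 $n\ge2$ | $D_{n+1}^{(2)}$ | $B_n$ | $C_n^{(1)}$ | $C_n$ | | $(D_{2n},C_{2n})$, $n\ge2$ | $A_{2n}^{(2)}$ | $C_n$ | $C_n^{(1)}$ | $C_n$ | | $(O,T)$ | $E_6^{(2)}$ | $F_4$ | $F_4^{(1)}$ | $F_4$ | | $(T,D_2)$ | $D_4^{(3)}$ | $G_2$ | $G_2^{(1)}$ | $G_2$ | | $(D_2,C_2)$ | $A_2^{(2)}$ | $A_1$ | $A_1^{(1)}$ | $A_1$ | Let $\check\rho_i$ ($i\in\check I$) be the distinct (pairwise non-isomorphic) restrictions to $N$ of the irreducible complex $G$-modules, and $\hat\phi_i$ ($i\in\hat I$) the distinct $G$-modules induced from the irreducible complex $N$-modules; the index $0$ belongs to the trivial module. Let $\widetilde A=(a_{ij})$ and $\widetilde B=(b_{ij})$ be the nonnegative integer matrices with $V\otimes\check\rho_j\cong\bigoplus_i\check\rho_i^{\oplus a_{ij}}$ and $V\otimes\hat\phi_j\cong\bigoplus_i\hat\phi_i^{\oplus b_{ij}}$, and let $A$, $B$ be obtained from them by deleting the row and column $0$. Put $$\check m^0(t)=\sum_{k\ge0}\dim\mathrm{Hom}_N(\check\rho_0,V^{\otimes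 k})\,t^k,\qquad \hat m^0(t)=\sum_{k\ge0}\dim\mathrm{Hom}_G(\hat\phi_0,V^{\otimes k})\,t^k .$$ The exponents and Coxeter numbers of the types are | type | exponents | Coxeter number | |---|---|---| | $A_1$ | $1$ | $2$ | | $B_n$, $C_n$ | $1,3,\dots,2n-1$ | $2n$ | | $F_4$ | $1,5,7,11$ | $12$ | | $G_2$ | $1,5$ | $6$ | | $A_1^{(1)}$ | $0,1$ | $1$ | | $A_2^{(2)}$ | $0,2$ | $2$ | | $A_{2n}^{(2)}$, $C_n^{(1)}$, $D_{n+1}^{(2)}$ ($n\ge2$) | $0,1,\dots,n$ | $n$ | | $B_n^{(1)}$, $A_{2n-1}^{(2)}$, $n$ odd | $0,1,\dots,n-1$ and once more $\frac{n-1}2$ | $n-1$ | | $B_n^{(1)}$, $A_{2n-1}^{(2)}$, $n$ even | $0,2,\dots,2(n-1)$ and $n-1$ | $2(n-1)$ | | $F_4^{(1)}$, $E_6^{(2)}$ | $0,2,3,4,6$ | $6$ | | $G_2^{(1)}$, $D_4^{(3)}$ | $0,1,2$ | $2$ | **Theorem.** For every distinguished pair, $G$ is finite, $N$ is normal in $G$,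 and the following hold. 1. For each type $X,Y,X_0,Y_0$, with generalized Cartan matrix $C$, exponents $\Delta$ and Coxeter number $h$ as in the table: $\Delta\subset[0,h]$ is stable (with multiplicities) under $m\mapsto h-m$, and the spectrum of the Coxeter transformation of $C$ (the product of all simple reflections) is $\{e^{2\pi i m/h}: m\in\Delta\}$ with multiplicities. For $X_0,Y_0$ the number $h$ is the order of the Coxeter transformation. 2. The matrices $\widetilde A$, $\widetilde B$ exist, and, up to labelling of the vertices with $0$ as the special vertex, $2I-\widetilde A$ and $2I-\widetilde B$ are the Cartan matrices of the affine types $X$ and $Y$, while $2I-A$ and $2I-B$ are the Cartan matrices of the finite types $X_0$ and $Y_0$. 3. Let $\Delta,h$ be the exponents and Coxeter number of $X_0$, let $\widetilde\Delta,\widetilde h$ be those of $X$, let $\Upsilon$ be any set of representatives of the conjugacy classes of $G$, and $\Upsilon(N)=\Upsilon\cap N$. Then $\check m^0(t)=\hat m^0(t)=\sum_{k\ge0}\dim (V^{\otimes k})^N\,t^k$, and $$\check m^0(t)=\hat m^0(t)=\frac{\det(I-tA^T)}{\det(I-t\widetilde A^T)}=\frac{\det(I-tA^T)}{\prod_{g\in\Upsilon(N)}(1-\chi_V(g)t)}=\frac{\prod_{m\in\Delta}\bigl(1-2\cos(\tfrac{m\pi}{h})t\bigr)}{\prod_{\widetilde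 m\in\widetilde\Delta}\bigl(1-2\cos(\tfrac{\widetilde m\pi}{\widetilde h})t\bigr)};$$ moreover the three numerators are equal and the three denominators are equal. The same holds with $B,\widetilde B,Y_0,Y$ in place of $A,\widetilde A,X_0,X$. In this way the exponents of all twisted affine types, of all untwisted affine types that are not simply laced, and of $A_1^{(1)}$ are realized. -/

import Mathlib

open scoped PowerSeries TensorProduct

noncomputable section

namespace McKaySlodowy

/-! ### Finite subgroups of `SU(2)` -/

/-- The special unitary group `SU₂`. -/
abbrev SU2 : Type := Matrix.specialUnitaryGroup (Fin 2) ℂ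

/-- The element `!![a, b; -conj b, conj a]` of `SU₂`, where `|a|² + |b|² = 1`. -/
def su2 (a b : ℂ) (h : a * star a + b * star b = 1) : SU2 :=
  ⟨!![a, b; -star b, star a], by
    rw [Matrix.mem_specialUnitaryGroup_iff, Matrix.mem_unitaryGroup_iff]
    constructor
    · ext i j
      fin_cases i <;> fin_cases j <;>
        simp [Matrix.mul_apply, Matrix.star_apply] at h ⊢
      · linear_combination h
      · ring
      · ring
      · linear_combination h
    · simp [Matrix.det_fin_two] at h ⊢
      linear_combination h⟩

/-- `θ n = exp (2 π i / n)`. -/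
def θ (n : ℕ) : ℂ := Complex.exp (2 * Real.pi * Complex.I / n)

lemma star_θ (n : ℕ) : star (θ n) = (θ n)⁻¹ := by
  rw [θ, Complex.star_def, ← Complex.exp_conj, ← Complex.exp_neg]
  congr 1
  simp [neg_div, Complex.conj_ofNat]

lemma θ_ne_zero (n : ℕ) : θ n ≠ 0 := Complex.exp_ne_zero _

lemma inv_sqrt_two_sq : ((Real.sqrt 2 : ℝ) : ℂ)⁻¹ * ((Real.sqrt 2 : ℝ) : ℂ)⁻¹ = 1 / 2 := by
  rw [← mul_inv, ← Complex.ofReal_mul, Real.mul_self_sqrt (by norm_num)]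
  norm_num

/-- `diag (θ_n⁻¹, θ_n)`. -/
def elemX (n : ℕ) : SU2 :=
  su2 (θ n)⁻¹ 0 (by
    have := θ_ne_zero n
    rw [star_inv₀, star_θ]
    simp [this])

/-- `!![0, i; i, 0]`. -/
def elemY : SU2 := su2 0 Complex.I (by simp)

/-- `(1/√2) !![θ₈⁻¹, θ₈⁻¹; -θ₈, θ₈]`. -/
def elemZ : SU2 :=
  su2 (((Real.sqrt 2 : ℝ) : ℂ)⁻¹ * (θ 8)⁻¹) (((Real.sqrt 2 : ℝ) : ℂ)⁻¹ * (θ 8)⁻¹) (by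
    have h1 := θ_ne_zero 8
    have h2 := inv_sqrt_two_sq
    have h3 : star (((Real.sqrt 2 : ℝ) : ℂ)⁻¹ * (θ 8)⁻¹) =
        ((Real.sqrt 2 : ℝ) : ℂ)⁻¹ * θ 8 := by
      rw [star_mul', star_inv₀, star_inv₀, star_θ, inv_inv, Complex.star_def, Complex.conj_ofReal]
    rw [h3]
    have h4 : (θ 8)⁻¹ * θ 8 = 1 := inv_mul_cancel₀ h1
    linear_combination
      (2 * ((Real.sqrt 2 : ℝ) : ℂ)⁻¹ * ((Real.sqrt 2 : ℝ) : ℂ)⁻¹) * h4 + 2 * h2)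

/-- The cyclic group `C_n` of order `n`, generated by `diag (θ_n⁻¹, θ_n)`. -/
def cyclicGroup (n : ℕ) : Subgroup SU2 := Subgroup.zpowers (elemX n)

/-- The binary dihedral group `D_n` of order `4n`. -/
def binaryDihedral (n : ℕ) : Subgroup SU2 := Subgroup.closure {elemX (2 * n), elemY}

/-- The binary tetrahedral group `T` of order `24`, generated by `diag (i, -i)`, `y`, `z`. -/
def binaryTetrahedral : Subgroup SU2 := Subgroup.closure {(elemX 4)⁻¹, elemY, elemZ}

/-- The binary octahedral group `O` of order `48`, generated by `diag (θ₈, θ₈⁻¹)`, `y`, `z`. -/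
def binaryOctahedral : Subgroup SU2 := Subgroup.closure {(elemX 8)⁻¹, elemY, elemZ}

/-- The natural module `ℂ²` of a subgroup of `SU₂`. -/
def natRep (G : Subgroup SU2) : Representation ℂ G (Fin 2 → ℂ) :=
  ((Matrix.toLinAlgEquiv' : Matrix (Fin 2) (Fin 2) ℂ ≃ₐ[ℂ] _) : _ →* _).comp
    ((Matrix.specialUnitaryGroup (Fin 2) ℂ).subtype.comp G.subtype)

/-! ### Cartan matrices, Coxeter transformations and exponents

The convention for generalized Cartan matrices is `C i j = ⟨αᵢ^∨, αⱼ⟩`; in the Dynkin diagram the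
arrow points to `i` if `|C i j| > 1` (it points to the shorter root).  The matrices of
`CartanMatrix` in Mathlib follow the transposed convention. -/

/-- The finite types that occur. -/
inductive FiniteType where
  | A1
  | B (n : ℕ)
  | C (n : ℕ)
  | F4
  | G2

namespace FiniteType

/-- The number of vertices of the Dynkin diagram. -/
abbrev rank : FiniteType → ℕ
  | A1 => 1
  | B n => n
  | C n => n
  | F4 => 4
  | G2 => 2

/-- The Cartan matrix. -/
def cartan : (X : FiniteType) → Matrix (Fin X.rank) (Fin X.rank) ℤ
  | A1 => (CartanMatrix.A 1).transpose
  | B n => (CartanMatrix.B n).transpose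
  | C n => (CartanMatrix.C n).transpose
  | F4 => CartanMatrix.F₄.transpose
  | G2 => CartanMatrix.G₂.transpose

/-- The exponents (with multiplicities). -/
def exponents : FiniteType → Multiset ℕ
  | A1 => {1}
  | B n => (Multiset.range n).map fun j => 2 * j + 1
  | C n => (Multiset.range n).map fun j => 2 * j + 1
  | F4 => {1, 5, 7, 11}
  | G2 => {1, 5}

/-- The Coxeter number. -/
def coxeterNumber : FiniteType → ℕ
  | A1 => 2
  | B n => 2 * n
  | C n => 2 * n
  | F4 => 12
  | G2 => 6

end FiniteType

/-- The twisted, respectively untwisted multiply laced, affine types, and `A₁⁽¹⁾`. -/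
inductive AffineType where
  /-- `A₁⁽¹⁾` -/
  | A11
  /-- `A₂⁽²⁾` -/
  | A22
  /-- `A_{2n}⁽²⁾`, `n ≥ 2` -/
  | A2even (n : ℕ)
  /-- `A_{2n-1}⁽²⁾`, `n ≥ 3` -/
  | A2odd (n : ℕ)
  /-- `D_{n+1}⁽²⁾`, `n ≥ 2` -/
  | D2 (n : ℕ)
  /-- `E₆⁽²⁾` -/
  | E62
  /-- `D₄⁽³⁾` -/
  | D43
  /-- `B_n⁽¹⁾`, `n ≥ 3` -/
  | B1 (n : ℕ)
  /-- `C_n⁽¹⁾`, `n ≥ 2` -/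
  | C1 (n : ℕ)
  /-- `F₄⁽¹⁾` -/
  | F41
  /-- `G₂⁽¹⁾` -/
  | G21

/-- The Cartan matrix of the path `0 - 1 - ⋯ - n`, where `C i j = - w i j` on the bonds. -/
def pathCartan (n : ℕ) (w : ℕ → ℕ → ℤ) : Matrix (Fin (n + 1)) (Fin (n + 1)) ℤ :=
  fun i j =>
    if i = j then 2
    else if i.val + 1 = j.val ∨ j.val + 1 = i.val then - w i j
    else 0

/-- The bonds `0 - 2`, `1 - 2`, `2 - 3 - ⋯ - n` of a fork, each listed once. -/
abbrev forkBond (i j : ℕ) : Prop := (i = 0 ∧ j = 2) ∨ (1 ≤ i ∧ i + 1 = j)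

/-- The Cartan matrix of the fork `0 - 2`, `1 - 2`, `2 - 3 - ⋯ - n`, where `C i j = - w i j` on
the bonds. -/
def forkCartan (n : ℕ) (w : ℕ → ℕ → ℤ) : Matrix (Fin (n + 1)) (Fin (n + 1)) ℤ :=
  fun i j =>
    if i = j then 2
    else if forkBond i j ∨ forkBond j i then - w i j
    else 0

namespace AffineType

/-- One less than the number of vertices of the affine Dynkin diagram. -/
abbrev rank : AffineType → ℕ
  | A11 => 1
  | A22 => 1
  | A2even n => n
  | A2odd n => n
  | D2 n => n
  | E62 => 4
  | D43 => 2
  | B1 n => n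
  | C1 n => n
  | F41 => 4
  | G21 => 2

/-- The affine Cartan matrix; the special vertex is `0`. -/
def cartan : (X : AffineType) → Matrix (Fin (X.rank + 1)) (Fin (X.rank + 1)) ℤ
  | A11 => pathCartan 1 fun _ _ => 2
  | A22 => pathCartan 1 fun i _ => if i = 0 then 4 else 1
  | A2even n => pathCartan n fun i j =>
      if (i = 0 ∧ j = 1) ∨ (i + 1 = n ∧ j = n) then 2 else 1
  | A2odd n => forkCartan n fun i j => if i + 1 = n ∧ j = n then 2 else 1
  | D2 n => pathCartan n fun i j => if (i = 0 ∧ j = 1) ∨ (i = n ∧ j + 1 = n) then 2 else 1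
  | E62 => pathCartan 4 fun i j => if i = 2 ∧ j = 3 then 2 else 1
  | D43 => pathCartan 2 fun i j => if i = 1 ∧ j = 2 then 3 else 1
  | B1 n => forkCartan n fun i j => if i = n ∧ j + 1 = n then 2 else 1
  | C1 n => pathCartan n fun i j => if (i = 1 ∧ j = 0) ∨ (i + 1 = n ∧ j = n) then 2 else 1
  | F41 => pathCartan 4 fun i j => if i = 3 ∧ j = 2 then 2 else 1
  | G21 => pathCartan 2 fun i j => if i = 2 ∧ j = 1 then 3 else 1

/-- The common exponents of `B_n⁽¹⁾` and `A_{2n-1}⁽²⁾`. -/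
def exponentsB (n : ℕ) : Multiset ℕ :=
  if Even n then (Multiset.range n).map (fun j => 2 * j) + {n - 1}
  else Multiset.range n + {(n - 1) / 2}

/-- The common affine Coxeter number of `B_n⁽¹⁾` and `A_{2n-1}⁽²⁾`. -/
def coxeterNumberB (n : ℕ) : ℕ := if Even n then 2 * (n - 1) else n - 1

/-- The exponents (with multiplicities). -/
def exponents : AffineType → Multiset ℕ
  | A11 => {0, 1}
  | A22 => {0, 2}
  | A2even n => Multiset.range (n + 1)
  | A2odd n => exponentsB n
  | D2 n => Multiset.range (n + 1)
  | E62 => {0, 2, 3, 4, 6}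
  | D43 => {0, 1, 2}
  | B1 n => exponentsB n
  | C1 n => Multiset.range (n + 1)
  | F41 => {0, 2, 3, 4, 6}
  | G21 => {0, 1, 2}

/-- The affine Coxeter number. -/
def coxeterNumber : AffineType → ℕ
  | A11 => 1
  | A22 => 2
  | A2even n => n
  | A2odd n => coxeterNumberB n
  | D2 n => n
  | E62 => 6
  | D43 => 2
  | B1 n => coxeterNumberB n
  | C1 n => n
  | F41 => 6
  | G21 => 2

end AffineType

/-- The simple reflection `αⱼ ↦ αⱼ - C i j • αᵢ`, in the basis of simple roots. -/
def simpleReflection {n : ℕ} (C : Matrix (Fin n) (Fin n) ℤ) (i : Fin n) :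
    Matrix (Fin n) (Fin n) ℤ :=
  1 - Matrix.of fun k j => if k = i then C i j else 0

/-- The Coxeter transformation: the product of all simple reflections. -/
def coxeterTransformation {n : ℕ} (C : Matrix (Fin n) (Fin n) ℤ) : Matrix (Fin n) (Fin n) ℤ :=
  (List.ofFn (simpleReflection C)).prod

/-- `Δ` is the multiset of exponents of the generalized Cartan matrix `C` relative to the number
`h`: it lies in `[0, h]`, satisfies the duality `m ↔ h - m`, and the spectrum of the Coxeter
transformation consists of the numbers `exp (2 π i m / h)`, `m ∈ Δ`. -/
structure IsExponents {n : ℕ} (C : Matrix (Fin n) (Fin n) ℤ) (Δ : Multiset ℕ) (h : ℕ) : Prop where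
  pos : 0 < h
  le : ∀ m ∈ Δ, m ≤ h
  duality : Δ.map (fun m => h - m) = Δ
  spectrum : ((coxeterTransformation C).map (fun x : ℤ => (x : ℂ))).charpoly =
    (Δ.map fun m : ℕ => (Polynomial.X - Polynomial.C
      (Complex.exp (2 * Real.pi * Complex.I * m / h)) : Polynomial ℂ)).prod

/-- `∏_{m ∈ Δ} (1 - 2 cos (m π / h) t)` as a power series. -/
def cosProduct (Δ : Multiset ℕ) (h : ℕ) : ℂ⟦X⟧ :=
  (Δ.map fun m : ℕ => (1 - PowerSeries.C ((2 * Real.cos (m * Real.pi / h) : ℝ) : ℂ) *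
    PowerSeries.X : ℂ⟦X⟧)).prod

/-! ### The distinguished pairs -/

/-- `DistinguishedPair G N X X₀ Y Y₀`: the pair `N ⊲ G` of finite subgroups of `SU₂`, together with
the affine type `X` and finite type `X₀` belonging to restriction, and the affine type `Y` and
finite type `Y₀` belonging to induction. -/
inductive DistinguishedPair :
    Subgroup SU2 → Subgroup SU2 → AffineType → FiniteType → AffineType → FiniteType → Prop
  | dihedral_dihedral (n : ℕ) (hn : 3 ≤ n) :
      DistinguishedPair (binaryDihedral (2 * (n - 1))) (binaryDihedral (n - 1))
        (.A2odd n) (.C n) (.B1 n) (.B n)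
  | dihedral_cyclic (n : ℕ) (hn : 2 ≤ n) :
      DistinguishedPair (binaryDihedral n) (cyclicGroup (2 * n))
        (.D2 n) (.B n) (.C1 n) (.C n)
  | dihedral_cyclic_index_four (n : ℕ) (hn : 2 ≤ n) :
      DistinguishedPair (binaryDihedral (2 * n)) (cyclicGroup (2 * n))
        (.A2even n) (.C n) (.C1 n) (.C n)
  | octahedral_tetrahedral :
      DistinguishedPair binaryOctahedral binaryTetrahedral .E62 .F4 .F41 .F4
  | tetrahedral_dihedral :
      DistinguishedPair binaryTetrahedral (binaryDihedral 2) .D43 .G2 .G21 .G2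
  | dihedral_two_cyclic_two :
      DistinguishedPair (binaryDihedral 2) (cyclicGroup 2) .A22 .A1 .A11 .A1

/-! ### Representation graphs and Poincaré series -/

section Graphs

variable {G : Type} [Group G] {W : Type} [AddCommGroup W] [Module ℂ W]

/-- The restriction of a representation of `G` to a subgroup `N`. -/
abbrev res {M : Type} [AddCommGroup M] [Module ℂ M] (N : Subgroup G)
    (ρ : Representation ℂ G M) : Representation ℂ N M :=
  ρ.comp N.subtype

/-- The representation on `V^{⊗k}`. -/
def tensorPower (V : Representation ℂ G W) (k : ℕ) : Representation ℂ G (⨂[ℂ]^k W) :=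
  (PiTensorProduct.mapMonoidHom (R := ℂ) (s := fun _ : Fin k => W)).comp
    (MonoidHom.pi fun _ => V)

/-- The Poincaré series `∑ₖ dim Hom_G(U, V^{⊗k}) tᵏ`. -/
def poincareSeries {M : Type} [AddCommGroup M] [Module ℂ M] (U : Representation ℂ G M)
    (V : Representation ℂ G W) : ℂ⟦X⟧ :=
  PowerSeries.mk fun k =>
    (Module.finrank ℂ (Representation.IntertwiningMap U (tensorPower V k)) : ℂ)

/-- The Poincaré series `∑ₖ dim (V^{⊗k})^G tᵏ` of the invariants in the tensor algebra. -/
def invariantSeries (V : Representation ℂ G W) : ℂ⟦X⟧ :=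
  PowerSeries.mk fun k => (Module.finrank ℂ (tensorPower V k).invariants : ℂ)

/-- The representation graph of `V` on restrictions to `N` of irreducible `G`-modules: the
irreducible modules `ρ i` (`i ∈ I`) of `G` represent all distinct restrictions, the restriction
of `ρ zero` is the trivial module, and `V ⊗ ρ̌_j = ⨁ᵢ a_{ij} ρ̌_i` where `adj = (a_{ij})`. -/
structure RestrictionGraph (N : Subgroup G) (V : Representation ℂ G W) (I : Type) where
  dim : I → ℕ
  ρ : ∀ i, Representation ℂ G (Fin (dim i) → ℂ)
  irreducible : ∀ i, (ρ i).IsIrreducible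
  distinct : ∀ i j, Nonempty ((res N (ρ i)).Equiv (res N (ρ j))) → i = j
  complete : ∀ (d : ℕ) (σ : Representation ℂ G (Fin d → ℂ)), σ.IsIrreducible →
    ∃ i, Nonempty ((res N σ).Equiv (res N (ρ i)))
  zero : I
  zero_trivial : Nonempty ((res N (ρ zero)).Equiv (Representation.trivial ℂ N ℂ))
  adj : Matrix I I ℕ
  fusion : ∀ j, Nonempty (((res N V).tprod (res N (ρ j))).Equiv
    (Representation.directSum fun p : (i : I) × Fin (adj i j) => res N (ρ p.1)))

/-- The representation graph of `V` on the `G`-modules induced from irreducible `N`-modules: the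
irreducible modules `φ i` (`i ∈ I`) of `N` represent all distinct induced modules, `φ zero` is
the trivial module, and `V ⊗ φ̂_j = ⨁ᵢ b_{ij} φ̂_i` where `adj = (b_{ij})`. -/
structure InductionGraph (N : Subgroup G) (V : Representation ℂ G W) (I : Type) where
  dim : I → ℕ
  φ : ∀ i, Representation ℂ N (Fin (dim i) → ℂ)
  irreducible : ∀ i, (φ i).IsIrreducible
  distinct : ∀ i j, Nonempty (((φ i).ind N.subtype).Equiv ((φ j).ind N.subtype)) → i = j
  complete : ∀ (d : ℕ) (σ : Representation ℂ N (Fin d → ℂ)), σ.IsIrreducible →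
    ∃ i, Nonempty ((σ.ind N.subtype).Equiv ((φ i).ind N.subtype))
  zero : I
  zero_trivial : Nonempty ((φ zero).Equiv (Representation.trivial ℂ N ℂ))
  adj : Matrix I I ℕ
  fusion : ∀ j, Nonempty ((V.tprod ((φ j).ind N.subtype)).Equiv
    (Representation.directSum fun p : (i : I) × Fin (adj i j) => (φ p.1).ind N.subtype))

/-- `m̌ⁱ(t) = ∑ₖ dim Hom_N(ρ̌_i, V^{⊗k}) tᵏ`. -/
def RestrictionGraph.series {N : Subgroup G} {V : Representation ℂ G W} {I : Type}
    (R : RestrictionGraph N V I) (i : I) : ℂ⟦X⟧ :=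
  poincareSeries (res N (R.ρ i)) (res N V)

/-- `m̂ⁱ(t) = ∑ₖ dim Hom_G(φ̂_i, V^{⊗k}) tᵏ`. -/
def InductionGraph.series {N : Subgroup G} {V : Representation ℂ G W} {I : Type}
    (R : InductionGraph N V I) (i : I) : ℂ⟦X⟧ :=
  poincareSeries ((R.φ i).ind N.subtype) V

/-- `Υ` contains exactly one element of each conjugacy class of `G`. -/
def IsConjRepresentatives (Υ : Finset G) : Prop :=
  ∀ g : G, ∃! u, u ∈ Υ ∧ IsConj g u

/-- `∏_{g ∈ Υ ∩ N} (1 - χ_V(g) t)`. -/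
def characterProduct (N : Subgroup G) (V : Representation ℂ G W) (Υ : Finset G) : ℂ⟦X⟧ :=
  open Classical in
  ∏ g ∈ Υ with g ∈ N, (1 - PowerSeries.C (V.character g) * PowerSeries.X)

end Graphs

section Matrices

variable {I : Type} [Fintype I] [DecidableEq I]

/-- `det (I - t Aᵀ)` as a power series in `t`. -/
def detSeries (A : Matrix I I ℕ) : ℂ⟦X⟧ :=
  (1 - (PowerSeries.X : ℂ⟦X⟧) • (A.map fun a : ℕ => (a : ℂ⟦X⟧)).transpose).det

/-- The adjacency matrix of the graph obtained by removing the vertex `o`. -/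
def removeVertex (A : Matrix I I ℕ) (o : I) : Matrix {i // i ≠ o} {i // i ≠ o} ℕ :=
  A.submatrix Subtype.val Subtype.val

/-- The graph with adjacency matrix `A` is the Dynkin diagram with Cartan matrix `C`:
`2 I - A` is `C` up to the labelling `e` of the vertices. -/
def IsDynkin {n : ℕ} (A : Matrix I I ℕ) (C : Matrix (Fin n) (Fin n) ℤ) (e : I ≃ Fin n) : Prop :=
  2 - A.map (fun a : ℕ => (a : ℤ)) = C.submatrix e e

end Matrices

end McKaySlodowy

end

/-! Everything is reduced to one finite piece of data, a `McKaySystem`: pairwise orthogonal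
functions f_i on N, each the restricted character of some G-module, as many as there are G-classes
in N, with a multiplication rule by the character of V. Orthogonality makes the square table of
values invertible (`isUnit_table`), so the f_i form a basis of the G-invariant functions on N.

Since G/N is abelian, irreducible G-modules with a common N-constituent have isomorphic restrictions
(`res_equiv_of_homDim_pos`): G acts on the N-homomorphisms through a commutative quotient, and a
common eigenvector is an isomorphism by Schur's argument. Hence the irreducible restrictions are
exactly the f_i (`exists_irreducible`, `complete`), and their graph is the multiplication matrix. An
irreducible N-module occurs in only one of these restrictions, with multiplicity E_i. Frobenius
reciprocity and self-duality of V then give b_kj E_k = a_jk E_j (`homDim_tprod_ind`), so induction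
yields the transposed diagram, rescaled by E.

The multiplication rule is a linear recursion for the Poincaré series, and Cramer's rule gives the
quotient of determinants (`removeVertex_series`, `series_eq`). The columns of the table diagonalize
the transposed adjacency matrix with eigenvalues χ_V, which gives the product over classes
(`detSeries_eq_prod`).

The cosine products concern Cartan matrices alone. With C = U + L, both unitriangular, the Coxeter
transformation c satisfies U c = -L, so det(q - c) = det(q U + L). For the diagrams here such
determinants depend only on the product of the scalings above and below the diagonal. The symmetric
scaling by z turns the same determinant into det(I - tA) with t = z / (1 + z²), and the duality m ↔
h - m turns eigenvalues into cosines. `HasProfile` records this one determinant; three-term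
recurrences compute it for paths and forks.

It remains to exhibit a system for each pair. For cyclic and dihedral groups the modules are
entrywise powers of the natural one. For T and O the elements are integral quaternions, and the
characters are polynomials in the trace, realized by removing constituents from tensor products. -/

noncomputable section

namespace McKaySlodowy

open Representation

/-! ### Dimensions of intertwiner spaces and decomposition of modules over a finite group. -/

section RepTheory

variable {G : Type} [Group G]
variable {M M' M'' : Type} [AddCommGroup M] [Module ℂ M] [AddCommGroup M'] [Module ℂ M']
  [AddCommGroup M''] [Module ℂ M'']

/-- The dimension of the space of intertwining maps. -/
def homDim (ρ : Representation ℂ G M) (σ : Representation ℂ G M') : ℕ :=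
  Module.finrank ℂ (IntertwiningMap ρ σ)

theorem homDim_eq_sum [Fintype G] [FiniteDimensional ℂ M] [FiniteDimensional ℂ M']
    (ρ : Representation ℂ G M) (σ : Representation ℂ G M') :
    (homDim ρ σ : ℂ) = (Nat.card G : ℂ)⁻¹ * ∑ g, σ.character g * ρ.character g⁻¹ := by
  have : Invertible (Nat.card G : ℂ) := invertibleOfNonzero (by simp)
  rw [homDim, card_inv_mul_sum_char_mul_char_eq_finrank]

theorem homDim_comm [Finite G] [FiniteDimensional ℂ M] [FiniteDimensional ℂ M']
    (ρ : Representation ℂ G M) (σ : Representation ℂ G M') : homDim ρ σ = homDim σ ρ := by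
  have := Fintype.ofFinite G
  have : (homDim ρ σ : ℂ) = homDim σ ρ := by
    rw [homDim_eq_sum, homDim_eq_sum, ← Equiv.sum_comp (Equiv.inv G)]
    simp [mul_comm]
  exact_mod_cast this

theorem homDim_congr [Finite G] [FiniteDimensional ℂ M] [FiniteDimensional ℂ M']
    [FiniteDimensional ℂ M'']
    (ρ : Representation ℂ G M) {σ : Representation ℂ G M'} {τ : Representation ℂ G M''}
    (h : σ.character = τ.character) : homDim ρ σ = homDim ρ τ := by
  have := Fintype.ofFinite G
  have : (homDim ρ σ : ℂ) = homDim ρ τ := by rw [homDim_eq_sum, homDim_eq_sum, h]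
  exact_mod_cast this

theorem char_prod [FiniteDimensional ℂ M] [FiniteDimensional ℂ M']
    (ρ : Representation ℂ G M) (σ : Representation ℂ G M') :
    (ρ.prod σ).character = ρ.character + σ.character := by
  ext g
  exact LinearMap.trace_prodMap' (ρ g) (σ g)

/-- The hypothesis is on characters rather than on a direct sum, so that a splitting known over G
can be used directly after restriction to N. -/
theorem homDim_of_char_add [Finite G] [FiniteDimensional ℂ M] [FiniteDimensional ℂ M']
    [FiniteDimensional ℂ M''] {L : Type} [AddCommGroup L] [Module ℂ L] [FiniteDimensional ℂ L]
    (π : Representation ℂ G L)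
    {ρ : Representation ℂ G M} {σ : Representation ℂ G M'} {τ : Representation ℂ G M''}
    (h : ρ.character = σ.character + τ.character) : homDim π ρ = homDim π σ + homDim π τ := by
  rw [homDim_congr π (h.trans (char_prod σ τ).symm)]
  have := Fintype.ofFinite G
  have : (homDim π (σ.prod τ) : ℂ) = homDim π σ + homDim π τ := by
    rw [homDim_eq_sum, homDim_eq_sum, homDim_eq_sum, char_prod]
    simp [add_mul, Finset.sum_add_distrib, mul_add]
  exact_mod_cast this

/-- Transport of a representation along a linear equivalence. -/
def transport (ρ : Representation ℂ G M) (e : M ≃ₗ[ℂ] M') : Representation ℂ G M' where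
  toFun g := e.toLinearMap ∘ₗ ρ g ∘ₗ e.symm.toLinearMap
  map_one' := by ext; simp
  map_mul' _ _ := by ext; simp

/-- A representation is equivalent to its transport. -/
def transportEquiv (ρ : Representation ℂ G M) (e : M ≃ₗ[ℂ] M') : ρ.Equiv (transport ρ e) :=
  .mk e fun g => by ext; simp [transport]

theorem exists_fin_model [FiniteDimensional ℂ M] (ρ : Representation ℂ G M) :
    ∃ (d : ℕ) (τ : Representation ℂ G (Fin d → ℂ)), Nonempty (ρ.Equiv τ) :=
  ⟨_, _, ⟨transportEquiv ρ (Module.finBasis ℂ M).equivFun⟩⟩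

theorem IsIrreducible.of_equiv {ρ : Representation ℂ G M} {σ : Representation ℂ G M'}
    (e : ρ.Equiv σ) (h : ρ.IsIrreducible) : σ.IsIrreducible := by
  rw [irreducible_iff_isSimpleModule_asModule] at h ⊢
  have e' : ρ.asModule ≃ₗ[MonoidAlgebra ℂ G] σ.asModule :=
    LinearEquiv.ofBijective (IntertwiningMap.equivLinearMapAsModule ρ σ e.toIntertwiningMap)
      e.bijective
  exact IsSimpleModule.congr e'.symm

theorem nontrivial_of_irreducible {ρ : Representation ℂ G M} (h : ρ.IsIrreducible) :
    Nontrivial M := by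
  by_contra hM
  rw [not_nontrivial_iff_subsingleton] at hM
  obtain ⟨p, q, hpq⟩ := h.exists_pair_ne
  apply hpq
  ext x
  rw [Subsingleton.elim x 0]
  exact ⟨fun _ => q.toSubmodule.zero_mem, fun _ => p.toSubmodule.zero_mem⟩

theorem homDim_pos_iff [FiniteDimensional ℂ M] [FiniteDimensional ℂ M']
    (ρ : Representation ℂ G M) (σ : Representation ℂ G M') :
    0 < homDim ρ σ ↔ ∃ f : IntertwiningMap ρ σ, f ≠ 0 :=
  Module.finrank_pos_iff_exists_ne_zero

/-- The inclusion of a subrepresentation. -/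
def subInclusion {ρ : Representation ℂ G M} (p : Subrepresentation ρ) :
    IntertwiningMap p.toRepresentation ρ :=
  ⟨p.toSubmodule.subtype, fun g => by ext; rfl⟩

/-- A submodule of minimal dimension, reached by descent. The model on `Fin d → ℂ` is needed because
the graphs quantify over such modules only. -/
theorem exists_irreducible_injective [FiniteDimensional ℂ M] [Nontrivial M]
    (ρ : Representation ℂ G M) :
    ∃ (d : ℕ) (σ : Representation ℂ G (Fin d → ℂ)) (f : IntertwiningMap σ ρ),
      σ.IsIrreducible ∧ Function.Injective f := by
  induction hn : Module.finrank ℂ M using Nat.strong_induction_on generalizing M with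
  | _ n ih =>
    by_cases h : ∀ p : Subrepresentation ρ, p = ⊥ ∨ p = ⊤
    · obtain ⟨d, τ, ⟨e⟩⟩ := exists_fin_model ρ
      have hirr : ρ.IsIrreducible := {
        exists_pair_ne := ⟨⊥, ⊤, fun hbt => by
          obtain ⟨x, hx⟩ := exists_ne (0 : M)
          have : x ∈ (⊥ : Subrepresentation ρ) := by rw [hbt]; exact Submodule.mem_top
          exact hx ((Submodule.mem_bot ℂ).1 this)⟩
        eq_bot_or_eq_top := h }
      exact ⟨d, τ, e.symm.toIntertwiningMap, IsIrreducible.of_equiv e hirr, e.symm.injective⟩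
    · push Not at h
      obtain ⟨p, hb, ht⟩ := h
      have hb' : p.toSubmodule ≠ ⊥ := fun h => hb (Subrepresentation.toSubmodule_injective h)
      have ht' : p.toSubmodule ≠ ⊤ := fun h => ht (Subrepresentation.toSubmodule_injective h)
      have : Nontrivial p.toSubmodule := (Submodule.nontrivial_iff_ne_bot).2 hb'
      obtain ⟨d, σ, f, h1, h2⟩ := ih _ (hn ▸ Submodule.finrank_lt ht') p.toRepresentation rfl
      refine ⟨d, σ, (subInclusion p).comp f, h1, ?_⟩
      exact (Subtype.val_injective).comp h2

theorem exists_complement [Finite G] [FiniteDimensional ℂ M] [FiniteDimensional ℂ M']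
    {σ : Representation ℂ G M'} {ρ : Representation ℂ G M} (f : IntertwiningMap σ ρ)
    (hf : Function.Injective f) :
    ∃ (d : ℕ) (τ : Representation ℂ G (Fin d → ℂ)), Nonempty (ρ.Equiv (σ.prod τ)) := by
  -- Maschke: invertibility of the group order makes the lattice of subrepresentations complemented.
  have : NeZero (Nat.card G : ℂ) := ⟨by exact_mod_cast Nat.card_pos.ne'⟩
  obtain ⟨q, hq⟩ := exists_isCompl f.range
  obtain ⟨d, τ, ⟨e⟩⟩ := exists_fin_model q.toRepresentation
  refine ⟨d, τ, ⟨Representation.Equiv.symm ?_⟩⟩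
  have hc : IsCompl (LinearMap.range f.toLinearMap) q.toSubmodule := by
    constructor
    · rw [Submodule.disjoint_def]
      intro x hx hx'
      have : x ∈ f.range ⊓ q := ⟨hx, hx'⟩
      rw [hq.inf_eq_bot] at this
      exact this
    · rw [codisjoint_iff]
      have := congr_arg Subrepresentation.toSubmodule hq.sup_eq_top
      exact this
  let F : IntertwiningMap (σ.prod τ) ρ :=
    ⟨f.toLinearMap.coprod (q.toSubmodule.subtype ∘ₗ e.symm.toLinearMap), fun g => by
      refine LinearMap.ext fun x => ?_
      have h1 := f.isIntertwining _ _ g x.1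
      have h2 := ((subInclusion q).comp e.symm.toIntertwiningMap).isIntertwining _ _ g x.2
      rw [LinearMap.comp_apply, LinearMap.comp_apply, LinearMap.coprod_apply,
        LinearMap.coprod_apply, map_add]
      exact congr_arg₂ (· + ·) h1 h2⟩
  refine F.ofBijective ⟨?_, ?_⟩
  · refine (injective_iff_map_eq_zero F).2 fun x hx => ?_
    have hx' : f x.1 + (e.symm x.2 : M) = 0 := hx
    have h1 : f x.1 ∈ LinearMap.range f.toLinearMap := ⟨x.1, rfl⟩
    have h2 : f x.1 = 0 := by
      refine (Submodule.disjoint_def.1 hc.disjoint) _ h1 ?_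
      rw [eq_neg_of_add_eq_zero_left hx']
      exact q.toSubmodule.neg_mem (e.symm x.2).2
    rw [h2, zero_add] at hx'
    have h3 : x.1 = 0 := (injective_iff_map_eq_zero f).1 hf _ h2
    have h4 : x.2 = 0 := by
      have : e.symm x.2 = 0 := Subtype.ext hx'
      exact (injective_iff_map_eq_zero e.symm).1 e.symm.injective _ this
    exact Prod.ext h3 h4
  · intro y
    obtain ⟨a, ha, b, hb, hab⟩ := Submodule.mem_sup.1 (hc.sup_eq_top ▸ Submodule.mem_top : y ∈ _)
    obtain ⟨x, rfl⟩ := ha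
    refine ⟨(x, e ⟨b, hb⟩), ?_⟩
    change f x + (e.symm (e ⟨b, hb⟩) : M) = y
    rw [Representation.Equiv.symm_apply_apply]
    exact hab

theorem exists_char_add_of_homDim_pos [Finite G] [FiniteDimensional ℂ M] [FiniteDimensional ℂ M']
    {σ : Representation ℂ G M'} {ρ : Representation ℂ G M} (hσ : σ.IsIrreducible)
    (h : 0 < homDim σ ρ) :
    ∃ (d : ℕ) (τ : Representation ℂ G (Fin d → ℂ)), Nonempty (ρ.Equiv (σ.prod τ)) := by
  obtain ⟨f, hf⟩ := (homDim_pos_iff _ _).1 h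
  exact exists_complement f ((IsIrreducible.injective_or_eq_zero f).resolve_right hf)

theorem homDim_zero_iff_subsingleton [Finite G] [FiniteDimensional ℂ M]
    (ρ : Representation ℂ G M)
    (h : ∀ (d : ℕ) (σ : Representation ℂ G (Fin d → ℂ)), σ.IsIrreducible → homDim σ ρ = 0) :
    Subsingleton M := by
  by_contra hM
  rw [not_subsingleton_iff_nontrivial] at hM
  obtain ⟨d, σ, f, h1, h2⟩ := exists_irreducible_injective ρ
  have := nontrivial_of_irreducible h1
  refine ((homDim_pos_iff σ ρ).2 ⟨f, fun hf => ?_⟩).ne' (h d σ h1)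
  obtain ⟨x, hx⟩ := exists_ne (0 : Fin d → ℂ)
  exact hx (h2 (by rw [hf]; simp))

/-- Equivalences of representations are compatible with direct products. -/
def prodCongr {L L' : Type} [AddCommGroup L] [Module ℂ L] [AddCommGroup L'] [Module ℂ L']
    {ρ : Representation ℂ G M} {σ : Representation ℂ G M'}
    {ρ' : Representation ℂ G L} {σ' : Representation ℂ G L'}
    (e : ρ.Equiv σ) (e' : ρ'.Equiv σ') : (ρ.prod ρ').Equiv (σ.prod σ') :=
  .mk (e.toLinearEquiv.prodCongr e'.toLinearEquiv) fun g => by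
    refine LinearMap.ext fun x => Prod.ext ?_ ?_
    · exact e.toIntertwiningMap.isIntertwining _ _ g x.1
    · exact e'.toIntertwiningMap.isIntertwining _ _ g x.2

/-- A common irreducible summand is split off on both sides; all multiplicities drop equally, and
the dimension decreases. This is the tool by which every isomorphism of modules is obtained from
numbers. -/
theorem equiv_of_homDim_eq [Finite G] [FiniteDimensional ℂ M] [FiniteDimensional ℂ M']
    (ρ : Representation ℂ G M) (ρ' : Representation ℂ G M')
    (h : ∀ (d : ℕ) (σ : Representation ℂ G (Fin d → ℂ)), σ.IsIrreducible →
      homDim σ ρ = homDim σ ρ') : Nonempty (ρ.Equiv ρ') := by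
  induction hn : Module.finrank ℂ M using Nat.strong_induction_on generalizing M M' with
  | _ n ih =>
    rcases subsingleton_or_nontrivial M with hM | hM
    · have h0 : ∀ (d : ℕ) (σ : Representation ℂ G (Fin d → ℂ)), σ.IsIrreducible →
          homDim σ ρ' = 0 := by
        intro d σ hσ
        rw [← h d σ hσ, homDim, Module.finrank_eq_zero_iff_of_free]
        refine ⟨fun f g => ?_⟩
        ext x
        exact Subsingleton.elim _ _
      have := homDim_zero_iff_subsingleton ρ' h0
      exact ⟨.mk (0 : M ≃ₗ[ℂ] M') fun g => by ext x; exact Subsingleton.elim _ _⟩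
    · obtain ⟨d, σ, f, h1, h2⟩ := exists_irreducible_injective ρ
      have := nontrivial_of_irreducible h1
      have hpos : 0 < homDim σ ρ := (homDim_pos_iff σ ρ).2 ⟨f, fun hf => by
        obtain ⟨x, hx⟩ := exists_ne (0 : Fin d → ℂ)
        exact hx (h2 (by rw [hf]; simp))⟩
      obtain ⟨a, τ, ⟨e⟩⟩ := exists_char_add_of_homDim_pos h1 hpos
      obtain ⟨b, τ', ⟨e'⟩⟩ := exists_char_add_of_homDim_pos h1 (h d σ h1 ▸ hpos)
      have hfin : Module.finrank ℂ (Fin a → ℂ) < n := by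
        rw [← hn, e.toLinearEquiv.finrank_eq, Module.finrank_prod]
        have := Module.finrank_pos (R := ℂ) (M := Fin d → ℂ)
        omega
      obtain ⟨e''⟩ := ih _ hfin τ τ' (fun k π hπ => by
        have h1 := homDim_of_char_add π ((char_iso e).trans (char_prod σ τ))
        have h2 := homDim_of_char_add π ((char_iso e').trans (char_prod σ τ'))
        have h3 := h k π hπ
        omega) rfl
      exact ⟨e.trans ((prodCongr (Representation.Equiv.refl σ) e'').trans e'.symm)⟩

theorem equiv_of_char_eq [Finite G] [FiniteDimensional ℂ M] [FiniteDimensional ℂ M']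
    {ρ : Representation ℂ G M} {ρ' : Representation ℂ G M'}
    (h : ρ.character = ρ'.character) : Nonempty (ρ.Equiv ρ') :=
  equiv_of_homDim_eq ρ ρ' fun _ σ _ => homDim_congr σ h

theorem char_directSum {ι : Type} [Fintype ι] {L : ι → Type} [∀ i, AddCommGroup (L i)]
    [∀ i, Module ℂ (L i)] [∀ i, FiniteDimensional ℂ (L i)] (ρ : ∀ i, Representation ℂ G (L i))
    (g : G) : (Representation.directSum ρ).character g = ∑ i, (ρ i).character g := by
  classical
  -- The block-diagonal operator is a sum of inclusion ∘ block ∘ projection; cyclicity of the trace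
  -- then moves the inclusion next to the projection.
  have hid : Representation.directSum ρ g = ∑ i, (DirectSum.lof ℂ ι L i) ∘ₗ
      ((ρ i g) ∘ₗ DirectSum.component ℂ ι L i) := by
    refine DirectSum.linearMap_ext _ fun i => LinearMap.ext fun x => ?_
    rw [LinearMap.comp_apply, LinearMap.comp_apply, LinearMap.sum_apply,
      Finset.sum_eq_single i]
    · simp only [LinearMap.comp_apply, DirectSum.component.lof_self, directSum_apply,
        DirectSum.lmap_lof]
    · intro j _ hj
      simp only [LinearMap.comp_apply, DirectSum.component.of, dif_neg hj.symm, map_zero]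
    · simp
  rw [character, hid, map_sum]
  refine Finset.sum_congr rfl fun i _ => ?_
  rw [LinearMap.trace_comp_comm', LinearMap.comp_assoc]
  have : DirectSum.component ℂ ι L i ∘ₗ DirectSum.lof ℂ ι L i = LinearMap.id := by
    ext x
    simp
  rw [this]
  rfl

instance finiteDimensional_directSum {ι : Type} [Fintype ι] {L : ι → Type}
    [∀ i, AddCommGroup (L i)]
    [∀ i, Module ℂ (L i)] [∀ i, FiniteDimensional ℂ (L i)] :
    FiniteDimensional ℂ (DirectSum ι L) := inferInstance

instance finiteDimensional_indV [Finite G] (N : Subgroup G) [FiniteDimensional ℂ M]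
    (φ : Representation ℂ N M) : FiniteDimensional ℂ (IndV N.subtype φ) := by
  have : FiniteDimensional ℂ (MonoidAlgebra ℂ G) := inferInstance
  exact inferInstance

/-- Frobenius reciprocity. -/
theorem homDim_ind (N : Subgroup G) (φ : Representation ℂ N M) (W : Representation ℂ G M') :
    homDim (φ.ind N.subtype) W = homDim φ (res N W) := by
  refine LinearEquiv.finrank_eq
    { toFun f := ⟨f.toLinearMap ∘ₗ IndV.mk N.subtype φ 1, fun g ↦ by
        ext x
        have := (f.isIntertwining _ _ (g : G) (IndV.mk N.subtype φ 1 x)).symm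
        simp_all [← Coinvariants.mk_inv_tmul]⟩
      map_add' _ _ := rfl
      map_smul' _ _ := rfl
      -- The class of `h ⊗ x` goes to `W h⁻¹ (f x)`; evaluation at `h = 1` recovers `f`.
      invFun f := ⟨Representation.Coinvariants.lift _
        (TensorProduct.lift <| (Finsupp.lift _ _ _ fun h => W h⁻¹ ∘ₗ f.toLinearMap) ∘ₗ
          (MonoidAlgebra.coeffLinearEquiv ℂ).toLinearMap)
        fun g ↦ by
          ext h x
          have := f.isIntertwining _ _ g x
          simp_all [Representation.ofMulAction_single, mul_inv_rev], fun g ↦ by ext; simp⟩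
      left_inv f := by
        ext h a
        simpa using (f.isIntertwining _ _ h⁻¹ (IndV.mk N.subtype φ 1 a)).symm
      right_inv _ := by ext; simp }

/-! ### Clifford theory over an abelian quotient. -/

/-- Conjugation `f ↦ ρ g ∘ f ∘ σ g⁻¹` on the space of `N`-homomorphisms. -/
def conjHom (N : Subgroup G) [N.Normal] (σ : Representation ℂ G M) (ρ : Representation ℂ G M') :
    Representation ℂ G (IntertwiningMap (res N σ) (res N ρ)) where
  toFun g :=
    { toFun f := ⟨ρ g ∘ₗ f.toLinearMap ∘ₗ σ g⁻¹, fun n => by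
        ext v
        have hn : g⁻¹ * n * g ∈ N := by
          simpa using (inferInstance : N.Normal).conj_mem n n.2 g⁻¹
        have h1 := f.isIntertwining _ _ ⟨_, hn⟩ (σ g⁻¹ v)
        have h2 : σ (g⁻¹ * n * g) (σ g⁻¹ v) = σ g⁻¹ (σ n v) := by
          rw [← Module.End.mul_apply, ← map_mul, ← Module.End.mul_apply, ← map_mul]
          simp
        have h3 : ρ g (ρ (g⁻¹ * n * g) (f (σ g⁻¹ v))) = ρ n (ρ g (f (σ g⁻¹ v))) := by
          rw [← Module.End.mul_apply, ← map_mul, ← Module.End.mul_apply, ← map_mul]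
          simp [mul_assoc]
        change f (σ (g⁻¹ * n * g) (σ g⁻¹ v)) = ρ (g⁻¹ * n * g) (f (σ g⁻¹ v)) at h1
        change ρ g (f (σ g⁻¹ (σ n v))) = ρ n (ρ g (f (σ g⁻¹ v)))
        rw [← h3, ← h1, h2]⟩
      map_add' f f' := by ext v; simp
      map_smul' c f := by ext v; simp }
  map_one' := by ext f v; simp
  map_mul' g h := by ext f v; simp

theorem conjHom_apply (N : Subgroup G) [N.Normal] (σ : Representation ℂ G M)
    (ρ : Representation ℂ G M') (g : G) (f : IntertwiningMap (res N σ) (res N ρ)) (v : M) :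
    conjHom N σ ρ g f v = ρ g (f (σ g⁻¹ v)) := rfl

/-- Elements of N act trivially on N-homomorphisms, so the conjugation action factors through a
commutative quotient. -/
theorem conjHom_comm (N : Subgroup G) [N.Normal] (hN : ∀ g h : G, g * h * g⁻¹ * h⁻¹ ∈ N)
    (σ : Representation ℂ G M) (ρ : Representation ℂ G M') (g h : G) :
    conjHom N σ ρ (g * h) = conjHom N σ ρ (h * g) := by
  have hn := hN g h
  have h0 : g * h = (g * h * g⁻¹ * h⁻¹) * (h * g) := by group
  have h1 : conjHom N σ ρ (g * h * g⁻¹ * h⁻¹) = 1 := by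
    ext f v
    have := f.isIntertwining _ _ ⟨_, hn⟩ (σ (g * h * g⁻¹ * h⁻¹)⁻¹ v)
    change f (σ (g * h * g⁻¹ * h⁻¹) (σ (g * h * g⁻¹ * h⁻¹)⁻¹ v)) =
      ρ (g * h * g⁻¹ * h⁻¹) (f (σ (g * h * g⁻¹ * h⁻¹)⁻¹ v)) at this
    change ρ (g * h * g⁻¹ * h⁻¹) (f (σ (g * h * g⁻¹ * h⁻¹)⁻¹ v)) = f v
    rw [← this, self_inv_apply]
  rw [h0, map_mul, h1, one_mul]

/-- A commuting family of operators on the space of N-homomorphisms has a common eigenvector f. It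
intertwines the two G-actions up to scalars, so its kernel and range are G-stable and Schur's
argument applies, although the restrictions to N may be reducible. -/
theorem res_equiv_of_homDim_pos [FiniteDimensional ℂ M] [FiniteDimensional ℂ M']
    (N : Subgroup G) [N.Normal] (hN : ∀ g h : G, g * h * g⁻¹ * h⁻¹ ∈ N)
    {σ : Representation ℂ G M} {ρ : Representation ℂ G M'} (hσ : σ.IsIrreducible)
    (hρ : ρ.IsIrreducible) (h : 0 < homDim (res N σ) (res N ρ)) :
    Nonempty ((res N σ).Equiv (res N ρ)) := by
  obtain ⟨f₀, hf₀⟩ := (homDim_pos_iff _ _).1 h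
  have : Nontrivial (IntertwiningMap (res N σ) (res N ρ)) := ⟨f₀, 0, hf₀⟩
  obtain ⟨d, S, j, hS, hj⟩ := exists_irreducible_injective (conjHom N σ ρ)
  have := nontrivial_of_irreducible hS
  obtain ⟨x, hx⟩ := exists_ne (0 : Fin d → ℂ)
  -- Inside an irreducible submodule of the space of N-homomorphisms each `S g` commutes with the
  -- action, hence is a scalar by Schur's lemma over ℂ.
  have hscal : ∀ g, ∃ c : ℂ, S g x = c • x := by
    intro g
    let T : IntertwiningMap S S := ⟨S g, fun h => by
      refine LinearMap.ext fun y => ?_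
      change S g (S h y) = S h (S g y)
      rw [← Module.End.mul_apply, ← map_mul, ← Module.End.mul_apply, ← map_mul]
      apply hj
      rw [j.isIntertwining, j.isIntertwining, conjHom_comm N hN]⟩
    obtain ⟨c, hc⟩ :=
      (IsIrreducible.algebraMap_intertwiningMap_bijective_of_isAlgClosed (ρ := S)).2 T
    refine ⟨c, ?_⟩
    have := congr_arg (fun F : IntertwiningMap S S => F x) hc
    exact this.symm
  choose c hc using hscal
  set f := j x with hf
  have hf0 : f ≠ 0 := fun h0 => hx (hj (by rw [← hf, h0, map_zero]))
  -- Semi-invariance is what makes the kernel and the range of `f`, a priori only N-stable, stable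
  -- under G.
  have key : ∀ g v, ρ g (f v) = c g • f (σ g v) := by
    intro g v
    have h1 : conjHom N σ ρ g f = c g • f := by
      rw [hf, ← j.isIntertwining, hc, map_smul]
    have h2 := congr_arg (fun F : IntertwiningMap (res N σ) (res N ρ) => F (σ g v)) h1
    simp only [conjHom_apply, IntertwiningMap.smul_apply, inv_self_apply] at h2
    exact h2
  have hc0 : ∀ g, c g ≠ 0 := by
    intro g h0
    apply hf0
    ext v
    have := key g v
    rw [h0, zero_smul] at this
    have h2 := congr_arg (ρ g⁻¹) this
    rw [inv_self_apply, map_zero] at h2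
    exact h2
  let K : Subrepresentation σ := ⟨LinearMap.ker f.toLinearMap, fun g v hv => by
    have hv' : f v = 0 := hv
    have := key g v
    rw [hv', map_zero] at this
    exact (smul_eq_zero.1 this.symm).resolve_left (hc0 g)⟩
  let R : Subrepresentation ρ := ⟨LinearMap.range f.toLinearMap, by
    rintro g _ ⟨v, rfl⟩
    exact ⟨c g • σ g v, by rw [map_smul]; exact (key g v).symm⟩⟩
  refine ⟨IntertwiningMap.ofBijective f ⟨?_, ?_⟩⟩
  · rcases hσ.eq_bot_or_eq_top K with h1 | h1
    · refine (injective_iff_map_eq_zero f).2 fun v hv => ?_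
      have : v ∈ K := hv
      rw [h1] at this
      exact this
    · exfalso
      apply hf0
      ext v
      have : v ∈ K := by rw [h1]; exact Submodule.mem_top
      exact this
  · rcases hρ.eq_bot_or_eq_top R with h1 | h1
    · exfalso
      apply hf0
      ext v
      have : f v ∈ R := ⟨v, rfl⟩
      rw [h1] at this
      exact this
    · intro y
      have : y ∈ R := by rw [h1]; exact Submodule.mem_top
      exact this

end RepTheory

open Representation

/-! ### Characters of tensor powers. -/

section TensorPowers

variable {G : Type} [Group G] {W : Type} [AddCommGroup W] [Module ℂ W]

theorem tensorPower_tprod (V : Representation ℂ G W) (k : ℕ) (g : G) (a : Fin k → W) :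
    tensorPower V k g (PiTensorProduct.tprod ℂ a) = PiTensorProduct.tprod ℂ fun i => V g (a i) :=
  PiTensorProduct.map_tprod (fun _ : Fin k => V g) a

/-- `V^{⊗(k+1)} ≅ V^{⊗k} ⊗ V`. -/
def tensorPowerSucc (V : Representation ℂ G W) (k : ℕ) :
    ((tensorPower V k).tprod (tensorPower V 1)).Equiv (tensorPower V (k + 1)) :=
  .mk TensorPower.mulEquiv fun g => by
    ext a b
    simp only [LinearMap.compMultilinearMap_apply, TensorProduct.AlgebraTensorModule.curry_apply,
      TensorProduct.curry_apply, LinearMap.coe_restrictScalars, LinearMap.comp_apply,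
      LinearEquiv.coe_coe, Representation.tprod_apply, TensorProduct.map_tmul, tensorPower_tprod]
    have h (a : Fin k → W) (b : Fin 1 → W) := TensorPower.tprod_mul_tprod ℂ a b
    simp only [TensorPower.gMul_def] at h
    rw [h, h, tensorPower_tprod]
    congr 1
    funext i
    refine Fin.addCases (fun i => ?_) (fun i => ?_) i <;> simp

/-- `V^{⊗1} ≅ V`. -/
def tensorPowerOne (V : Representation ℂ G W) : (tensorPower V 1).Equiv V :=
  .mk (PiTensorProduct.subsingletonEquiv (0 : Fin 1)) fun g => by
    ext a
    simp [tensorPower_tprod]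

theorem char_tensorPower [FiniteDimensional ℂ W] (V : Representation ℂ G W) (k : ℕ) (g : G) :
    (tensorPower V k).character g = V.character g ^ k := by
  induction k with
  | zero =>
    have : tensorPower V 0 g = 1 := by
      ext a
      simp only [LinearMap.compMultilinearMap_apply, tensorPower_tprod]
      simp only [Module.End.one_apply]
      congr 1
      exact Subsingleton.elim _ _
    rw [character, this, LinearMap.trace_one,
      (PiTensorProduct.isEmptyEquiv (Fin 0) (R := ℂ) (s := fun _ => W)).finrank_eq]
    simp
  | succ k ih =>
    rw [← char_iso (tensorPowerSucc V k), char_tensor, char_iso (tensorPowerOne V), Pi.mul_apply,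
      ih, pow_succ]

end TensorPowers

section Adjugate

/-- The form of the diagonal cofactor for an arbitrary index type, where deleting `o` is a subtype.
Replacing row `o` by a unit vector makes the matrix block triangular. -/
theorem adjugate_self_eq_det_submatrix {I R : Type} [Fintype I] [DecidableEq I] [CommRing R]
    (M : Matrix I I R) (o : I) :
    M.adjugate o o = (M.submatrix (Subtype.val : {i // i ≠ o} → I) Subtype.val).det := by
  rw [Matrix.adjugate_apply,
    Matrix.twoBlockTriangular_det' (M.updateRow o (Pi.single o 1)) (fun i => i = o)]
  · refine (congr_arg₂ (· * ·) ?_ ?_).trans (one_mul _)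
    · have key : ∀ (_ : Fintype {i // i = o}) (N : Matrix {i // i = o} {i // i = o} R),
          N.det = N ⟨o, rfl⟩ ⟨o, rfl⟩ := fun _ N => by
        let _ : Unique {i // i = o} := ⟨⟨⟨o, rfl⟩⟩, fun i => Subtype.ext i.2⟩
        rw [Matrix.det_unique]
        rfl
      refine (key _ _).trans ?_
      simp [Matrix.toSquareBlockProp]
    · congr 1
      ext i j
      simp [Matrix.toSquareBlockProp, Matrix.updateRow_ne i.2]
  · rintro i rfl j hj
    simp [hj]

end Adjugate

open Representation

theorem natCard_cast_ne_zero (G : Type) [Group G] [Finite G] : (Nat.card G : ℂ) ≠ 0 := by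
  exact_mod_cast Nat.card_pos.ne'

/-- Invariance of one character under inversion makes the pairing bilinear without conjugation, so
that later orthogonality sums need no complex conjugates. -/
theorem card_mul_homDim {G : Type} [Group G] [Fintype G] {M M' : Type} [AddCommGroup M]
    [Module ℂ M] [AddCommGroup M'] [Module ℂ M'] [FiniteDimensional ℂ M] [FiniteDimensional ℂ M']
    (φ : Representation ℂ G M) (χ : Representation ℂ G M')
    (hχ : ∀ g, χ.character g⁻¹ = χ.character g) :
    (Nat.card G : ℂ) * homDim φ χ = ∑ g, φ.character g * χ.character g := by
  rw [homDim_eq_sum, ← mul_assoc, mul_inv_cancel₀ (by exact_mod_cast Nat.card_pos.ne'), one_mul,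
    ← Equiv.sum_comp (Equiv.inv G)]
  simp [hχ, mul_comm]

theorem homDim_of_char_sum {G : Type} [Group G] [Finite G] {M M' : Type} [AddCommGroup M]
    [Module ℂ M] [AddCommGroup M'] [Module ℂ M'] [FiniteDimensional ℂ M] [FiniteDimensional ℂ M']
    {ι : Type} [Fintype ι] {L : ι → Type} [∀ i, AddCommGroup (L i)] [∀ i, Module ℂ (L i)]
    [∀ i, FiniteDimensional ℂ (L i)]
    (φ : Representation ℂ G M) (χ : Representation ℂ G M') (ρ : ∀ i, Representation ℂ G (L i))
    (a : ι → ℕ) (h : ∀ g, χ.character g = ∑ i, a i * (ρ i).character g) :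
    homDim φ χ = ∑ i, a i * homDim φ (ρ i) := by
  have := Fintype.ofFinite G
  have : (homDim φ χ : ℂ) = ∑ i, a i * (homDim φ (ρ i) : ℂ) := by
    simp_rw [homDim_eq_sum, h, Finset.sum_mul, Finset.mul_sum]
    rw [Finset.sum_comm]
    refine Finset.sum_congr rfl fun i _ => Finset.sum_congr rfl fun g _ => by ring
  exact_mod_cast this

theorem char_directSum_sigma {G : Type} [Group G]
    {ι : Type} [Fintype ι] {L : ι → Type} [∀ i, AddCommGroup (L i)] [∀ i, Module ℂ (L i)]
    [∀ i, FiniteDimensional ℂ (L i)] (ρ : ∀ i, Representation ℂ G (L i)) (a : ι → ℕ) (g : G) :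
    (Representation.directSum fun p : (i : ι) × Fin (a i) => ρ p.1).character g =
      ∑ i, a i * (ρ i).character g := by
  rw [char_directSum, Fintype.sum_sigma]
  refine Finset.sum_congr rfl fun i _ => ?_
  change ∑ _ : Fin (a i), (ρ i).character g = _
  simp

theorem char_trivial {G : Type} [Group G] (g : G) :
    (Representation.trivial ℂ G ℂ).character g = 1 := by
  have : (Representation.trivial ℂ G ℂ) g = 1 := by ext; simp
  rw [character, this, LinearMap.trace_one]
  simp

/-! ### McKay systems and the graph of restrictions. -/

/-- A system of class functions `f i` on a normal subgroup `N` with abelian quotient that spans the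
`G`-invariant functions on `N`, together with the multiplication rules by the character of `V`. -/
structure McKaySystem {G : Type} [Group G] (N : Subgroup G) [Fintype N] {W : Type}
    [AddCommGroup W] [Module ℂ W] (V : Representation ℂ G W) (r : ℕ) where
  /-- the restricted characters -/
  f : Fin (r + 1) → N → ℂ
  /-- their norms -/
  ν : Fin (r + 1) → ℕ
  /-- representatives of the `G`-classes in `N` -/
  rep : Fin (r + 1) → N
  /-- multiplication by `V` -/
  A : Matrix (Fin (r + 1)) (Fin (r + 1)) ℕ
  comm : ∀ g h : G, g * h * g⁻¹ * h⁻¹ ∈ N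
  f_inv : ∀ i n, f i n⁻¹ = f i n
  V_inv : ∀ g, V.character g⁻¹ = V.character g
  conj_rep : ∀ n : N, ∃ (i : Fin (r + 1)) (g : G), (n : G) = g * rep i * g⁻¹
  ν_pos : ∀ i, 0 < ν i
  orth : ∀ i j, ∑ n, f i n * f j n = if i = j then (Nat.card N : ℂ) * ν i else 0
  f_zero : ∀ n, f 0 n = 1
  fusion : ∀ j (n : N), V.character n * f j n = ∑ i, A i j * f i n
  real : ∀ i, ∃ (d : ℕ) (U : Representation ℂ G (Fin d → ℂ)), ∀ n : N, U.character n = f i n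
  -- Excludes a proper constituent whose restriction is the fraction `m / ν i` of `f i`. The norm of
  -- that fraction is `m ^ 2 / ν i`, an integer, whence the divisibility.
  rigid : ∀ (i : Fin (r + 1)) (m d : ℕ) (U : Representation ℂ G (Fin d → ℂ)), 0 < m → m ≤ ν i →
    ν i ∣ m ^ 2 → (∀ n : N, ν i * U.character n = m * f i n) → m = ν i

namespace McKaySystem

variable {G : Type} [Group G] {N : Subgroup G} [Fintype N] {W : Type}
  [AddCommGroup W] [Module ℂ W] {V : Representation ℂ G W} {r : ℕ}
  (S : McKaySystem N V r)

include S

theorem f_conj (i : Fin (r + 1)) {m n : N} (g : G) (h : (m : G) = g * n * g⁻¹) :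
    S.f i m = S.f i n := by
  obtain ⟨d, U, hU⟩ := S.real i
  rw [← hU, ← hU, h, char_conj]

theorem sum_coeff (c : Fin (r + 1) → ℂ) (j : Fin (r + 1)) :
    ∑ n, (∑ i, c i * S.f i n) * S.f j n = c j * (Nat.card N * S.ν j) := by
  simp_rw [Finset.sum_mul]
  rw [Finset.sum_comm]
  simp_rw [mul_assoc, ← Finset.mul_sum, S.orth]
  simp

theorem coeff_unique {c c' : Fin (r + 1) → ℂ}
    (h : ∀ n, ∑ i, c i * S.f i n = ∑ i, c' i * S.f i n) : c = c' := by
  funext j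
  have h1 := S.sum_coeff c j
  simp_rw [h] at h1
  rw [S.sum_coeff] at h1
  exact (mul_right_cancel₀ (mul_ne_zero (natCard_cast_ne_zero N) (by exact_mod_cast (S.ν_pos j).ne')) h1).symm

theorem f_injective {i j : Fin (r + 1)} (h : ∀ n, S.f i n = S.f j n) : i = j := by
  have := S.coeff_unique (c := Pi.single i 1) (c' := Pi.single j 1) fun n => by
    simpa [Pi.single_apply] using h n
  by_contra hij
  have h2 := congr_fun this i
  simp [hij] at h2

/-- The values on the class representatives. -/
def table : Matrix (Fin (r + 1)) (Fin (r + 1)) ℂ := Matrix.of fun i j => S.f i (S.rep j)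

/-- A dependence among the rows on representatives propagates to all of N by invariance and
contradicts orthogonality. The table is square, so the `f i` also span the invariant functions. -/
theorem isUnit_table : IsUnit S.table := by
  rw [← Matrix.vecMul_injective_iff_isUnit]
  intro c c' h
  apply S.coeff_unique
  intro n
  obtain ⟨k, g, hg⟩ := S.conj_rep n
  simp_rw [S.f_conj _ g hg]
  exact congr_fun h k

theorem exists_coeff (h : N → ℂ) (hinv : ∀ (m n : N) (g : G), (m : G) = g * n * g⁻¹ → h m = h n) :
    ∃ c : Fin (r + 1) → ℂ, ∀ n, h n = ∑ i, c i * S.f i n := by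
  obtain ⟨c, hc⟩ := Matrix.vecMul_surjective_iff_isUnit.2 S.isUnit_table fun j => h (S.rep j)
  refine ⟨c, fun n => ?_⟩
  obtain ⟨k, g, hg⟩ := S.conj_rep n
  simp_rw [S.f_conj _ g hg, hinv _ _ g hg]
  exact (congr_fun hc k).symm

theorem char_inv {M : Type} [AddCommGroup M] [Module ℂ M] (U : Representation ℂ G M)
    {i : Fin (r + 1)} (hU : ∀ n : N, U.character n = S.f i n) (n : N) :
    (res N U).character n⁻¹ = (res N U).character n := by
  change U.character (n⁻¹ : N) = U.character n
  rw [hU, hU, S.f_inv]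

theorem card_mul_homDim_char {M M' : Type} [AddCommGroup M] [Module ℂ M] [AddCommGroup M']
    [Module ℂ M'] [FiniteDimensional ℂ M] [FiniteDimensional ℂ M'] (φ : Representation ℂ N M')
    (U : Representation ℂ G M) {i : Fin (r + 1)} (hU : ∀ n : N, U.character n = S.f i n) :
    (Nat.card N : ℂ) * homDim φ (res N U) = ∑ n, φ.character n * S.f i n := by
  rw [card_mul_homDim _ _ (S.char_inv U hU)]
  exact Finset.sum_congr rfl fun n _ => by rw [← hU]; rfl

theorem homDim_char_char {M M' : Type} [AddCommGroup M] [Module ℂ M] [AddCommGroup M']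
    [Module ℂ M'] [FiniteDimensional ℂ M] [FiniteDimensional ℂ M'] (U : Representation ℂ G M)
    (U' : Representation ℂ G M') {i j : Fin (r + 1)} (hU : ∀ n : N, U.character n = S.f i n)
    (hU' : ∀ n : N, U'.character n = S.f j n) :
    homDim (res N U) (res N U') = if i = j then S.ν i else 0 := by
  have h := S.card_mul_homDim_char (res N U) U' hU'
  have h2 : ∑ n, (res N U).character n * S.f j n = ∑ n, S.f i n * S.f j n :=
    Finset.sum_congr rfl fun n _ => by rw [← hU]; rfl
  rw [h2, S.orth] at h
  split_ifs at h ⊢ with hij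
  · exact_mod_cast mul_left_cancel₀ (natCard_cast_ne_zero N) h
  · exact_mod_cast (mul_eq_zero.1 h).resolve_left (natCard_cast_ne_zero N)

/-- Take an irreducible submodule of a module realizing `f i`. Its restriction is orthogonal to
every other `f l`, hence a multiple of `f i`, and `rigid` forces the multiple to be the whole. -/
theorem exists_irreducible [Finite G] (i : Fin (r + 1)) :
    ∃ (d : ℕ) (ρ : Representation ℂ G (Fin d → ℂ)), ρ.IsIrreducible ∧
      ∀ n : N, ρ.character n = S.f i n := by
  obtain ⟨d, U, hU⟩ := S.real i
  have hnt : Nontrivial (Fin d → ℂ) := by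
    by_contra hM
    rw [not_nontrivial_iff_subsingleton] at hM
    have h0 : homDim (res N U) (res N U) = 0 := by
      rw [homDim, Module.finrank_eq_zero_iff_of_free]
      refine ⟨fun f g => ?_⟩
      ext x
      exact congr_fun (Subsingleton.elim (_ : Fin d → ℂ) _) _
    rw [S.homDim_char_char U U hU hU, if_pos rfl] at h0
    exact (S.ν_pos i).ne' h0
  obtain ⟨k, ρ, j, hρ, hj⟩ := exists_irreducible_injective U
  obtain ⟨k', ρ', ⟨e⟩⟩ := exists_complement j hj
  have hchar := (char_iso e).trans (char_prod ρ ρ')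
  have hchar' : (res N U).character = (res N ρ).character + (res N ρ').character := by
    ext n
    exact congr_fun hchar (n : G)
  obtain ⟨c, hc⟩ := S.exists_coeff (fun n => ρ.character n) fun m n g h => by
    rw [h, char_conj]
  have hnt := nontrivial_of_irreducible hρ
  choose dU Ur hUr using S.real
  -- The Fourier coefficient times the norm is a dimension, hence a natural number; for `l = i` it
  -- becomes the `m` of `rigid`.
  have hcoef : ∀ l, c l * S.ν l = homDim (res N ρ) (res N (Ur l)) := by
    intro l
    have h1 := S.card_mul_homDim_char (res N ρ) (Ur l) (hUr l)
    have h2 : ∑ n, (res N ρ).character n * S.f l n = ∑ n, (∑ i, c i * S.f i n) * S.f l n :=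
      Finset.sum_congr rfl fun n _ => by rw [← hc]; rfl
    rw [h2, S.sum_coeff] at h1
    apply mul_left_cancel₀ (natCard_cast_ne_zero N)
    rw [h1]
    ring
  have hadd : ∀ l, homDim (res N (Ur l)) (res N ρ) + homDim (res N (Ur l)) (res N ρ') =
      if l = i then S.ν l else 0 := by
    intro l
    rw [← S.homDim_char_char (Ur l) U (hUr l) hU]
    exact (homDim_of_char_add _ hchar').symm
  have hc0 : ∀ l, l ≠ i → c l = 0 := by
    intro l hl
    have h1 := hadd l
    rw [if_neg hl] at h1
    have h2 := hcoef l
    rw [homDim_comm, (by omega : homDim (res N (Ur l)) (res N ρ) = 0), Nat.cast_zero] at h2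
    exact (mul_eq_zero.1 h2).resolve_right (by exact_mod_cast (S.ν_pos l).ne')
  set m := homDim (res N (Ur i)) (res N ρ) with hm
  have hν : (S.ν i : ℂ) ≠ 0 := by exact_mod_cast (S.ν_pos i).ne'
  have hm' : c i * S.ν i = m := by rw [hcoef, homDim_comm]
  have hle : m ≤ S.ν i := by
    have := hadd i
    rw [if_pos rfl] at this
    omega
  have hval : ∀ n : N, S.ν i * ρ.character n = m * S.f i n := by
    intro n
    rw [hc n, Finset.sum_eq_single i (fun l _ hl => by rw [hc0 l hl, zero_mul]) (by simp), ← hm']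
    ring
  have hpos : 0 < m := by
    rw [Nat.pos_iff_ne_zero]
    intro h0
    have h1 := hval 1
    rw [h0, Nat.cast_zero, zero_mul] at h1
    have h2 := (mul_eq_zero.1 h1).resolve_left hν
    rw [OneMemClass.coe_one, char_one] at h2
    exact Module.finrank_pos.ne' (Nat.cast_eq_zero.1 h2)
  -- The quotient is the dimension of the endomorphism algebra of the restriction.
  have hdvd : S.ν i ∣ m ^ 2 := by
    refine ⟨homDim (res N ρ) (res N ρ), ?_⟩
    have hinv : ∀ n, (res N ρ).character n⁻¹ = (res N ρ).character n := by
      intro n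
      apply mul_left_cancel₀ hν
      have h1 := hval n⁻¹
      rw [S.f_inv, ← hval] at h1
      exact h1
    have h1 := card_mul_homDim (res N ρ) (res N ρ) hinv
    have h2 : (S.ν i : ℂ) ^ 2 * ∑ n, (res N ρ).character n * (res N ρ).character n =
        m ^ 2 * ∑ n, S.f i n * S.f i n := by
      rw [Finset.mul_sum, Finset.mul_sum]
      refine Finset.sum_congr rfl fun n _ => ?_
      change (S.ν i : ℂ) ^ 2 * (ρ.character n * ρ.character n) = _
      linear_combination ((S.ν i : ℂ) * ρ.character n + m * S.f i n) * hval n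
    rw [S.orth, if_pos rfl, ← h1] at h2
    have h3 : (S.ν i : ℂ) * Nat.card N * (m ^ 2 - S.ν i * homDim (res N ρ) (res N ρ)) = 0 := by
      linear_combination -h2
    have h4 := (mul_eq_zero.1 h3).resolve_left (mul_ne_zero hν (natCard_cast_ne_zero N))
    exact_mod_cast sub_eq_zero.1 h4
  have hmν := S.rigid i m k ρ hpos hle hdvd hval
  refine ⟨k, ρ, hρ, fun n => ?_⟩
  have := hval n
  rw [hmν] at this
  exact mul_left_cancel₀ hν this

variable [Finite G]

/-- The dimension of the irreducible module `S.ρ i`. -/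
def dim (i : Fin (r + 1)) : ℕ := (S.exists_irreducible i).choose

/-- An irreducible module of `G` with restricted character `S.f i`. -/
def ρ (i : Fin (r + 1)) : Representation ℂ G (Fin (S.dim i) → ℂ) :=
  (S.exists_irreducible i).choose_spec.choose

theorem ρ_irreducible (i : Fin (r + 1)) : (S.ρ i).IsIrreducible :=
  (S.exists_irreducible i).choose_spec.choose_spec.1

theorem char_ρ (i : Fin (r + 1)) (n : N) : (S.ρ i).character n = S.f i n :=
  (S.exists_irreducible i).choose_spec.choose_spec.2 n

theorem char_res_ρ (i : Fin (r + 1)) : (res N (S.ρ i)).character = S.f i :=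
  funext (S.char_ρ i)

theorem homDim_ρ_ρ (i j : Fin (r + 1)) :
    homDim (res N (S.ρ i)) (res N (S.ρ j)) = if i = j then S.ν i else 0 :=
  S.homDim_char_char _ _ (S.char_ρ i) (S.char_ρ j)

/-- The delta function at 1 is a combination of the `f i`, and it pairs with the character of `φ` to
the nonzero dimension of `φ`. -/
theorem exists_homDim_pos {M : Type} [AddCommGroup M] [Module ℂ M] [FiniteDimensional ℂ M]
    [Nontrivial M] (φ : Representation ℂ N M) : ∃ i, 0 < homDim φ (res N (S.ρ i)) := by
  classical
  by_contra! h
  obtain ⟨c, hc⟩ := S.exists_coeff (fun n => if n = 1 then 1 else 0) fun m n g h => by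
    have : m = 1 ↔ n = 1 := by
      rw [← OneMemClass.coe_eq_one, h, conj_eq_one_iff, OneMemClass.coe_eq_one]
    simp [this]
  have h1 : ∑ n, φ.character n * (if n = 1 then 1 else 0) = Module.finrank ℂ M := by simp
  simp_rw [hc, Finset.mul_sum] at h1
  rw [Finset.sum_comm, Finset.sum_eq_zero] at h1
  · exact Module.finrank_pos.ne' (Nat.cast_eq_zero.1 h1.symm)
  · intro i _
    have h2 := S.card_mul_homDim_char φ (S.ρ i) (S.char_ρ i)
    rw [Nat.le_zero.1 (h i), Nat.cast_zero, mul_zero] at h2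
    simp_rw [mul_left_comm, ← Finset.mul_sum, ← h2, mul_zero]

variable [N.Normal]

theorem complete {M : Type} [AddCommGroup M] [Module ℂ M] [FiniteDimensional ℂ M]
    (σ : Representation ℂ G M) (hσ : σ.IsIrreducible) :
    ∃ i, Nonempty ((res N σ).Equiv (res N (S.ρ i))) := by
  have := nontrivial_of_irreducible hσ
  obtain ⟨i, hi⟩ := S.exists_homDim_pos (res N σ)
  exact ⟨i, res_equiv_of_homDim_pos N S.comm hσ (S.ρ_irreducible i) hi⟩

theorem complete_char {M : Type} [AddCommGroup M] [Module ℂ M] [FiniteDimensional ℂ M]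
    (σ : Representation ℂ G M) (hσ : σ.IsIrreducible) :
    ∃ i, ∀ n : N, σ.character n = S.f i n := by
  obtain ⟨i, ⟨e⟩⟩ := S.complete σ hσ
  exact ⟨i, fun n => (congr_fun (char_iso e) n).trans (S.char_ρ i n)⟩

variable [FiniteDimensional ℂ W]

/-- The representation graph of restrictions. -/
def restrictionGraph : RestrictionGraph N V (Fin (r + 1)) where
  dim := S.dim
  ρ := S.ρ
  irreducible := S.ρ_irreducible
  distinct i j := fun ⟨e⟩ => S.f_injective fun n => by
    rw [← S.char_ρ, ← S.char_ρ]
    exact congr_fun (char_iso e) n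
  complete _ σ hσ := S.complete σ hσ
  zero := 0
  zero_trivial := equiv_of_char_eq <| funext fun n =>
    (S.char_ρ 0 n).trans ((S.f_zero n).trans (char_trivial n).symm)
  adj := S.A
  fusion j := equiv_of_char_eq <| funext fun n => by
    rw [char_tensor, Pi.mul_apply,
      char_directSum_sigma (fun i => res N (S.ρ i)) (fun i => S.A i j)]
    simp_rw [S.char_res_ρ]
    exact S.fusion j n

/-- By `complete_char` the vertices of any graph are the `f i`, and linear independence of these
leaves no freedom for the multiplicities. All statements about arbitrary graphs pass through this
relabelling. -/
theorem restrictionGraph_unique {I : Type} [Fintype I] [DecidableEq I]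
    (R : RestrictionGraph N V I) :
    ∃ e : I ≃ Fin (r + 1), e R.zero = 0 ∧ (∀ i j, R.adj i j = S.A (e i) (e j)) ∧
      ∀ i (n : N), (R.ρ i).character n = S.f (e i) n := by
  choose e he using fun i => S.complete_char (R.ρ i) (R.irreducible i)
  have hbij : Function.Bijective e := by
    constructor
    · intro i j hij
      refine R.distinct i j (equiv_of_char_eq (funext fun n => ?_))
      exact (he i n).trans (hij ▸ (he j n).symm)
    · intro k
      obtain ⟨i, ⟨E⟩⟩ := R.complete _ (S.ρ k) (S.ρ_irreducible k)
      refine ⟨i, S.f_injective fun n => ?_⟩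
      rw [← he, ← S.char_ρ]
      exact (congr_fun (char_iso E) n).symm
  refine ⟨Equiv.ofBijective e hbij, S.f_injective fun n => ?_, fun i j => ?_, he⟩
  · obtain ⟨E⟩ := R.zero_trivial
    rw [S.f_zero]
    exact (he R.zero n).symm.trans ((congr_fun (char_iso E) n).trans (char_trivial n))
  · obtain ⟨E⟩ := R.fusion j
    have key : ∀ n : N, ∑ k, (R.adj ((Equiv.ofBijective e hbij).symm k) j : ℂ) * S.f k n =
        ∑ k, (S.A k (e j) : ℂ) * S.f k n := by
      intro n
      have h1 := congr_fun (char_iso E) n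
      rw [char_tensor, Pi.mul_apply,
        char_directSum_sigma (fun i => res N (R.ρ i)) (fun i => R.adj i j)] at h1
      have h2 : ∀ i, (res N (R.ρ i)).character n = S.f (e i) n := fun i => he i n
      simp_rw [h2] at h1
      rw [← S.fusion, ← Equiv.sum_comp (Equiv.ofBijective e hbij)]
      simp only [Equiv.ofBijective_symm_apply_apply, Equiv.ofBijective_apply]
      exact h1.symm
    have := congr_fun (S.coeff_unique key) (e i)
    rw [Equiv.ofBijective_symm_apply_apply] at this
    exact_mod_cast this

end McKaySystem

/-! ### Irreducible constituents on the normal subgroup and the graph of induced modules. -/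

open Representation

/-- A constituent of multiplicity e contributes a block of dimension e² to the endomorphisms.
Splitting off one copy at a time avoids an isotypic decomposition. -/
theorem homDim_sq_le {G : Type} [Group G] [Finite G] {M M' : Type} [AddCommGroup M]
    [Module ℂ M] [AddCommGroup M'] [Module ℂ M'] [FiniteDimensional ℂ M] [FiniteDimensional ℂ M']
    (φ : Representation ℂ G M) (hφ : φ.IsIrreducible) (χ : Representation ℂ G M') :
    homDim φ χ ^ 2 ≤ homDim χ χ := by
  induction hm : homDim φ χ using Nat.strong_induction_on generalizing M' with
  | _ m ih =>
    subst hm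
    rcases Nat.eq_zero_or_pos (homDim φ χ) with h | h
    · simp [h]
    · obtain ⟨d, τ, ⟨e⟩⟩ := exists_char_add_of_homDim_pos hφ h
      have hc := (char_iso e).trans (char_prod φ τ)
      have h1 : homDim φ χ = 1 + homDim φ τ := by
        rw [homDim_of_char_add φ hc, homDim, IsIrreducible.finrank_intertwiningMap_self]
      have h2 := homDim_of_char_add χ hc
      have h3 := homDim_of_char_add τ hc
      rw [homDim_comm χ φ, homDim_comm χ τ, h1, h3, homDim_comm τ φ] at h2
      have h4 := ih (homDim φ τ) (by omega) τ rfl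
      rw [h2, h1]
      nlinarith

namespace McKaySystem

variable {G : Type} [Group G] {N : Subgroup G} [Fintype N] {W : Type}
  [AddCommGroup W] [Module ℂ W] {V : Representation ℂ G W} {r : ℕ}
  (S : McKaySystem N V r)

/-- The numerical data of the induced modules: `E i` is the multiplicity of an irreducible
constituent of the `i`-th restriction, `B` describes the multiplication of the induced modules
by `V`. -/
structure IsInductionData (E : Fin (r + 1) → ℕ) (B : Matrix (Fin (r + 1)) (Fin (r + 1)) ℕ) :
    Prop where
  -- Here `e` and `d` stand for multiplicity and dimension of an N-constituent, and `D` for the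
  -- dimension of the restriction; `ν d = e D` is the dimension count that holds for every
  -- constituent.
  mult : ∀ (i : Fin (r + 1)) (e d D : ℕ), S.f i 1 = D → 0 < e → e ^ 2 ≤ S.ν i →
    S.ν i * d = e * D → e = E i
  matrix : ∀ j k, B k j * E k = S.A j k * E j

variable [Finite G] [N.Normal] {E : Fin (r + 1) → ℕ} {B : Matrix (Fin (r + 1)) (Fin (r + 1)) ℕ}

-- Distinct restrictions have no nonzero homomorphisms between them, so an N-irreducible occurs in
-- at most one; the delta function at 1 shows that it occurs in some. Its multiplicity is determined
-- by the numerical constraint `mult`.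
omit [N.Normal] in
theorem homDim_unique_constituent (hS : S.IsInductionData E B) {M : Type} [AddCommGroup M]
    [Module ℂ M] [FiniteDimensional ℂ M] (φ : Representation ℂ N M) (hφ : φ.IsIrreducible) :
    ∃ i, ∀ k, homDim φ (res N (S.ρ k)) = if k = i then E i else 0 := by
  classical
  have := nontrivial_of_irreducible hφ
  obtain ⟨i, hi⟩ := S.exists_homDim_pos φ
  have h0 : ∀ k, k ≠ i → homDim φ (res N (S.ρ k)) = 0 := by
    intro k hk
    by_contra hne
    obtain ⟨a, τ, ⟨e⟩⟩ := exists_char_add_of_homDim_pos hφ hi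
    have h1 := homDim_of_char_add (res N (S.ρ k)) ((char_iso e).trans (char_prod φ τ))
    rw [S.homDim_ρ_ρ, if_neg hk, homDim_comm _ φ] at h1
    omega
  refine ⟨i, fun k => ?_⟩
  split_ifs with hk
  · subst hk
    refine hS.mult k _ (Module.finrank ℂ M) (S.dim k) ?_ hi ?_ ?_
    · rw [← S.char_ρ, OneMemClass.coe_one, char_one, Module.finrank_fin_fun]
    · refine (homDim_sq_le φ hφ _).trans (le_of_eq ?_)
      rw [S.homDim_ρ_ρ, if_pos rfl]
    -- Pairing the expansion of the delta function with `φ` and with `f k` computes both dimensions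
    -- through the same coefficient `c k`; its elimination gives the dimension count.
    · obtain ⟨c, hc⟩ := S.exists_coeff (fun n => if n = 1 then 1 else 0) fun m n g h => by
        have : m = 1 ↔ n = 1 := by
          rw [← OneMemClass.coe_eq_one, h, conj_eq_one_iff, OneMemClass.coe_eq_one]
        simp [this]
      have h1 : ∑ n, φ.character n * (if n = 1 then 1 else 0) = Module.finrank ℂ M := by simp
      have h2 : ∑ n : N, (if n = 1 then 1 else 0) * S.f k n = S.f k 1 := by simp
      simp_rw [hc] at h1 h2
      rw [S.sum_coeff] at h2
      simp_rw [Finset.mul_sum, mul_left_comm] at h1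
      rw [Finset.sum_comm] at h1
      simp_rw [← Finset.mul_sum, ← S.card_mul_homDim_char φ _ (S.char_ρ _)] at h1
      rw [Finset.sum_eq_single k (fun l _ hl => by rw [h0 l hl]; simp) (by simp)] at h1
      have h3 : S.f k 1 = S.dim k := by
        rw [← S.char_ρ, OneMemClass.coe_one, char_one, Module.finrank_fin_fun]
      rw [h3] at h2
      have : (S.ν k : ℂ) * Module.finrank ℂ M = homDim φ (res N (S.ρ k)) * S.dim k := by
        rw [← h1, ← h2]
        ring
      exact_mod_cast this
  · exact h0 k hk

omit [N.Normal] in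
theorem exists_constituent (hS : S.IsInductionData E B) (i : Fin (r + 1)) :
    0 < E i ∧ ∃ (d : ℕ) (φ : Representation ℂ N (Fin d → ℂ)), φ.IsIrreducible ∧
      ∀ k, homDim φ (res N (S.ρ k)) = if k = i then E i else 0 := by
  have := nontrivial_of_irreducible (S.ρ_irreducible i)
  obtain ⟨d, φ, j, hφ, hj⟩ := exists_irreducible_injective (res N (S.ρ i))
  obtain ⟨l, hl⟩ := S.homDim_unique_constituent hS φ hφ
  have hpos : 0 < homDim φ (res N (S.ρ i)) := (homDim_pos_iff _ _).2 ⟨j, fun h0 => by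
    have := nontrivial_of_irreducible hφ
    obtain ⟨x, hx⟩ := exists_ne (0 : Fin d → ℂ)
    exact hx (hj (by rw [h0]; simp))⟩
  rw [hl] at hpos
  split_ifs at hpos with h
  · subst h
    exact ⟨hpos, d, φ, hφ, hl⟩
  · simp at hpos

omit [N.Normal] in
theorem homDim_irreducible {σ : ℕ} {M : Type} [AddCommGroup M] [Module ℂ M]
    [FiniteDimensional ℂ M] (φ : Representation ℂ N M) (τ : Representation ℂ G (Fin σ → ℂ))
    {k : Fin (r + 1)} (e : (res N τ).Equiv (res N (S.ρ k))) :
    homDim (φ.ind N.subtype) τ = homDim φ (res N (S.ρ k)) := by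
  rw [homDim_ind, homDim_congr φ (char_iso e)]

/-- Every irreducible G-module restricts to one of the `S.ρ k`, so by Frobenius reciprocity these
finitely many numbers determine the induced module. -/
theorem ind_equiv {M M' : Type} [AddCommGroup M] [Module ℂ M]
    [FiniteDimensional ℂ M] [AddCommGroup M'] [Module ℂ M'] [FiniteDimensional ℂ M']
    (φ : Representation ℂ N M) (φ' : Representation ℂ N M')
    (h : ∀ k, homDim φ (res N (S.ρ k)) = homDim φ' (res N (S.ρ k))) :
    Nonempty ((φ.ind N.subtype).Equiv (φ'.ind N.subtype)) := by
  refine equiv_of_homDim_eq _ _ fun d σ hσ => ?_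
  obtain ⟨k, ⟨e⟩⟩ := S.complete σ hσ
  rw [homDim_comm σ, homDim_comm σ, S.homDim_irreducible φ σ e, S.homDim_irreducible φ' σ e, h]

variable [FiniteDimensional ℂ W]

-- The character of V is invariant under inversion, so V moves to the other side of Hom; Frobenius
-- reciprocity and the fusion rule then give the count `A j k * E j`, which `matrix` rewrites.
omit [N.Normal] in
theorem homDim_tprod_ind (hS : S.IsInductionData E B) {M : Type} [AddCommGroup M] [Module ℂ M]
    [FiniteDimensional ℂ M] (φ : Representation ℂ N M) {j : Fin (r + 1)}
    (hφ : ∀ k, homDim φ (res N (S.ρ k)) = if k = j then E j else 0)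
    {d : ℕ} (σ : Representation ℂ G (Fin d → ℂ)) {k : Fin (r + 1)}
    (e : (res N σ).Equiv (res N (S.ρ k))) :
    homDim (V.tprod (φ.ind N.subtype)) σ = B k j * E k := by
  have := Fintype.ofFinite G
  have h1 : homDim (V.tprod (φ.ind N.subtype)) σ = homDim (φ.ind N.subtype) (V.tprod σ) := by
    have : (homDim (V.tprod (φ.ind N.subtype)) σ : ℂ) =
        homDim (φ.ind N.subtype) (V.tprod σ) := by
      rw [homDim_eq_sum, homDim_eq_sum]
      congr 1
      refine Finset.sum_congr rfl fun g _ => ?_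
      rw [char_tensor, char_tensor, Pi.mul_apply, Pi.mul_apply, S.V_inv]
      ring
    exact_mod_cast this
  rw [h1, homDim_ind, homDim_of_char_sum φ _ (fun i => res N (S.ρ i)) (fun i => S.A i k)]
  · simp_rw [hφ]
    simp [hS.matrix]
  · intro n
    simp_rw [S.char_res_ρ]
    rw [← S.fusion]
    change (V.tprod σ).character n = _
    rw [char_tensor, Pi.mul_apply, ← S.char_ρ]
    congr 1
    exact congr_fun (char_iso e) n

/-- The representation graph of induced modules. -/
def inductionGraph (hS : S.IsInductionData E B) : InductionGraph N V (Fin (r + 1)) where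
  dim i := (S.exists_constituent hS i).2.choose
  φ i := (S.exists_constituent hS i).2.choose_spec.choose
  irreducible i := (S.exists_constituent hS i).2.choose_spec.choose_spec.1
  distinct i j := fun ⟨e⟩ => by
    have h1 := (S.exists_constituent hS i).2.choose_spec.choose_spec.2 i
    have h2 := (S.exists_constituent hS j).2.choose_spec.choose_spec.2 i
    rw [← homDim_ind, homDim_comm, homDim_congr _ (char_iso e), homDim_comm, homDim_ind, h2] at h1
    by_contra hij
    rw [if_neg hij, if_pos rfl] at h1
    exact (S.exists_constituent hS i).1.ne h1
  complete d σ hσ := by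
    obtain ⟨i, hi⟩ := S.homDim_unique_constituent hS σ hσ
    exact ⟨i, S.ind_equiv _ _ fun k => by
      rw [hi, (S.exists_constituent hS i).2.choose_spec.choose_spec.2 k]⟩
  zero := 0
  zero_trivial := by
    have h1 := (S.exists_constituent hS 0).2.choose_spec.choose_spec.2 0
    have hirr := (S.exists_constituent hS 0).2.choose_spec.choose_spec.1
    rw [if_pos rfl] at h1
    -- The zeroth restriction is one-dimensional, so a nonzero map into it from an irreducible
    -- module is an isomorphism.
    obtain ⟨f, hf⟩ := (homDim_pos_iff _ _).1 (h1 ▸ (S.exists_constituent hS 0).1)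
    have hdim : S.dim 0 = 1 := by
      have h2 := S.char_ρ 0 1
      rw [OneMemClass.coe_one, char_one, Module.finrank_fin_fun, S.f_zero] at h2
      exact_mod_cast h2
    have hinj := (IsIrreducible.injective_or_eq_zero f).resolve_right hf
    have hsurj : Function.Surjective f := by
      have := nontrivial_of_irreducible hirr
      have h3 := LinearMap.finrank_le_finrank_of_injective (f := f.toLinearMap) hinj
      have h4 := Module.finrank_pos (R := ℂ) (M := Fin ((S.exists_constituent hS 0).2.choose) → ℂ)
      refine (LinearMap.injective_iff_surjective_of_finrank_eq_finrank (f := f.toLinearMap) ?_).1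
        hinj
      have h5 : Module.finrank ℂ (Fin (S.dim 0) → ℂ) = 1 := by
        rw [Module.finrank_fin_fun, hdim]
      omega
    obtain ⟨e⟩ := (S.restrictionGraph).zero_trivial
    exact ⟨(IntertwiningMap.ofBijective f ⟨hinj, hsurj⟩).trans e⟩
  adj := B
  fusion j := by
    refine equiv_of_homDim_eq _ _ fun d σ hσ => ?_
    obtain ⟨k, ⟨e⟩⟩ := S.complete σ hσ
    rw [homDim_comm, S.homDim_tprod_ind hS _
      (S.exists_constituent hS j).2.choose_spec.choose_spec.2 σ e,
      homDim_of_char_sum σ _ _ _ fun g => char_directSum_sigma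
        (fun i => (S.exists_constituent hS i).2.choose_spec.choose.ind N.subtype)
        (fun i => B i j) g]
    simp_rw [homDim_comm σ, S.homDim_irreducible _ σ e,
      (S.exists_constituent hS _).2.choose_spec.choose_spec.2 k]
    simp

/-- Vertices are matched by the unique restriction containing the given N-module. Testing the
decomposition of V ⊗ φ̂_j against `S.ρ (e i)` isolates one entry of the adjacency matrix times a
positive `E`, which cancels. -/
theorem inductionGraph_unique (hS : S.IsInductionData E B) {J : Type} [Fintype J] [DecidableEq J]
    (R : InductionGraph N V J) :
    ∃ e : J ≃ Fin (r + 1), e R.zero = 0 ∧ ∀ i j, R.adj i j = B (e i) (e j) := by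
  choose e he using fun i => S.homDim_unique_constituent hS (R.φ i) (R.irreducible i)
  have hpos : ∀ i, 0 < E i := fun i => (S.exists_constituent hS i).1
  have hbij : Function.Bijective e := by
    constructor
    · intro i j hij
      refine R.distinct i j (S.ind_equiv _ _ fun k => ?_)
      rw [he, he, hij]
    · intro k
      obtain ⟨_, d, φ, hφ, h⟩ := S.exists_constituent hS k
      obtain ⟨i, ⟨E'⟩⟩ := R.complete _ φ hφ
      refine ⟨i, ?_⟩
      have h1 := h k
      rw [← homDim_ind, homDim_comm, homDim_congr _ (char_iso E'), homDim_comm, homDim_ind, he,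
        if_pos rfl] at h1
      by_contra hne
      rw [if_neg (Ne.symm hne)] at h1
      exact (hpos k).ne h1
  refine ⟨Equiv.ofBijective e hbij, ?_, fun i j => ?_⟩
  · obtain ⟨E'⟩ := R.zero_trivial
    have h1 := he R.zero 0
    rw [homDim_comm, homDim_congr _ (char_iso E')] at h1
    have h2 : homDim (res N (S.ρ 0)) (Representation.trivial ℂ N ℂ) = S.ν 0 := by
      rw [← homDim_congr _ (char_iso (S.restrictionGraph.zero_trivial.some))]
      exact (S.homDim_ρ_ρ 0 0).trans (if_pos rfl)
    rw [h2] at h1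
    by_contra hne
    rw [if_neg fun h => hne h.symm] at h1
    exact (S.ν_pos 0).ne' h1
  · obtain ⟨E'⟩ := R.fusion j
    have h1 := S.homDim_tprod_ind hS (R.φ j) (he j) (S.ρ (e i)) (Representation.Equiv.refl _)
    rw [homDim_comm, homDim_congr _ (char_iso E'),
      homDim_of_char_sum _ _ _ _ fun g => char_directSum_sigma
        (fun i => (R.φ i).ind N.subtype) (fun i => R.adj i j) g] at h1
    simp_rw [homDim_comm (S.ρ (e i)), homDim_ind, he, hbij.1.eq_iff] at h1
    simp only [mul_ite, mul_zero, Finset.sum_ite_eq, Finset.mem_univ, if_true] at h1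
    exact Nat.eq_of_mul_eq_mul_right (hpos _) h1

end McKaySystem

/-! ### Poincaré series as quotients of determinants. -/

open Representation

theorem detSeries_submatrix {I J : Type} [Fintype I] [DecidableEq I] [Fintype J] [DecidableEq J]
    (e : I ≃ J) (A : Matrix I I ℕ) (B : Matrix J J ℕ) (h : ∀ i j, A i j = B (e i) (e j)) :
    detSeries A = detSeries B := by
  have : A = B.submatrix e e := by ext i j; exact h i j
  subst this
  rw [detSeries, detSeries, ← Matrix.det_submatrix_equiv_self e]
  congr 1
  ext i j
  simp [Matrix.one_apply]

theorem constantCoeff_detSeries {I : Type} [Fintype I] [DecidableEq I] (A : Matrix I I ℕ) :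
    PowerSeries.constantCoeff (detSeries A) = 1 := by
  rw [detSeries, RingHom.map_det]
  convert Matrix.det_one (n := I) (R := ℂ)
  ext i j
  simp [Matrix.one_apply]

/-- Cramer's rule: the recursion says that (I - tAᵀ) s is the unit vector at `o`. The determinant
has constant term 1, so it is invertible as a power series. -/
theorem removeVertex_series {I : Type} [Fintype I] [DecidableEq I] (A : Matrix I I ℕ) (o : I)
    (s : I → ℂ⟦X⟧) (hs : ∀ j, s j = (if j = o then 1 else 0) + PowerSeries.X * ∑ i, A i j * s i) :
    s o = detSeries (removeVertex A o) * (detSeries A)⁻¹ := by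
  rw [PowerSeries.eq_mul_inv_iff_mul_eq (by rw [constantCoeff_detSeries]; exact one_ne_zero)]
  set M : Matrix I I ℂ⟦X⟧ :=
    1 - (PowerSeries.X : ℂ⟦X⟧) • (A.map fun a : ℕ => (a : ℂ⟦X⟧)).transpose with hM
  have h1 : M.mulVec s = Pi.single o 1 := by
    funext j
    rw [hM, Matrix.sub_mulVec, Matrix.one_mulVec, Pi.sub_apply, hs j, Matrix.smul_mulVec]
    simp [Matrix.mulVec, dotProduct, Pi.single_apply]
  have h2 : (M.adjugate.mulVec (M.mulVec s)) o = M.det * s o := by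
    rw [Matrix.mulVec_mulVec, Matrix.adjugate_mul, Matrix.smul_mulVec, Matrix.one_mulVec]
    rfl
  rw [h1] at h2
  have h3 : detSeries (removeVertex A o) = M.adjugate o o := by
    rw [adjugate_self_eq_det_submatrix, detSeries]
    congr 1
    ext i j
    simp [hM, removeVertex, Matrix.one_apply, Subtype.ext_iff]
  rw [h3, mul_comm]
  change M.det * s o = _
  rw [← h2]
  simp

namespace McKaySystem

variable {G : Type} [Group G] {N : Subgroup G} [Fintype N] {W : Type}
  [AddCommGroup W] [Module ℂ W] {V : Representation ℂ G W} {r : ℕ}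
  (S : McKaySystem N V r)

/-- The fusion rule says that the columns of the table are eigenvectors of Aᵀ with eigenvalues χ_V
on the representatives; the invertible table cancels from the determinants. -/
theorem detSeries_eq_prod :
    detSeries S.A = ∏ k, (1 - PowerSeries.C (V.character (S.rep k)) * PowerSeries.X : ℂ⟦X⟧) := by
  set T : Matrix (Fin (r + 1)) (Fin (r + 1)) ℂ⟦X⟧ := S.table.map PowerSeries.C with hT
  have hTu : IsUnit T.det := by
    have h := (Matrix.isUnit_iff_isUnit_det _).1 S.isUnit_table
    have h2 : T.det = PowerSeries.C S.table.det := by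
      rw [hT, RingHom.map_det]
      rfl
    rw [h2]
    exact h.map PowerSeries.C
  have key : (1 - (PowerSeries.X : ℂ⟦X⟧) • (S.A.map fun a : ℕ => (a : ℂ⟦X⟧)).transpose) * T =
      T * Matrix.diagonal fun k =>
        (1 - PowerSeries.C (V.character (S.rep k)) * PowerSeries.X : ℂ⟦X⟧) := by
    ext1 j k
    rw [Matrix.mul_diagonal, Matrix.sub_mul, Matrix.one_mul, Matrix.smul_mul, Matrix.sub_apply,
      Matrix.smul_apply, Matrix.mul_apply]
    have h1 : ∑ i, ((S.A.map fun a : ℕ => (a : ℂ⟦X⟧)).transpose j i) * T i k =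
        PowerSeries.C (V.character (S.rep k) * S.f j (S.rep k)) := by
      rw [S.fusion, map_sum]
      refine Finset.sum_congr rfl fun i _ => ?_
      simp [hT, table]
    rw [h1]
    simp only [hT, Matrix.map_apply, table, Matrix.of_apply, map_mul, smul_eq_mul]
    ring
  have := congr_arg Matrix.det key
  rw [Matrix.det_mul, Matrix.det_mul, Matrix.det_diagonal, mul_comm] at this
  exact hTu.mul_left_cancel this

theorem rep_injective {i j : Fin (r + 1)} {g : G} (h : (S.rep i : G) = g * S.rep j * g⁻¹) :
    i = j := by
  have h1 : ∀ k, S.table k i = S.table k j := fun k => S.f_conj k g h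
  have h2 := (Matrix.mulVec_injective_iff_isUnit.2 S.isUnit_table)
    (a₁ := Pi.single i 1) (a₂ := Pi.single j 1) (by
      funext k
      simp [h1])
  by_contra hij
  have h3 := congr_fun h2 i
  simp [hij] at h3

/-- Normality makes the classes in question whole G-classes, so `Υ ∩ N` and the `rep k` are matched
up to conjugation, under which the character of V is constant. -/
theorem characterProduct_eq [N.Normal] (Υ : Finset G) (hΥ : IsConjRepresentatives Υ) :
    characterProduct N V Υ = detSeries S.A := by
  classical
  rw [S.detSeries_eq_prod, characterProduct]
  choose e he hu using fun k : Fin (r + 1) => hΥ (S.rep k)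
  have he' : ∀ k, ∃ g : G, g * S.rep k * g⁻¹ = e k := fun k => isConj_iff.1 (he k).2
  symm
  refine Finset.prod_bij (fun k _ => e k) (fun k _ => ?_) (fun i _ j _ hij => ?_)
    (fun u hu' => ?_) fun k _ => ?_
  · obtain ⟨g, hg⟩ := he' k
    refine Finset.mem_filter.2 ⟨(he k).1, ?_⟩
    rw [← hg]
    exact (inferInstance : N.Normal).conj_mem _ (S.rep k).2 g
  · have h1 : IsConj (S.rep j : G) (S.rep i) := (he j).2.trans (hij ▸ (he i).2.symm)
    obtain ⟨g, hg⟩ := isConj_iff.1 h1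
    exact S.rep_injective hg.symm
  · obtain ⟨hu1, hu2⟩ := Finset.mem_filter.1 hu'
    obtain ⟨k, g, hg⟩ := S.conj_rep ⟨u, hu2⟩
    exact ⟨k, Finset.mem_univ _, (hu k u ⟨hu1, isConj_iff.2 ⟨g, hg.symm⟩⟩).symm⟩
  · obtain ⟨g, hg⟩ := he' k
    rw [← hg, char_conj]

end McKaySystem

section Series

variable {G : Type} [Group G] [Finite G] {N : Subgroup G} {W : Type}
  [AddCommGroup W] [Module ℂ W] {V : Representation ℂ G W} [FiniteDimensional ℂ W]

theorem homDim_trivial {M : Type} [AddCommGroup M] [Module ℂ M] [FiniteDimensional ℂ M]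
    (ρ : Representation ℂ N M) :
    homDim (Representation.trivial ℂ N ℂ) ρ = Module.finrank ℂ ρ.invariants := by
  have := Fintype.ofFinite N
  have : Invertible (Nat.card N : ℂ) := invertibleOfNonzero (natCard_cast_ne_zero N)
  have h := card_inv_mul_sum_char_eq_finrank ρ
  have h2 := homDim_eq_sum (Representation.trivial ℂ N ℂ) ρ
  simp_rw [char_trivial, mul_one] at h2
  rw [h] at h2
  exact_mod_cast h2

theorem series_zero_eq_invariantSeries {I : Type} (R : RestrictionGraph N V I) :
    R.series R.zero = invariantSeries (res N V) := by
  ext k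
  simp only [RestrictionGraph.series, poincareSeries, invariantSeries, PowerSeries.coeff_mk]
  rw [← homDim_trivial, ← homDim_comm, ← homDim_congr _ (char_iso R.zero_trivial.some),
    homDim_comm]
  rfl

/-- Frobenius reciprocity for the trivial module, in each tensor degree. -/
theorem series_zero_eq_series_zero {I J : Type} (R : RestrictionGraph N V I)
    (T : InductionGraph N V J) : R.series R.zero = T.series T.zero := by
  ext k
  simp only [RestrictionGraph.series, poincareSeries, InductionGraph.series, PowerSeries.coeff_mk]
  have h1 : homDim ((T.φ T.zero).ind N.subtype) (tensorPower V k) =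
      homDim (T.φ T.zero) (tensorPower (res N V) k) := homDim_ind N (T.φ T.zero) (tensorPower V k)
  have h2 := homDim_congr (tensorPower (res N V) k) (char_iso T.zero_trivial.some)
  rw [← homDim_congr (tensorPower (res N V) k) (char_iso R.zero_trivial.some), homDim_comm,
    ← h1, homDim_comm] at h2
  rw [homDim_comm (tensorPower (res N V) k)] at h2
  exact congr_arg Nat.cast (h2.symm.trans (homDim_comm _ _))

end Series

namespace McKaySystem

variable {G : Type} [Group G] {N : Subgroup G} [Fintype N] {W : Type}
  [AddCommGroup W] [Module ℂ W] {V : Representation ℂ G W} {r : ℕ}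
  (S : McKaySystem N V r) [Finite G] [N.Normal] [FiniteDimensional ℂ W]

include S in
-- The coefficient of tᵏ in the j-th series is the mean of f_j χ_Vᵏ. For k > 0 one factor χ_V is
-- absorbed into f_j by the fusion rule, and for k = 0 orthogonality to f_0 = 1 remains.
theorem series_eq {I : Type} [Fintype I] [DecidableEq I] (R : RestrictionGraph N V I) :
    R.series R.zero = detSeries (removeVertex R.adj R.zero) * (detSeries R.adj)⁻¹ := by
  obtain ⟨e, he0, headj, hechar⟩ := S.restrictionGraph_unique R
  have hcoeff : ∀ j k, (Nat.card N : ℂ) * PowerSeries.coeff k (R.series j) =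
      ∑ n : N, S.f (e j) n * V.character n ^ k := by
    intro j k
    rw [RestrictionGraph.series, poincareSeries, PowerSeries.coeff_mk]
    have hc : ∀ n, (tensorPower (res N V) k).character n = V.character n ^ k :=
      fun n => char_tensorPower _ k n
    refine (card_mul_homDim (res N (R.ρ j)) (tensorPower (res N V) k) fun n => ?_).trans ?_
    · rw [hc, hc, InvMemClass.coe_inv, S.V_inv]
    · refine Finset.sum_congr rfl fun n _ => ?_
      rw [hc, ← hechar]
      rfl
  refine removeVertex_series R.adj R.zero R.series fun j => ?_
  ext k
  apply mul_left_cancel₀ (natCard_cast_ne_zero N)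
  rw [hcoeff]
  cases k with
  | zero =>
    have h1 : ∑ n : N, S.f (e j) n * V.character n ^ 0 = ∑ n : N, S.f (e j) n * S.f 0 n :=
      Finset.sum_congr rfl fun n _ => by rw [S.f_zero, pow_zero]
    have h2 : (S.ν 0 : ℂ) = 1 := by
      have := S.orth 0 0
      simp only [S.f_zero, if_true, mul_one] at this
      rw [Finset.sum_const, Finset.card_univ, ← Nat.card_eq_fintype_card, nsmul_eq_mul] at this
      exact (mul_left_cancel₀ (natCard_cast_ne_zero N) this).symm
    rw [h1, S.orth]
    by_cases hj : j = R.zero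
    · subst hj
      simp [he0, h2]
    · have : e j ≠ 0 := fun h => hj (e.injective (h.trans he0.symm))
      simp [this, hj]
  | succ k =>
    have h0 : PowerSeries.coeff (k + 1) (if j = R.zero then (1 : ℂ⟦X⟧) else 0) = 0 := by
      split_ifs
      · rw [PowerSeries.coeff_one, if_neg k.succ_ne_zero]
      · exact map_zero _
    rw [map_add, h0, zero_add, PowerSeries.coeff_succ_X_mul, map_sum, Finset.mul_sum]
    have h1 : ∀ i, (Nat.card N : ℂ) * PowerSeries.coeff k ((R.adj i j : ℂ⟦X⟧) * R.series i) =
        ∑ n : N, (R.adj i j : ℂ) * (S.f (e i) n * V.character n ^ k) := by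
      intro i
      rw [← nsmul_eq_mul (R.adj i j), map_nsmul, nsmul_eq_mul, mul_left_comm, hcoeff, Finset.mul_sum]
    rw [Finset.sum_congr rfl fun i _ => h1 i]
    rw [Finset.sum_comm]
    refine Finset.sum_congr rfl fun n _ => ?_
    rw [pow_succ, mul_left_comm, mul_comm (S.f (e j) n), S.fusion, Finset.mul_sum,
      ← Equiv.sum_comp e]
    refine Finset.sum_congr rfl fun i _ => ?_
    rw [headj]
    ring

end McKaySystem

/-! ### Three-term recurrences for determinants. -/

section Recursion

variable {R : Type} [CommRing R]

/-- Expansion along the last row and then the last column. Only these need be sparse, so the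
recurrence also applies to forks beyond their branching. -/
theorem det_tridiagonal_succ (M : ℕ → ℕ → R) (k : ℕ) (h1 : ∀ j < k, M (k + 1) j = 0)
    (h2 : ∀ j < k, M j (k + 1) = 0) :
    (Matrix.of fun i j : Fin (k + 2) => M i j).det =
      M (k + 1) (k + 1) * (Matrix.of fun i j : Fin (k + 1) => M i j).det -
        M k (k + 1) * M (k + 1) k * (Matrix.of fun i j : Fin k => M i j).det := by
  rw [Matrix.det_succ_row _ (Fin.last (k + 1)), Fin.sum_univ_castSucc, Fin.sum_univ_castSucc,
    Finset.sum_eq_zero, zero_add]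
  · have e1 : ((Matrix.of fun i j : Fin (k + 2) => M i j).submatrix (Fin.last (k + 1)).succAbove
        (Fin.last (k + 1)).succAbove) = Matrix.of fun i j : Fin (k + 1) => M i j := by
      ext i j
      simp
    have e2 : ((Matrix.of fun i j : Fin (k + 2) => M i j).submatrix (Fin.last (k + 1)).succAbove
        (Fin.last k).castSucc.succAbove).det =
          M k (k + 1) * (Matrix.of fun i j : Fin k => M i j).det := by
      rw [Matrix.det_succ_column _ (Fin.last k), Fin.sum_univ_castSucc, Finset.sum_eq_zero,
        zero_add]
      · have e3 : ((((Matrix.of fun i j : Fin (k + 2) => M i j).submatrix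
            (Fin.last (k + 1)).succAbove (Fin.last k).castSucc.succAbove).submatrix
            (Fin.last k).succAbove (Fin.last k).succAbove)) =
              Matrix.of fun i j : Fin k => M i j := by
          ext i j
          simp [Fin.succAbove, Fin.lt_def]
        rw [e3]
        simp [Fin.succAbove, ← two_mul]
      · intro i _
        simp [Fin.succAbove, h2]
    rw [e1, e2]
    have e4 : ((-1 : R)) ^ (k * 2) = 1 := by rw [mul_comm, pow_mul]; simp
    simp [pow_add, ← two_mul]
    ring_nf
    rw [e4]
    ring
  · intro i _
    simp [h1]

end Recursion

/-! ### The characteristic polynomial of the Coxeter transformation. -/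

section Coxeter

/-- The matrix with diagonal entries `a`, and the entries of `C` multiplied by `p` above and by `s`
below the diagonal. -/
def triScale {n : ℕ} (C : Matrix (Fin n) (Fin n) ℤ) (a p s : ℂ) : Matrix (Fin n) (Fin n) ℂ :=
  Matrix.of fun i j => if i = j then a else if i < j then p * C i j else s * C i j

variable {n : ℕ} (C : Matrix (Fin n) (Fin n) ℤ)

theorem simpleReflection_mul_apply (i : Fin n) (P : Matrix (Fin n) (Fin n) ℤ) (k j : Fin n) :
    (simpleReflection C i * P) k j = P k j - if k = i then (C * P) i j else 0 := by
  rw [simpleReflection, Matrix.sub_mul, Matrix.one_mul, Matrix.sub_apply, Matrix.mul_apply]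
  congr 1
  split_ifs with h <;> simp [h, Matrix.mul_apply]

/-- The product `S_k ⋯ S_{n-1}` of the simple reflections. -/
def partialCoxeter (k : ℕ) : Matrix (Fin n) (Fin n) ℤ :=
  ((List.ofFn (simpleReflection C)).drop k).prod

theorem partialCoxeter_zero : partialCoxeter C 0 = coxeterTransformation C := rfl

theorem partialCoxeter_succ (k : Fin n) :
    partialCoxeter C k = simpleReflection C k * partialCoxeter C (k + 1) := by
  rw [partialCoxeter, partialCoxeter, List.drop_eq_getElem_cons (by simp), List.prod_cons]
  simp

theorem partialCoxeter_last : partialCoxeter C n = 1 := by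
  rw [partialCoxeter, List.drop_of_length_le (by simp), List.prod_nil]

/-- Left multiplication by a simple reflection changes one row only, so each row of the Coxeter
transformation is settled at a single stage of the product. -/
theorem partialCoxeter_apply_of_ne (k : Fin n) {i : Fin n} (hi : i ≠ k) (j : Fin n) :
    partialCoxeter C k i j = partialCoxeter C (k + 1) i j := by
  rw [partialCoxeter_succ, simpleReflection_mul_apply, if_neg hi, sub_zero]

theorem partialCoxeter_apply_of_lt {k : ℕ} (hk : k ≤ n) {i : Fin n} (hi : (i : ℕ) < k)
    (j : Fin n) : partialCoxeter C k i j = (1 : Matrix (Fin n) (Fin n) ℤ) i j := by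
  induction hk using Nat.decreasingInduction with
  | self => rw [partialCoxeter_last]
  | of_succ k hk ih =>
    rw [partialCoxeter_apply_of_ne C ⟨k, hk⟩ (Fin.ne_of_lt hi), ih (by omega)]

theorem partialCoxeter_apply_of_le {k : ℕ} {i : Fin n} (hi : k ≤ i) (j : Fin n) :
    partialCoxeter C k i j = coxeterTransformation C i j := by
  induction k with
  | zero => rw [partialCoxeter_zero]
  | succ k ih =>
    have hk : k < n := by omega
    rw [← ih (by omega), partialCoxeter_apply_of_ne C ⟨k, hk⟩]
    exact fun h => by rw [h] at hi; simp at hi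

/-- The upper unitriangular part. -/
def upperPart : Matrix (Fin n) (Fin n) ℤ :=
  Matrix.of fun i j => if i = j then 1 else if i < j then C i j else 0

/-- The lower unitriangular part. -/
def lowerPart : Matrix (Fin n) (Fin n) ℤ :=
  Matrix.of fun i j => if i = j then 1 else if j < i then C i j else 0

/-- Row k of the Coxeter transformation is the unit row minus a combination of later rows and unit
rows. Moving the later rows to the left produces the upper part, and the unit rows leave the lower
part. -/
theorem upperPart_mul_coxeterTransformation (hC : ∀ i, C i i = 2) :
    upperPart C * coxeterTransformation C = -lowerPart C := by
  ext k j
  have hk : coxeterTransformation C k j = (1 : Matrix (Fin n) (Fin n) ℤ) k j -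
      ∑ i, C k i * partialCoxeter C (k + 1) i j := by
    rw [← partialCoxeter_apply_of_le C le_rfl, partialCoxeter_succ, simpleReflection_mul_apply,
      if_pos rfl, partialCoxeter_apply_of_lt C (by omega) (by omega), Matrix.mul_apply]
  -- For i > k the partial product already has its final row; for i ≤ k it still has the identity
  -- row, and the last summand removes that contribution.
  have hterm : ∀ i, upperPart C k i * coxeterTransformation C i j =
      (if i = k then coxeterTransformation C k j else 0) + C k i * partialCoxeter C (k + 1) i j -
        (if i = j then (if i ≤ k then C k i else 0) else 0) := by
    intro i
    rcases lt_trichotomy i k with h | h | h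
    · rw [partialCoxeter_apply_of_lt C (by omega) (by omega)]
      simp [upperPart, h.ne, h.ne', h.not_gt, h.le, Matrix.one_apply]
    · subst h
      rw [partialCoxeter_apply_of_lt C (by omega) (by omega)]
      simp [upperPart, Matrix.one_apply]
    · rw [partialCoxeter_apply_of_le C (by omega)]
      simp [upperPart, h.ne, h.ne', h, h.not_ge]
  rw [Matrix.mul_apply, Finset.sum_congr rfl fun i _ => hterm i, Finset.sum_sub_distrib,
    Finset.sum_add_distrib, Finset.sum_ite_eq', Finset.sum_ite_eq', if_pos (Finset.mem_univ _),
    if_pos (Finset.mem_univ _), hk, sub_add_cancel]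
  rcases lt_trichotomy j k with h | h | h
  · simp [lowerPart, h.ne', h, h.le]
  · subst h
    simp [lowerPart, hC]
  · simp [lowerPart, h.ne, h.not_gt, h.not_ge]

theorem det_upperPart : (upperPart C).det = 1 := by
  rw [Matrix.det_of_isUpperTriangular]
  · simp [upperPart]
  · intro i j hij
    have hij' : j < i := hij
    simp [upperPart, hij'.ne', hij'.not_gt]

/-- Multiplication by the upper part U, of determinant 1, turns q - c into q U + L. -/
theorem eval_charpoly_coxeterTransformation (hC : ∀ i, C i i = 2) (q : ℂ) :
    ((coxeterTransformation C).map (fun x : ℤ => (x : ℂ))).charpoly.eval q =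
      (triScale C (1 + q) q 1).det := by
  set f := Int.castRingHom ℂ
  have h1 : ((upperPart C).map f).det = 1 := by
    have := RingHom.map_det f (upperPart C)
    rw [det_upperPart, map_one] at this
    exact this.symm
  have h2 : (upperPart C).map f * (coxeterTransformation C).map f = -(lowerPart C).map f := by
    rw [← Matrix.map_mul, upperPart_mul_coxeterTransformation C hC]
    ext i j
    simp
  have h3 (M : Matrix (Fin n) (Fin n) ℂ) : M.det = ((upperPart C).map f * M).det := by
    rw [Matrix.det_mul, h1, one_mul]
  rw [Matrix.eval_charpoly, h3, Matrix.mul_sub]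
  congr 1
  change (upperPart C).map f * _ - (upperPart C).map f * (coxeterTransformation C).map f = _
  rw [h2]
  ext i j
  rcases lt_trichotomy i j with h | h | h
  · simp [upperPart, lowerPart, triScale, h.ne, h, h.not_gt, f, mul_comm]
  · subst h
    simp [upperPart, lowerPart, triScale]
    ring
  · simp [upperPart, lowerPart, triScale, h.ne', h, h.not_gt, f]

end Coxeter

/-! ### Profiles: one determinant controlling both spectrum and cosine product. -/

open Polynomial in
/-- A generalized Cartan matrix with prescribed determinants of its triangular rescalings. -/
structure HasProfile {n : ℕ} (C : Matrix (Fin n) (Fin n) ℤ) (Δ : Multiset ℕ) (h : ℕ) : Prop where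
  pos : 0 < h
  le : ∀ m ∈ Δ, m ≤ h
  duality : Δ.map (fun m => h - m) = Δ
  card : Multiset.card Δ = n
  diag : ∀ i, C i i = 2
  -- Used with `(q, 1)` for the characteristic polynomial and with `(z, z)` for the adjacency
  -- determinant. The excluded value allows cancelling `1 - p * s` and is harmless for polynomial
  -- identities.
  det : ∀ p s : ℂ, p * s ≠ 1 → (triScale C (1 + p * s) p s).det =
    (Δ.map fun m : ℕ => p * s - Complex.exp (2 * Real.pi * Complex.I * m / h)).prod

namespace HasProfile

variable {n : ℕ} {C : Matrix (Fin n) (Fin n) ℤ} {Δ : Multiset ℕ} {h : ℕ} (hP : HasProfile C Δ h)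
include hP

theorem isExponents : IsExponents C Δ h where
  pos := hP.pos
  le := hP.le
  duality := hP.duality
  spectrum := by
    refine Polynomial.eq_of_infinite_eval_eq _ _
      (Set.Infinite.mono ?_ (Set.finite_singleton (1 : ℂ)).infinite_compl)
    intro q hq
    rw [Set.mem_ofPred_eq, eval_charpoly_coxeterTransformation C hP.diag,
      Polynomial.eval_multiset_prod, Multiset.map_map]
    have := hP.det q 1 (by simpa using hq)
    simpa using this

/-- With e_m = exp(πim/h) each left factor is (z - e_m)(z - e_m⁻¹). Since e_{h-m}⁻¹ = -e_m, duality
replaces the second factors by z + e_m, and the products become z² - e_m². -/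
theorem prod_sub_cos (z : ℂ) :
    (Δ.map fun m : ℕ => 1 + z * z - ((2 * Real.cos (m * Real.pi / h) : ℝ) : ℂ) * z).prod =
      (Δ.map fun m : ℕ => z * z - Complex.exp (2 * Real.pi * Complex.I * m / h)).prod := by
  have hh : (h : ℂ) ≠ 0 := by exact_mod_cast hP.pos.ne'
  set e : ℕ → ℂ := fun m => Complex.exp (Real.pi * Complex.I * m / h) with he
  have h1 : ∀ m : ℕ, 1 + z * z - ((2 * Real.cos (m * Real.pi / h) : ℝ) : ℂ) * z =
      (z - e m) * (z - (e m)⁻¹) := by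
    intro m
    have h2 : ((2 * Real.cos (m * Real.pi / h) : ℝ) : ℂ) = e m + (e m)⁻¹ := by
      rw [he, ← Complex.exp_neg]
      push_cast
      rw [Complex.two_cos]
      congr 2 <;> ring
    have h3 : e m * (e m)⁻¹ = 1 := mul_inv_cancel₀ (Complex.exp_ne_zero _)
    rw [h2]
    linear_combination -h3
  have h4 : (Δ.map fun m : ℕ => z - (e m)⁻¹) = Δ.map fun m : ℕ => z + e m := by
    conv_lhs => rw [← hP.duality, Multiset.map_map]
    refine Multiset.map_congr rfl fun m hm => ?_
    rw [Function.comp_apply, he, ← Complex.exp_neg, sub_eq_add_neg]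
    congr 1
    have : -(Real.pi * Complex.I * ((h - m : ℕ) : ℂ) / h) =
        Real.pi * Complex.I * m / h - Real.pi * Complex.I := by
      rw [Nat.cast_sub (hP.le m hm)]
      field_simp
      ring
    rw [this, Complex.exp_sub_pi_mul_I, neg_neg]
  simp_rw [h1, Multiset.prod_map_mul]
  rw [h4, ← Multiset.prod_map_mul]
  congr 1
  refine Multiset.map_congr rfl fun m _ => ?_
  have : Complex.exp (2 * Real.pi * Complex.I * m / h) = e m * e m := by
    rw [he, ← Complex.exp_add]
    congr 1
    ring
  rw [this]
  ring

/-- Substituting t = z / (1 + z²) and clearing (1 + z²)ⁿ turns det(I - tA) into the symmetric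
scaling of C, and each cosine factor into 1 + z² - 2cos(mπ/h) z. -/
theorem detSeries_eq_cosProduct {I : Type} [Fintype I] [DecidableEq I] {A : Matrix I I ℕ}
    {e : I ≃ Fin n} (hA : IsDynkin A C e) : detSeries A = cosProduct Δ h := by
  set P : Polynomial ℂ :=
    (1 - (Polynomial.X : Polynomial ℂ) •
      (A.map fun a : ℕ => (a : Polynomial ℂ)).transpose).det with hPdef
  set Q : Polynomial ℂ := (Δ.map fun m : ℕ =>
    (1 - Polynomial.C ((2 * Real.cos (m * Real.pi / h) : ℝ) : ℂ) * Polynomial.X)).prod with hQdef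
  have hc (a : ℕ) : ((a : Polynomial ℂ) : ℂ⟦X⟧) = a :=
    map_natCast (Polynomial.coeToPowerSeries.ringHom (R := ℂ)) a
  have h1 : detSeries A = Polynomial.coeToPowerSeries.ringHom P := by
    rw [hPdef, RingHom.map_det, detSeries]
    congr 1
    ext1 i j
    by_cases hij : i = j
    · subst hij
      simp [hc]
    · simp [hij, hc]
  have h2 : cosProduct Δ h = Polynomial.coeToPowerSeries.ringHom Q := by
    rw [hQdef, map_multiset_prod, Multiset.map_map, cosProduct]
    congr 1
    refine Multiset.map_congr rfl fun m _ => ?_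
    simp
  rw [h1, h2]
  congr 1
  -- The value 0 is excluded to solve the quadratic equation for z; ±1/2 are the values for which z²
  -- = 1.
  refine Polynomial.eq_of_infinite_eval_eq _ _
    (Set.Infinite.mono ?_ (Set.Finite.infinite_compl (s := {0, 1 / 2, -1 / 2}) (by simp)))
  intro t ht
  simp only [Set.mem_compl_iff, Set.mem_insert_iff, Set.mem_singleton_iff, not_or] at ht
  obtain ⟨ht0, ht1, ht2⟩ := ht
  obtain ⟨z, hz⟩ : ∃ z : ℂ, z = t * (1 + z * z) := by
    obtain ⟨w, hw⟩ := IsAlgClosed.exists_pow_nat_eq (1 - 4 * t ^ 2) two_pos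
    refine ⟨(1 + w) / (2 * t), ?_⟩
    field_simp
    linear_combination (-1) * hw
  have hz1 : 1 + z * z ≠ 0 := by
    intro h0
    rw [h0, mul_zero] at hz
    rw [hz] at h0
    simp at h0
  have hzz : z * z ≠ 1 := by
    intro h0
    have h3 : (z - 1) * (z + 1) = 0 := by linear_combination h0
    rcases mul_eq_zero.1 h3 with h4 | h4
    · apply ht1
      rw [sub_eq_zero.1 h4] at hz
      linear_combination (-1 / 2) * hz
    · apply ht2
      rw [eq_neg_of_add_eq_zero_left h4] at hz
      linear_combination (-1 / 2) * hz
  rw [Set.mem_ofPred_eq]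
  have h3 : (1 + z * z) ^ n * P.eval t = (triScale C (1 + z * z) z z).det := by
    have hcard : Fintype.card I = n := by rw [Fintype.card_congr e, Fintype.card_fin]
    have h4 : P.eval t = (1 - t • (A.map fun a : ℕ => (a : ℂ)).transpose).det := by
      rw [hPdef, ← Polynomial.coe_evalRingHom, RingHom.map_det]
      congr 1
      ext i j
      simp [Matrix.one_apply, apply_ite (Polynomial.eval t)]
    have h4' : (1 + z * z) ^ n = (1 + z * z) ^ Fintype.card I := by rw [hcard]
    rw [h4, h4', ← Matrix.det_submatrix_equiv_self e (triScale _ _ _ _), ← Matrix.det_smul, ← Matrix.det_transpose]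
    congr 1
    ext i j
    have hij := congr_fun (congr_fun hA i) j
    simp only [Matrix.sub_apply, Matrix.submatrix_apply, Matrix.map_apply] at hij
    rw [Matrix.transpose_apply, Matrix.smul_apply, Matrix.sub_apply, Matrix.smul_apply,
      Matrix.transpose_apply, Matrix.map_apply, smul_eq_mul, smul_eq_mul, Matrix.submatrix_apply,
      triScale, Matrix.of_apply]
    by_cases h5 : i = j
    · subst h5
      rw [hP.diag] at hij
      have h6 : A i i = 0 := by
        have : (2 : Matrix I I ℤ) i i = 2 := by rw [← Matrix.diagonal_ofNat, Matrix.diagonal_apply_eq]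
        rw [this] at hij
        omega
      simp [h6]
    · have h6 : (A i j : ℂ) = -(C (e i) (e j) : ℂ) := by
        have : (2 : Matrix I I ℤ) i j = 0 := by rw [← Matrix.diagonal_ofNat, Matrix.diagonal_apply_ne _ h5]
        rw [this] at hij
        rw [← hij]
        simp
      have h7 : ((1 : Matrix I I ℂ) j i) = 0 := Matrix.one_apply_ne (Ne.symm h5)
      rw [h7, if_neg (fun h => h5 (e.injective h)), ite_self, h6]
      linear_combination (-(C (e i) (e j) : ℂ)) * hz
  have h4 : (1 + z * z) ^ n * Q.eval t =
      (Δ.map fun m : ℕ => 1 + z * z - ((2 * Real.cos (m * Real.pi / h) : ℝ) : ℂ) * z).prod := by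
    rw [hQdef, Polynomial.eval_multiset_prod, Multiset.map_map, ← hP.card,
      ← Multiset.prod_replicate, ← Multiset.map_const', ← Multiset.prod_map_mul]
    congr 1
    refine Multiset.map_congr rfl fun m _ => ?_
    simp only [Function.comp_apply, Polynomial.eval_sub, Polynomial.eval_one, Polynomial.eval_mul,
      Polynomial.eval_C, Polynomial.eval_X]
    linear_combination ((2 * Real.cos (m * Real.pi / h) : ℝ) : ℂ) * hz
  apply mul_left_cancel₀ (pow_ne_zero n hz1)
  rw [h3, h4, hP.det z z hzz, hP.prod_sub_cos]

end HasProfile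

theorem prod_exp_range (n : ℕ) (hn : 0 < n) (q : ℂ) :
    ((Multiset.range n).map fun m : ℕ =>
      q - Complex.exp (2 * Real.pi * Complex.I * m / n)).prod = q ^ n - 1 := by
  have h := congr_arg (Polynomial.eval q)
    (X_pow_sub_C_eq_prod (Complex.isPrimitiveRoot_exp n hn.ne') hn (one_pow n))
  rw [Polynomial.eval_prod] at h
  simp only [Polynomial.eval_sub, Polynomial.eval_pow, Polynomial.eval_X, Polynomial.eval_C] at h
  rw [h]
  refine congr_arg Multiset.prod (Multiset.map_congr rfl fun m _ => ?_)
  rw [mul_one, ← Complex.exp_nat_mul]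
  congr 3
  ring

/-- Distinct exponents below h make the characteristic polynomial divide Xʰ - 1, so Cayley–Hamilton
bounds the order. The exponent 1 supplies an eigenvector for a primitive h-th root of unity, so h
divides the order. -/
theorem orderOf_coxeterTransformation {n : ℕ} {C : Matrix (Fin n) (Fin n) ℤ} {Δ : Multiset ℕ}
    {h : ℕ} (hE : IsExponents C Δ h) (hnd : Δ.Nodup) (hlt : ∀ m ∈ Δ, m < h) (h1 : 1 ∈ Δ) :
    orderOf (coxeterTransformation C) = h := by
  set M : Matrix (Fin n) (Fin n) ℂ := (coxeterTransformation C).map (fun x : ℤ => (x : ℂ)) with hM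
  have hpow : ∀ k, M ^ k = ((coxeterTransformation C) ^ k).map (fun x : ℤ => (x : ℂ)) := fun k =>
    (map_pow (Int.castRingHom ℂ).mapMatrix (coxeterTransformation C) k).symm
  have hone : ∀ k, M ^ k = 1 ↔ coxeterTransformation C ^ k = 1 := by
    intro k
    rw [hpow, ← Matrix.map_one (fun x : ℤ => (x : ℂ)) (by simp) (by simp)]
    exact (Matrix.map_injective Int.cast_injective).eq_iff
  have hζ := Complex.isPrimitiveRoot_exp h hE.pos.ne'
  apply Nat.dvd_antisymm
  · apply orderOf_dvd_of_pow_eq_one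
    rw [← hone]
    have hdvd : M.charpoly ∣ Polynomial.X ^ h - Polynomial.C 1 := by
      rw [hE.spectrum, X_pow_sub_C_eq_prod hζ hE.pos (one_pow h)]
      have hle : Δ ≤ Multiset.range h :=
        (Multiset.le_iff_subset hnd).2 fun m hm => Multiset.mem_range.2 (hlt m hm)
      refine (Multiset.prod_dvd_prod_of_le (Multiset.map_le_map hle)).trans (dvd_of_eq ?_)
      refine congr_arg Multiset.prod (Multiset.map_congr rfl fun m _ => ?_)
      rw [mul_one, ← Complex.exp_nat_mul]
      congr 3
      ring
    obtain ⟨R, hR⟩ := hdvd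
    have := congr_arg (Polynomial.aeval M) hR
    rw [map_mul, Matrix.aeval_self_charpoly, zero_mul] at this
    simpa [sub_eq_zero] using this
  · have hroot : M.charpoly.eval (Complex.exp (2 * Real.pi * Complex.I / h)) = 0 := by
      rw [hE.spectrum, Polynomial.eval_multiset_prod, Multiset.map_map]
      apply Multiset.prod_eq_zero
      rw [Multiset.mem_map]
      exact ⟨1, h1, by simp⟩
    rw [Matrix.eval_charpoly] at hroot
    obtain ⟨v, hv, hv0⟩ := Matrix.exists_mulVec_eq_zero_iff.2 hroot
    rw [Matrix.sub_mulVec, sub_eq_zero] at hv0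
    set ζ := Complex.exp (2 * Real.pi * Complex.I / h)
    have hv1 : M.mulVec v = ζ • v := by
      rw [← hv0, Matrix.scalar_apply, ← Matrix.smul_one_eq_diagonal, Matrix.smul_mulVec,
        Matrix.one_mulVec]
    have hvk : ∀ k, (M ^ k).mulVec v = ζ ^ k • v := by
      intro k
      induction k with
      | zero => simp
      | succ k ih => rw [pow_succ, ← Matrix.mulVec_mulVec, hv1, Matrix.mulVec_smul, ih, smul_smul,
          pow_succ, mul_comm]
    have h3 := hvk (orderOf (coxeterTransformation C))
    rw [(hone _).2 (pow_orderOf_eq_one _), Matrix.one_mulVec] at h3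
    obtain ⟨i, hi⟩ := Function.ne_iff.1 hv
    have h4 := congr_fun h3 i
    rw [Pi.smul_apply, smul_eq_mul] at h4
    exact hζ.dvd_of_pow_eq_one _ (mul_right_cancel₀ hi (by rw [one_mul]; exact h4.symm))

/-! ### Determinants of paths and forks. -/

section Determinants

/-- The entries of the Cartan matrix of a path, indexed by natural numbers. -/
def pathEntry (w : ℕ → ℕ → ℤ) (i j : ℕ) : ℤ :=
  if i = j then 2 else if i + 1 = j ∨ j + 1 = i then - w i j else 0

/-- The entries of the Cartan matrix of a fork, indexed by natural numbers. -/
def forkEntry (w : ℕ → ℕ → ℤ) (i j : ℕ) : ℤ :=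
  if i = j then 2 else if forkBond i j ∨ forkBond j i then - w i j else 0

/-- The entries of `triScale`, indexed by natural numbers. -/
def triEntry (c : ℕ → ℕ → ℤ) (a p s : ℂ) (i j : ℕ) : ℂ :=
  if i = j then a else if i < j then p * c i j else s * c i j

theorem triScale_eq {n : ℕ} {C : Matrix (Fin n) (Fin n) ℤ} {c : ℕ → ℕ → ℤ}
    (hC : ∀ i j : Fin n, C i j = c i j) (a p s : ℂ) :
    triScale C a p s = Matrix.of fun i j : Fin n => triEntry c a p s i j := by
  ext i j
  simp only [triScale, triEntry, Matrix.of_apply, hC, Fin.ext_iff, Fin.lt_def]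

/-- The leading minors of the triangular rescaling of the Cartan matrix of a path, where `v k` is
the product of the two labels of the bond between `k` and `k + 1`. -/
def pathDet (q : ℂ) (v : ℕ → ℤ) : ℕ → ℂ
  | 0 => 1
  | 1 => 1 + q
  | k + 2 => (1 + q) * pathDet q v (k + 1) - q * v k * pathDet q v k

theorem det_path {n : ℕ} {C : Matrix (Fin n) (Fin n) ℤ} {w : ℕ → ℕ → ℤ}
    (hC : ∀ i j : Fin n, C i j = pathEntry w i j) (p s : ℂ) :
    (triScale C (1 + p * s) p s).det =
      pathDet (p * s) (fun k => w k (k + 1) * w (k + 1) k) n := by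
  rw [triScale_eq hC]
  clear hC C
  induction n using Nat.twoStepInduction with
  | zero => simp [pathDet]
  | one => simp [pathDet, triEntry]
  | more k ih1 ih2 =>
    rw [det_tridiagonal_succ (triEntry (pathEntry w) (1 + p * s) p s) k, ih1, ih2, pathDet]
    · have e1 : triEntry (pathEntry w) (1 + p * s) p s (k + 1) (k + 1) = 1 + p * s := by
        simp [triEntry]
      have e2 : triEntry (pathEntry w) (1 + p * s) p s k (k + 1) = -(p * w k (k + 1)) := by
        simp [triEntry, pathEntry]
      have e3 : triEntry (pathEntry w) (1 + p * s) p s (k + 1) k = -(s * w (k + 1) k) := by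
        simp [triEntry, pathEntry]
      rw [e1, e2, e3]
      push_cast
      ring
    · intro j hj
      simp only [triEntry, pathEntry]
      rw [if_neg (by omega), if_neg (by omega), if_neg (by omega), if_neg (by omega)]
      simp
    · intro j hj
      simp only [triEntry, pathEntry]
      rw [if_neg (by omega), if_pos (by omega), if_neg (by omega), if_neg (by omega)]
      simp

theorem pathDet_of_simple (q : ℂ) (v : ℕ → ℤ) (n : ℕ) (h : ∀ k, k + 2 ≤ n → v k = 1) :
    (1 - q) * pathDet q v n = 1 - q ^ (n + 1) := by
  induction n using Nat.twoStepInduction with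
  | zero => simp [pathDet]
  | one => simp [pathDet]; ring
  | more k ih1 ih2 =>
    have h1 := ih1 fun j hj => h j (by omega)
    have h2 := ih2 fun j hj => h j (by omega)
    rw [pathDet, h k le_rfl]
    push_cast
    linear_combination (1 + q) * h2 - q * h1

/-- Only products of opposite labels enter the recurrence, so the direction of the double arrow is
immaterial: B and C share the value. -/
theorem pathDet_of_double_first (q : ℂ) (v : ℕ → ℤ) (n : ℕ) (hn : 1 ≤ n) (h0 : v 0 = 2)
    (h : ∀ k, 1 ≤ k → k + 2 ≤ n → v k = 1) : pathDet q v n = 1 + q ^ n := by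
  induction n using Nat.twoStepInduction with
  | zero => simp at hn
  | one => simp [pathDet]
  | more k ih1 ih2 =>
    have h2 := ih2 (by omega) fun j hj hj' => h j hj (by omega)
    rw [pathDet, h2]
    rcases Nat.eq_zero_or_pos k with rfl | hk
    · rw [h0]
      simp [pathDet]
      ring
    · rw [h k hk le_rfl, ih1 hk fun j hj hj' => h j hj (by omega)]
      push_cast
      ring

theorem pathDet_of_double_last (q : ℂ) (hq : q ≠ 1) (v : ℕ → ℤ) (n : ℕ)
    (h0 : v n = 2) (h : ∀ k < n, v k = 1) : pathDet q v (n + 2) = 1 + q ^ (n + 2) := by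
  have h1 := pathDet_of_simple q v n fun k hk => h k (by omega)
  have h2 := pathDet_of_simple q v (n + 1) fun k hk => h k (by omega)
  apply mul_left_cancel₀ (sub_ne_zero.2 hq.symm)
  rw [pathDet, h0]
  push_cast
  linear_combination (1 + q) * h2 - 2 * q * h1

theorem pathDet_of_double_both (q : ℂ) (v : ℕ → ℤ) (n : ℕ) (h0 : v 0 = 2) (h1 : v (n + 1) = 2)
    (h : ∀ k, 1 ≤ k → k ≤ n → v k = 1) : pathDet q v (n + 3) = (1 - q) * (1 - q ^ (n + 2)) := by
  rw [pathDet, h1, pathDet_of_double_first q v (n + 2) (by omega) h0 fun k hk hk' =>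
    h k hk (by omega), pathDet_of_double_first q v (n + 1) (by omega) h0 fun k hk hk' =>
    h k hk (by omega)]
  push_cast
  ring

/-- The leading minors before the last vertex are those of type D, namely (1 + q)(1 + q^(k+1)) in
size k + 2. The final double bond is one more step of the recurrence, with coefficient 2. -/
theorem det_fork {n : ℕ} {C : Matrix (Fin (n + 4)) (Fin (n + 4)) ℤ} {w : ℕ → ℕ → ℤ}
    (hC : ∀ i j : Fin (n + 4), C i j = forkEntry w i j) (h1 : w 0 2 = 1) (h2 : w 2 0 = 1)
    (h : ∀ k, 1 ≤ k → k ≤ n + 1 → w k (k + 1) = 1 ∧ w (k + 1) k = 1)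
    (hl : w (n + 2) (n + 3) * w (n + 3) (n + 2) = 2) (p s : ℂ) :
    (triScale C (1 + p * s) p s).det =
      (1 + p * s) * (1 - p * s) * (1 - (p * s) ^ (n + 2)) := by
  rw [triScale_eq hC]
  set D : ℕ → ℂ := fun k =>
    (Matrix.of fun i j : Fin k => triEntry (forkEntry w) (1 + p * s) p s i j).det with hD
  have hrec : ∀ k, D (k + 4) =
      (1 + p * s) * D (k + 3) -
        p * s * (w (k + 2) (k + 3) * w (k + 3) (k + 2) : ℤ) * D (k + 2) := by
    intro k
    rw [hD]
    simp only
    rw [det_tridiagonal_succ (triEntry (forkEntry w) (1 + p * s) p s) (k + 2)]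
    · have e1 : triEntry (forkEntry w) (1 + p * s) p s (k + 3) (k + 3) = 1 + p * s := by
        simp [triEntry]
      have e2 : triEntry (forkEntry w) (1 + p * s) p s (k + 2) (k + 3) =
          -(p * w (k + 2) (k + 3)) := by
        simp [triEntry, forkEntry, forkBond]
      have e3 : triEntry (forkEntry w) (1 + p * s) p s (k + 3) (k + 2) =
          -(s * w (k + 3) (k + 2)) := by
        simp [triEntry, forkEntry, forkBond]
      rw [e1, e2, e3]
      push_cast
      ring
    · intro j hj
      simp only [triEntry, forkEntry, forkBond]
      rw [if_neg (by omega), if_neg (by omega), if_neg (by omega), if_neg (by omega)]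
      simp
    · intro j hj
      simp only [triEntry, forkEntry, forkBond]
      rw [if_neg (by omega), if_pos (by omega), if_neg (by omega), if_neg (by omega)]
      simp
  have hlow : ∀ k ≤ n, D (k + 3) = (1 + p * s) * (1 + (p * s) ^ (k + 2)) ∧
      D (k + 2) = (1 + p * s) * (1 + (p * s) ^ (k + 1)) := by
    intro k
    induction k with
    | zero =>
      intro _
      obtain ⟨h3, h4⟩ := h 1 le_rfl (by omega)
      constructor
      · rw [hD]
        simp only
        rw [Matrix.det_fin_three]
        simp [triEntry, forkEntry, forkBond, h1, h2] at h3 h4 ⊢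
        simp [h3, h4]
        ring
      · rw [hD]
        simp only
        rw [Matrix.det_fin_two]
        simp [triEntry, forkEntry, forkBond]
    | succ k ih =>
      intro hk
      obtain ⟨h3, h4⟩ := ih (by omega)
      obtain ⟨h5, h6⟩ := h (k + 2) (by omega) (by omega)
      refine ⟨?_, h3⟩
      rw [hrec, h3, h4, h5, h6]
      push_cast
      ring
  obtain ⟨h3, h4⟩ := hlow n le_rfl
  change D (n + 4) = _
  rw [hrec, h3, h4, hl]
  push_cast
  ring

end Determinants

/-! ### Products over the exponents. -/

section Exponents

open Complex

/-- The odd powers of a primitive 2n-th root of unity are the n-th roots of -1. -/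
theorem prod_exp_odd (n : ℕ) (hn : 0 < n) (q : ℂ) :
    (((Multiset.range n).map fun j => 2 * j + 1).map fun m : ℕ =>
      q - exp (2 * Real.pi * I * m / (2 * n : ℕ))).prod = 1 + q ^ n := by
  have hn0 : (n : ℂ) ≠ 0 := by exact_mod_cast hn.ne'
  have hα : exp (Real.pi * I / n) ^ n = -1 := by
    rw [← exp_nat_mul, mul_div_cancel₀ _ hn0, exp_pi_mul_I]
  have h := congr_arg (Polynomial.eval q)
    (X_pow_sub_C_eq_prod (isPrimitiveRoot_exp n hn.ne') hn hα)
  rw [Polynomial.eval_prod] at h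
  simp only [Polynomial.eval_sub, Polynomial.eval_pow, Polynomial.eval_X, Polynomial.eval_C] at h
  rw [add_comm, ← sub_neg_eq_add, h, Multiset.map_map]
  refine congr_arg Multiset.prod (Multiset.map_congr rfl fun m _ => ?_)
  rw [← exp_nat_mul, ← exp_add, Function.comp_apply]
  congr 2
  push_cast
  field_simp

theorem prod_exp_range_succ (n : ℕ) (hn : 0 < n) (q : ℂ) :
    ((Multiset.range (n + 1)).map fun m : ℕ => q - exp (2 * Real.pi * I * m / n)).prod =
      (1 - q) * (1 - q ^ n) := by
  have hn0 : (n : ℂ) ≠ 0 := by exact_mod_cast hn.ne'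
  rw [Multiset.range_succ, Multiset.map_cons, Multiset.prod_cons, prod_exp_range n hn,
    mul_div_cancel_right₀ _ hn0, exp_two_pi_mul_I]
  ring

theorem exp_two_pi_half (m h : ℕ) (hm : 2 * m = h) (hh : 0 < h) :
    exp (2 * Real.pi * I * m / h) = -1 := by
  rw [← exp_pi_mul_I]
  congr 1
  have : (h : ℂ) ≠ 0 := by exact_mod_cast hh.ne'
  rw [div_eq_iff this, ← hm]
  push_cast
  ring

/-- The extra exponent is half the Coxeter number and contributes 1 + q. For even n everything is
doubled, since (n - 1)/2 is then not an integer; the roots of unity are unchanged. -/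
theorem prod_exp_exponentsB (n : ℕ) (hn : 2 ≤ n) (q : ℂ) :
    ((AffineType.exponentsB n).map fun m : ℕ =>
      q - exp (2 * Real.pi * I * m / AffineType.coxeterNumberB n)).prod =
      (1 + q) * (1 - q) * (1 - q ^ (n - 1)) := by
  have hr := prod_exp_range_succ (n - 1) (by omega) q
  rw [Nat.sub_add_cancel (by omega)] at hr
  rw [AffineType.exponentsB, AffineType.coxeterNumberB]
  split_ifs with h
  · rw [Multiset.map_add, Multiset.prod_add, Multiset.map_map, Multiset.map_singleton,
      Multiset.prod_singleton, exp_two_pi_half _ _ rfl (by omega), mul_assoc (1 + q), ← hr, mul_comm]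
    congr 1
    · ring
    · refine congr_arg Multiset.prod (Multiset.map_congr rfl fun m _ => ?_)
      rw [Function.comp_apply]
      congr 2
      push_cast
      rw [mul_left_comm, mul_div_mul_left _ _ two_ne_zero]
  · rw [Multiset.map_add, Multiset.prod_add, Multiset.map_singleton, Multiset.prod_singleton,
      exp_two_pi_half _ _ (by
        have := Nat.not_even_iff_odd.1 h
        obtain ⟨k, rfl⟩ := this
        omega) (by omega), hr]
    ring

theorem dual_of_nodup {Δ : Multiset ℕ} {h : ℕ} (hnd : Δ.Nodup) (hle : ∀ m ∈ Δ, m ≤ h)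
    (hd : ∀ m ∈ Δ, h - m ∈ Δ) : Δ.map (fun m => h - m) = Δ := by
  refine (Multiset.Nodup.ext (hnd.map_on fun a ha b hb hab => ?_) hnd).2 fun m => ?_
  · have := hle a ha
    have := hle b hb
    omega
  · rw [Multiset.mem_map]
    constructor
    · rintro ⟨a, ha, rfl⟩
      exact hd a ha
    · intro hm
      exact ⟨h - m, hd m hm, Nat.sub_sub_self (hle m hm)⟩

theorem dual_range_succ (n : ℕ) :
    (Multiset.range (n + 1)).map (fun m => n - m) = Multiset.range (n + 1) :=
  dual_of_nodup (Multiset.nodup_range _) (fun m hm => by rw [Multiset.mem_range] at hm; omega)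
    fun m _ => by rw [Multiset.mem_range]; omega

theorem exponentsB_le (n : ℕ) (hn : 2 ≤ n) :
    ∀ m ∈ AffineType.exponentsB n, m ≤ AffineType.coxeterNumberB n := by
  intro m hm
  rw [AffineType.exponentsB] at hm
  rw [AffineType.coxeterNumberB]
  split_ifs at hm ⊢ <;> simp at hm <;> omega

theorem exponentsB_dual (n : ℕ) (hn : 2 ≤ n) :
    (AffineType.exponentsB n).map (fun m => AffineType.coxeterNumberB n - m) =
      AffineType.exponentsB n := by
  have hr := dual_range_succ (n - 1)
  rw [Nat.sub_add_cancel (by omega)] at hr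
  rw [AffineType.exponentsB, AffineType.coxeterNumberB]
  split_ifs with h
  · rw [Multiset.map_add, Multiset.map_map]
    congr 1
    · conv_rhs => rw [← hr, Multiset.map_map]
      refine Multiset.map_congr rfl fun m _ => ?_
      simp only [Function.comp_apply]
      omega
    · rw [Multiset.map_singleton]
      congr 1
      omega
  · rw [Multiset.map_add, hr, Multiset.map_singleton]
    congr 2
    obtain ⟨k, rfl⟩ := Nat.not_even_iff_odd.1 h
    omega

theorem card_exponentsB (n : ℕ) : Multiset.card (AffineType.exponentsB n) = n + 1 := by
  rw [AffineType.exponentsB]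
  split_ifs <;> simp

end Exponents

theorem exp_div_eq_pow (m h : ℕ) :
    Complex.exp (2 * Real.pi * Complex.I * m / h) =
      Complex.exp (2 * Real.pi * Complex.I / h) ^ m := by
  rw [← Complex.exp_nat_mul]
  congr 1
  ring

theorem primitive_root_six {η : ℂ} (hη : IsPrimitiveRoot η 6) : η ^ 2 = η - 1 := by
  have h6 : (η ^ 3 - 1) * (η + 1) * (η ^ 2 - η + 1) = 0 := by linear_combination hη.pow_eq_one
  have h3 : η ^ 3 - 1 ≠ 0 := sub_ne_zero.2 (hη.pow_ne_one_of_pos_of_lt (by norm_num) (by norm_num))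
  have h2 : η + 1 ≠ 0 := fun h => hη.pow_ne_one_of_pos_of_lt (l := 2) (by norm_num) (by norm_num)
    (by rw [eq_neg_of_add_eq_zero_left h]; norm_num)
  have := (mul_eq_zero.1 h6).resolve_left (mul_ne_zero h3 h2)
  linear_combination this

/-! ### Exponents of the finite types. -/

namespace FiniteType

theorem pathEntry_A1 : ∀ i j : Fin 1, A1.cartan i j = pathEntry (fun _ _ => 1) i j := by
  intro i j
  fin_cases i; fin_cases j; rfl

theorem hasProfile_A1 : HasProfile A1.cartan A1.exponents A1.coxeterNumber where
  pos := by decide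
  le := by decide
  duality := by decide
  card := by decide
  diag := by decide
  det p s _ := by
    rw [det_path pathEntry_A1]
    have h := exp_two_pi_half 1 2 rfl two_pos
    simp only [exponents, coxeterNumber, Multiset.map_singleton, Multiset.prod_singleton, pathDet]
    rw [h]
    ring

theorem pathEntry_G2 : ∀ i j : Fin 2, G2.cartan i j = pathEntry (fun i _ => if i = 1 then 3 else 1) i j := by
  intro i j
  fin_cases i <;> fin_cases j <;> rfl

theorem hasProfile_G2 : HasProfile G2.cartan G2.exponents G2.coxeterNumber where
  pos := by decide
  le := by decide
  duality := by decide
  card := by decide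
  diag := by decide
  det p s _ := by
    rw [det_path pathEntry_G2]
    have hη := Complex.isPrimitiveRoot_exp 6 (by norm_num)
    have h1 := primitive_root_six hη
    have h6 := hη.pow_eq_one
    have e1 := exp_div_eq_pow 1 6
    have e5 := exp_div_eq_pow 5 6
    simp only [exponents, coxeterNumber, Multiset.insert_eq_cons, Multiset.map_cons,
      Multiset.map_singleton, Multiset.prod_cons, Multiset.prod_singleton, pathDet]
    rw [e1, e5]
    generalize Complex.exp (2 * Real.pi * Complex.I / (6 : ℕ)) = η at *
    have h5 : η ^ 5 = 1 - η := by
      linear_combination (η ^ 3 + η ^ 2 - 1) * h1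
    rw [h5]
    norm_num
    linear_combination h1

theorem pathEntry_F4 : ∀ i j : Fin 4, F4.cartan i j = pathEntry (fun i j => if i = 2 ∧ j = 1 then 2 else 1) i j := by
  intro i j
  fin_cases i <;> fin_cases j <;> rfl

theorem hasProfile_F4 : HasProfile F4.cartan F4.exponents F4.coxeterNumber where
  pos := by decide
  le := by decide
  duality := by decide
  card := by decide
  diag := by decide
  det p s _ := by
    rw [det_path pathEntry_F4]
    have hζ := Complex.isPrimitiveRoot_exp 12 (by norm_num)
    have h1 := primitive_root_six (hζ.pow (by norm_num) (show 12 = 2 * 6 by norm_num))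
    have e1 := exp_div_eq_pow 1 12
    have e5 := exp_div_eq_pow 5 12
    have e7 := exp_div_eq_pow 7 12
    have e11 := exp_div_eq_pow 11 12
    simp only [exponents, coxeterNumber, Multiset.insert_eq_cons, Multiset.map_cons,
      Multiset.map_singleton, Multiset.prod_cons, Multiset.prod_singleton, pathDet]
    rw [e1, e5, e7, e11]
    generalize Complex.exp (2 * Real.pi * Complex.I / (12 : ℕ)) = ζ at *
    have h6 : ζ ^ 6 = -1 := by linear_combination (ζ ^ 2 + 1) * h1
    have h7 : ζ ^ 7 = -ζ := by linear_combination ζ * h6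
    have h11 : ζ ^ 11 = -ζ ^ 5 := by linear_combination ζ ^ 5 * h6
    have h10 : ζ ^ 10 = 1 - ζ ^ 2 := by linear_combination ζ ^ 4 * h6 - h1
    have h12 : ζ ^ 12 = 1 := by linear_combination (ζ ^ 6 - 1) * h6
    rw [h7, h11]
    norm_num
    linear_combination (p * s) ^ 2 * h10 - h12

theorem pathEntry_B (n : ℕ) : ∀ i j : Fin n, (B n).cartan i j =
    pathEntry (fun i j => if i + 1 = n ∧ j + 1 = i then 2 else 1) i j := by
  intro i j
  have := i.2
  simp only [cartan, Matrix.transpose_apply, CartanMatrix.B, Matrix.of_apply, pathEntry,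
    Fin.ext_iff]
  split_ifs <;> first | rfl | omega

theorem pathEntry_C (n : ℕ) : ∀ i j : Fin n, (C n).cartan i j =
    pathEntry (fun i j => if j + 1 = n ∧ i + 1 = j then 2 else 1) i j := by
  intro i j
  have := j.2
  simp only [cartan, Matrix.transpose_apply, CartanMatrix.C, Matrix.of_apply, pathEntry,
    Fin.ext_iff]
  split_ifs <;> first | rfl | omega

theorem dual_odd (n : ℕ) : ((Multiset.range n).map fun j => 2 * j + 1).map (fun m => 2 * n - m) =
    (Multiset.range n).map fun j => 2 * j + 1 := by
  refine dual_of_nodup ((Multiset.nodup_range n).map fun a b h => ?_) (fun m hm => ?_)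
    fun m hm => ?_
  · omega
  · obtain ⟨j, hj, rfl⟩ := Multiset.mem_map.1 hm
    rw [Multiset.mem_range] at hj
    omega
  · obtain ⟨j, hj, rfl⟩ := Multiset.mem_map.1 hm
    rw [Multiset.mem_range] at hj
    exact Multiset.mem_map.2 ⟨n - 1 - j, Multiset.mem_range.2 (by omega), by omega⟩

/-- Common to B and C, which differ only in the direction of the last arrow. -/
theorem hasProfile_odd {n : ℕ} (hn : 2 ≤ n) {C : Matrix (Fin n) (Fin n) ℤ} {w : ℕ → ℕ → ℤ}
    (hC : ∀ i j : Fin n, C i j = pathEntry w i j)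
    (hw : ∀ k, w k (k + 1) * w (k + 1) k = if k + 2 = n then 2 else 1) :
    HasProfile C ((Multiset.range n).map fun j => 2 * j + 1) (2 * n) where
  pos := by omega
  le m hm := by
    obtain ⟨j, hj, rfl⟩ := Multiset.mem_map.1 hm
    rw [Multiset.mem_range] at hj
    omega
  duality := dual_odd n
  card := by simp
  diag i := by rw [hC, pathEntry, if_pos rfl]
  det p s h := by
    obtain ⟨k, rfl⟩ := Nat.exists_eq_add_of_le' hn
    rw [det_path hC, prod_exp_odd _ (by omega)]
    exact pathDet_of_double_last _ h _ _ (by rw [hw, if_pos rfl]) fun j hj => by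
      rw [hw, if_neg (by omega)]

theorem hasProfile_B {n : ℕ} (hn : 2 ≤ n) :
    HasProfile (B n).cartan (B n).exponents (B n).coxeterNumber :=
  hasProfile_odd hn (pathEntry_B n) fun k => by split_ifs <;> first | rfl | omega

theorem hasProfile_C {n : ℕ} (hn : 2 ≤ n) :
    HasProfile (C n).cartan (C n).exponents (C n).coxeterNumber :=
  hasProfile_odd hn (pathEntry_C n) fun k => by split_ifs <;> first | rfl | omega

theorem orderOf_odd {n : ℕ} (hn : 1 ≤ n) {C : Matrix (Fin n) (Fin n) ℤ}
    (h : IsExponents C ((Multiset.range n).map fun j => 2 * j + 1) (2 * n)) :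
    orderOf (coxeterTransformation C) = 2 * n := by
  refine orderOf_coxeterTransformation h ((Multiset.nodup_range n).map fun a b h => ?_)
    (fun m hm => ?_) (Multiset.mem_map.2 ⟨0, Multiset.mem_range.2 hn, rfl⟩)
  · omega
  · obtain ⟨j, hj, rfl⟩ := Multiset.mem_map.1 hm
    rw [Multiset.mem_range] at hj
    omega

end FiniteType

/-! ### Exponents of the affine types. -/

namespace AffineType

theorem pathCartan_apply {n : ℕ} (w : ℕ → ℕ → ℤ) (i j : Fin (n + 1)) :
    pathCartan n w i j = pathEntry w i j := by
  simp [pathCartan, pathEntry, Fin.ext_iff]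

theorem forkCartan_apply {n : ℕ} (w : ℕ → ℕ → ℤ) (i j : Fin (n + 1)) :
    forkCartan n w i j = forkEntry w i j := by
  simp [forkCartan, forkEntry, Fin.ext_iff]

theorem hasProfile_A11 : HasProfile A11.cartan A11.exponents A11.coxeterNumber where
  pos := by decide
  le := by decide
  duality := by decide
  card := by decide
  diag := by decide
  det p s _ := by
    refine (det_path (pathCartan_apply (n := 1) (fun _ _ => 2)) p s).trans ?_
    simp [pathDet, exponents, coxeterNumber, Complex.exp_two_pi_mul_I]
    ring

theorem hasProfile_A22 : HasProfile A22.cartan A22.exponents A22.coxeterNumber where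
  pos := by decide
  le := by decide
  duality := by decide
  card := by decide
  diag := by decide
  det p s _ := by
    refine (det_path (pathCartan_apply (n := 1) (fun i _ => if i = 0 then 4 else 1)) p s).trans ?_
    simp [pathDet, exponents, coxeterNumber, Complex.exp_two_pi_mul_I]
    ring

theorem prod_exp_six (q : ℂ) :
    (({0, 2, 3, 4, 6} : Multiset ℕ).map fun m : ℕ =>
      q - Complex.exp (2 * Real.pi * Complex.I * m / (6 : ℕ))).prod =
      (q - 1) * (q ^ 3 - 1) * (q + 1) := by
  have hη := Complex.isPrimitiveRoot_exp 6 (by norm_num)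
  have h1 := primitive_root_six hη
  have h6 := hη.pow_eq_one
  simp only [exp_div_eq_pow, Multiset.insert_eq_cons, Multiset.map_cons,
    Multiset.map_singleton, Multiset.prod_cons, Multiset.prod_singleton]
  generalize Complex.exp (2 * Real.pi * Complex.I / (6 : ℕ)) = η at *
  have h3 : η ^ 3 = -1 := by linear_combination (η + 1) * h1
  have h4 : η ^ 4 = -η := by linear_combination η * h3
  rw [h1, h3, h4, h6]
  linear_combination -(q - 1) ^ 2 * (q + 1) * h1

theorem prod_exp_two (q : ℂ) :
    (({0, 1, 2} : Multiset ℕ).map fun m : ℕ =>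
      q - Complex.exp (2 * Real.pi * Complex.I * m / (2 : ℕ))).prod =
      (q - 1) ^ 2 * (q + 1) := by
  have h1 := exp_two_pi_half 1 2 rfl two_pos
  simp only [Multiset.insert_eq_cons, Multiset.map_cons,
    Multiset.map_singleton, Multiset.prod_cons, Multiset.prod_singleton]
  rw [h1]
  simp [Complex.exp_two_pi_mul_I]
  ring

theorem hasProfile_E62 : HasProfile E62.cartan E62.exponents E62.coxeterNumber where
  pos := by decide
  le := by decide
  duality := by decide
  card := by decide
  diag := by decide
  det p s _ := by
    refine (det_path (pathCartan_apply (n := 4) (fun i j => if i = 2 ∧ j = 3 then 2 else 1)) p s).trans ?_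
    refine Eq.trans ?_ (prod_exp_six (p * s)).symm
    norm_num [pathDet]
    ring

theorem hasProfile_F41 : HasProfile F41.cartan F41.exponents F41.coxeterNumber where
  pos := by decide
  le := by decide
  duality := by decide
  card := by decide
  diag := by decide
  det p s _ := by
    refine (det_path (pathCartan_apply (n := 4) (fun i j => if i = 3 ∧ j = 2 then 2 else 1)) p s).trans ?_
    refine Eq.trans ?_ (prod_exp_six (p * s)).symm
    norm_num [pathDet]
    ring

theorem hasProfile_D43 : HasProfile D43.cartan D43.exponents D43.coxeterNumber where
  pos := by decide
  le := by decide
  duality := by decide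
  card := by decide
  diag := by decide
  det p s _ := by
    refine (det_path (pathCartan_apply (n := 2) (fun i j => if i = 1 ∧ j = 2 then 3 else 1)) p s).trans ?_
    refine Eq.trans ?_ (prod_exp_two (p * s)).symm
    norm_num [pathDet]
    ring

theorem hasProfile_G21 : HasProfile G21.cartan G21.exponents G21.coxeterNumber where
  pos := by decide
  le := by decide
  duality := by decide
  card := by decide
  diag := by decide
  det p s _ := by
    refine (det_path (pathCartan_apply (n := 2) (fun i j => if i = 2 ∧ j = 1 then 3 else 1)) p s).trans ?_
    refine Eq.trans ?_ (prod_exp_two (p * s)).symm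
    norm_num [pathDet]
    ring

/-- Common to `A2even`, `D2` and `C1`: a double bond at each end, in whatever direction. For n = 2
the two bonds are still distinct. -/
theorem hasProfile_path {n : ℕ} (hn : 2 ≤ n) (w : ℕ → ℕ → ℤ)
    (hw : ∀ k, k < n → w k (k + 1) * w (k + 1) k = if k = 0 ∨ k + 1 = n then 2 else 1) :
    HasProfile (pathCartan n w) (Multiset.range (n + 1)) n where
  pos := by omega
  le m hm := by rw [Multiset.mem_range] at hm; omega
  duality := dual_range_succ n
  card := by simp
  diag i := by simp [pathCartan]
  det p s _ := by
    obtain ⟨k, rfl⟩ := Nat.exists_eq_add_of_le' hn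
    rw [det_path (pathCartan_apply w), prod_exp_range_succ _ (by omega)]
    exact pathDet_of_double_both _ _ _ (by rw [hw 0 (by omega), if_pos (by omega)])
      (by rw [hw (k + 1) (by omega), if_pos (by omega)])
      fun j hj hj' => by rw [hw j (by omega), if_neg (by omega)]

theorem hasProfile_A2even {n : ℕ} (hn : 2 ≤ n) :
    HasProfile (A2even n).cartan (A2even n).exponents (A2even n).coxeterNumber :=
  hasProfile_path hn (fun i j => if (i = 0 ∧ j = 1) ∨ (i + 1 = n ∧ j = n) then 2 else 1) fun k hk => by split_ifs <;> first | rfl | omega | grind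

theorem hasProfile_D2 {n : ℕ} (hn : 2 ≤ n) :
    HasProfile (D2 n).cartan (D2 n).exponents (D2 n).coxeterNumber :=
  hasProfile_path hn (fun i j => if (i = 0 ∧ j = 1) ∨ (i = n ∧ j + 1 = n) then 2 else 1) fun k hk => by split_ifs <;> first | rfl | omega | grind

theorem hasProfile_C1 {n : ℕ} (hn : 2 ≤ n) :
    HasProfile (C1 n).cartan (C1 n).exponents (C1 n).coxeterNumber :=
  hasProfile_path hn (fun i j => if (i = 1 ∧ j = 0) ∨ (i + 1 = n ∧ j = n) then 2 else 1) fun k hk => by split_ifs <;> first | rfl | omega | grind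

theorem hasProfile_fork {n : ℕ} (hn : 3 ≤ n) (w : ℕ → ℕ → ℤ)
    (h1 : w 0 2 = 1) (h2 : w 2 0 = 1)
    (h : ∀ k, 1 ≤ k → k + 1 < n → w k (k + 1) = 1 ∧ w (k + 1) k = 1)
    (hl : w (n - 1) n * w n (n - 1) = 2) :
    HasProfile (forkCartan n w) (exponentsB n) (coxeterNumberB n) where
  pos := by
    rw [coxeterNumberB]
    split_ifs <;> omega
  le := exponentsB_le n (by omega)
  duality := exponentsB_dual n (by omega)
  card := card_exponentsB n
  diag i := by simp [forkCartan]
  det p s _ := by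
    obtain ⟨k, rfl⟩ := Nat.exists_eq_add_of_le' hn
    rw [prod_exp_exponentsB _ (by omega)]
    exact det_fork (forkCartan_apply w) h1 h2 (fun j hj hj' => h j hj (by omega)) hl p s

theorem hasProfile_A2odd {n : ℕ} (hn : 3 ≤ n) :
    HasProfile (A2odd n).cartan (A2odd n).exponents (A2odd n).coxeterNumber :=
  hasProfile_fork hn (fun i j => if i + 1 = n ∧ j = n then 2 else 1) (by rw [if_neg (by omega)]) (by rw [if_neg (by omega)])
    (fun k _ _ => by rw [if_neg (by omega), if_neg (by omega)]; exact ⟨rfl, rfl⟩)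
    (by rw [if_pos (by omega), if_neg (by omega)]; rfl)

theorem hasProfile_B1 {n : ℕ} (hn : 3 ≤ n) :
    HasProfile (B1 n).cartan (B1 n).exponents (B1 n).coxeterNumber :=
  hasProfile_fork hn (fun i j => if i = n ∧ j + 1 = n then 2 else 1) (by rw [if_neg (by omega)]) (by rw [if_neg (by omega)])
    (fun k _ _ => by rw [if_neg (by omega), if_neg (by omega)]; exact ⟨rfl, rfl⟩)
    (by rw [if_neg (by omega), if_pos (by omega)]; rfl)

end AffineType

/-! ### From a system with prescribed matrices to the full correspondence. -/

theorem isDynkin_of_relabel {I : Type} [Fintype I] [DecidableEq I] {r : ℕ}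
    {C : Matrix (Fin r) (Fin r) ℤ} (hdiag : ∀ i, C i i = 2) {A : Matrix (Fin r) (Fin r) ℕ}
    (hA : ∀ i j, (A i j : ℤ) = if i = j then 0 else -C i j) {R : Matrix I I ℕ} (e : I ≃ Fin r)
    (he : ∀ i j, R i j = A (e i) (e j)) : IsDynkin R C e := by
  ext i j
  rw [Matrix.sub_apply, Matrix.map_apply, he, hA, Matrix.submatrix_apply, Matrix.ofNat_apply]
  by_cases h : i = j
  · subst h
    simp [hdiag]
  · simp [h]

/-- The permutation `σ` absorbs the cases in which the finite diagram is numbered from the opposite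
end. -/
theorem IsDynkin.removeVertex {I : Type} [Fintype I] [DecidableEq I] {r : ℕ} {R : Matrix I I ℕ}
    {C : Matrix (Fin (r + 1)) (Fin (r + 1)) ℤ} {e : I ≃ Fin (r + 1)} (h : IsDynkin R C e) {o : I}
    (ho : e o = 0) {C₀ : Matrix (Fin r) (Fin r) ℤ} (σ : Fin r ≃ Fin r)
    (hσ : ∀ i j : Fin r, C i.succ j.succ = C₀ (σ i) (σ j)) :
    ∃ e₀ : {i // i ≠ o} ≃ Fin r, IsDynkin (removeVertex R o) C₀ e₀ := by
  have hsub : ∀ i, i ≠ o ↔ e i ≠ 0 := fun i => by rw [← ho, Ne, Ne, e.apply_eq_iff_eq]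
  obtain ⟨e₁, hsucc⟩ : ∃ e₁ : {i // i ≠ o} ≃ Fin r, ∀ i, (e₁ i).succ = e i.1 := by
    refine ⟨(e.subtypeEquiv hsub).trans (finSuccAboveEquiv 0).symm, fun i => ?_⟩
    have := congr_arg Subtype.val ((finSuccAboveEquiv 0).apply_symm_apply (e.subtypeEquiv hsub i))
    rw [finSuccAboveEquiv_apply] at this
    exact this
  refine ⟨e₁.trans σ, ?_⟩
  ext i j
  have h1 := congr_fun (congr_fun h i.1) j.1
  have h2 : C (e i.1) (e j.1) = C₀ (σ (e₁ i)) (σ (e₁ j)) := by rw [← hσ, hsucc, hsucc]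
  rw [Matrix.submatrix_apply, Equiv.trans_apply, Equiv.trans_apply, ← h2]
  rw [Matrix.sub_apply, Matrix.submatrix_apply, Matrix.ofNat_apply] at h1
  rw [Matrix.sub_apply, Matrix.ofNat_apply, ← h1]
  simp [McKaySlodowy.removeVertex, Subtype.ext_iff]

namespace McKaySystem

variable {G : Type} [Group G] [Finite G] {N : Subgroup G} [Fintype N] [N.Normal] {W : Type}
  [AddCommGroup W] [Module ℂ W] [FiniteDimensional ℂ W] {V : Representation ℂ G W} {r : ℕ}
  (S : McKaySystem N V r)
  {C D : Matrix (Fin (r + 1)) (Fin (r + 1)) ℤ} {C₀ D₀ : Matrix (Fin r) (Fin r) ℤ}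
  {Δ Δ' Δ₀ Δ₀' : Multiset ℕ} {h h' h₀ h₀' : ℕ}

include S

theorem isDynkin_restriction (hC : HasProfile C Δ h)
    (hA : ∀ i j, (S.A i j : ℤ) = if i = j then 0 else -C i j) (σ : Fin r ≃ Fin r)
    (hσ : ∀ i j : Fin r, C i.succ j.succ = C₀ (σ i) (σ j))
    (I : Type) [Fintype I] [DecidableEq I] (R : RestrictionGraph N V I) :
    (∃ e : I ≃ Fin (r + 1), e R.zero = 0 ∧ IsDynkin R.adj C e) ∧
      ∃ e₀ : {i // i ≠ R.zero} ≃ Fin r, IsDynkin (removeVertex R.adj R.zero) C₀ e₀ := by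
  obtain ⟨e, he0, he, -⟩ := S.restrictionGraph_unique R
  have hd := isDynkin_of_relabel hC.diag hA e he
  exact ⟨⟨e, he0, hd⟩, hd.removeVertex he0 σ hσ⟩

theorem isDynkin_induction {E : Fin (r + 1) → ℕ} {B : Matrix (Fin (r + 1)) (Fin (r + 1)) ℕ}
    (hS : S.IsInductionData E B) (hD : HasProfile D Δ h)
    (hB : ∀ i j, (B i j : ℤ) = if i = j then 0 else -D i j) (σ : Fin r ≃ Fin r)
    (hσ : ∀ i j : Fin r, D i.succ j.succ = D₀ (σ i) (σ j))
    (J : Type) [Fintype J] [DecidableEq J] (R : InductionGraph N V J) :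
    (∃ e : J ≃ Fin (r + 1), e R.zero = 0 ∧ IsDynkin R.adj D e) ∧
      ∃ e₀ : {i // i ≠ R.zero} ≃ Fin r, IsDynkin (removeVertex R.adj R.zero) D₀ e₀ := by
  obtain ⟨e, he0, he⟩ := S.inductionGraph_unique hS R
  have hd := isDynkin_of_relabel hD.diag hB e he
  exact ⟨⟨e, he0, hd⟩, hd.removeVertex he0 σ hσ⟩

/-- The representation graphs and Poincaré series of a system whose matrices come from given
Cartan matrices. -/
theorem correspondence {E : Fin (r + 1) → ℕ} {B : Matrix (Fin (r + 1)) (Fin (r + 1)) ℕ}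
    (hS : S.IsInductionData E B)
    (hC : HasProfile C Δ h) (hC₀ : HasProfile C₀ Δ₀ h₀)
    (hD : HasProfile D Δ' h') (hD₀ : HasProfile D₀ Δ₀' h₀')
    (hA : ∀ i j, (S.A i j : ℤ) = if i = j then 0 else -C i j)
    (hB : ∀ i j, (B i j : ℤ) = if i = j then 0 else -D i j)
    (σ : Fin r ≃ Fin r) (hσ : ∀ i j : Fin r, C i.succ j.succ = C₀ (σ i) (σ j))
    (hτ : ∀ i j : Fin r, D i.succ j.succ = D₀ i j)
    (hcos : cosProduct Δ h = cosProduct Δ' h') (hcos₀ : cosProduct Δ₀ h₀ = cosProduct Δ₀' h₀') :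
    (Nonempty (RestrictionGraph N V (Fin (r + 1))) ∧
      Nonempty (InductionGraph N V (Fin (r + 1)))) ∧
    (∀ (I : Type) [Fintype I] [DecidableEq I] (R : RestrictionGraph N V I),
      (∃ e : I ≃ Fin (r + 1), e R.zero = 0 ∧ IsDynkin R.adj C e) ∧
      (∃ e₀ : {i // i ≠ R.zero} ≃ Fin r, IsDynkin (removeVertex R.adj R.zero) C₀ e₀)) ∧
    (∀ (J : Type) [Fintype J] [DecidableEq J] (S : InductionGraph N V J),
      (∃ e : J ≃ Fin (r + 1), e S.zero = 0 ∧ IsDynkin S.adj D e) ∧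
      (∃ e₀ : {i // i ≠ S.zero} ≃ Fin r, IsDynkin (removeVertex S.adj S.zero) D₀ e₀)) ∧
    ∀ (I J : Type) [Fintype I] [DecidableEq I] [Fintype J] [DecidableEq J]
      (R : RestrictionGraph N V I) (S : InductionGraph N V J)
      (Υ : Finset G), IsConjRepresentatives Υ →
      (detSeries (removeVertex R.adj R.zero) = cosProduct Δ₀ h₀ ∧
        detSeries R.adj = characterProduct N V Υ ∧ detSeries R.adj = cosProduct Δ h) ∧
      (detSeries (removeVertex S.adj S.zero) = cosProduct Δ₀' h₀' ∧
        detSeries S.adj = characterProduct N V Υ ∧ detSeries S.adj = cosProduct Δ' h') ∧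
      R.series R.zero = invariantSeries (res N V) ∧
      R.series R.zero = S.series S.zero ∧
      R.series R.zero = detSeries (removeVertex R.adj R.zero) * (detSeries R.adj)⁻¹ ∧
      R.series R.zero = detSeries (removeVertex R.adj R.zero) * (characterProduct N V Υ)⁻¹ ∧
      R.series R.zero = cosProduct Δ₀ h₀ * (cosProduct Δ h)⁻¹ ∧
      S.series S.zero = detSeries (removeVertex S.adj S.zero) * (detSeries S.adj)⁻¹ ∧
      S.series S.zero = detSeries (removeVertex S.adj S.zero) * (characterProduct N V Υ)⁻¹ ∧
      S.series S.zero = cosProduct Δ₀' h₀' * (cosProduct Δ' h')⁻¹ := by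
  refine ⟨⟨⟨S.restrictionGraph⟩, ⟨S.inductionGraph hS⟩⟩, S.isDynkin_restriction hC hA σ hσ,
    S.isDynkin_induction hS hD hB (Equiv.refl _) hτ, ?_⟩
  intro I J _ _ _ _ R T Υ hΥ
  obtain ⟨⟨e, -, he⟩, e₀, he₀⟩ := S.isDynkin_restriction hC hA σ hσ I R
  obtain ⟨⟨f, -, hf⟩, f₀, hf₀⟩ := S.isDynkin_induction hS hD hB (Equiv.refl _) hτ J T
  obtain ⟨a, -, ha, -⟩ := S.restrictionGraph_unique R
  have h1 := hC.detSeries_eq_cosProduct he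
  have h2 := hC₀.detSeries_eq_cosProduct he₀
  have h3 := hD.detSeries_eq_cosProduct hf
  have h4 := hD₀.detSeries_eq_cosProduct hf₀
  have h5 : detSeries R.adj = characterProduct N V Υ := by
    rw [S.characterProduct_eq Υ hΥ, detSeries_submatrix a _ _ ha]
  -- The induction side needs no eigenvalue computation or recursion of its own: the two cosine
  -- products agree, so both the determinant and the series formula are carried over from
  -- restriction.
  have h6 : detSeries T.adj = characterProduct N V Υ := by rw [h3, ← hcos, ← h1, h5]
  have h7 := S.series_eq R
  have h8 := series_zero_eq_series_zero R T
  have h9 : T.series T.zero = detSeries (removeVertex T.adj T.zero) * (detSeries T.adj)⁻¹ := by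
    rw [← h8, h7, h4, h3, h2, h1, hcos, hcos₀]
  refine ⟨⟨h2, h5, h1⟩, ⟨h4, h6, h3⟩, series_zero_eq_invariantSeries R, h8, h7, ?_, ?_, h9, ?_, ?_⟩
  · rw [← h5, h7]
  · rw [← h1, ← h2, h7]
  · rw [← h6, h9]
  · rw [← h3, ← h4, h9]

end McKaySystem

open Representation

/-! ### Realizing differences of characters by modules. -/

section Realization

variable {G : Type} [Group G] [Finite G] {N : Subgroup G}

omit [Finite G] in
theorem subsingleton_of_homDim_self {M : Type} [AddCommGroup M] [Module ℂ M]
    [FiniteDimensional ℂ M] (ρ : Representation ℂ G M) (h : homDim ρ ρ = 0) : Subsingleton M := by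
  by_contra hM
  rw [not_subsingleton_iff_nontrivial] at hM
  have : 0 < homDim ρ ρ := (homDim_pos_iff _ _).2 ⟨IntertwiningMap.id ρ, fun h0 => by
    obtain ⟨x, hx⟩ := exists_ne (0 : M)
    exact hx (by
      have := congr_arg (fun f : IntertwiningMap ρ ρ => f x) h0
      simpa using this)⟩
  omega

omit [Finite G] in
theorem char_res_add {M M' M'' : Type} [AddCommGroup M] [Module ℂ M] [AddCommGroup M']
    [Module ℂ M'] [AddCommGroup M''] [Module ℂ M''] [FiniteDimensional ℂ M'] [FiniteDimensional ℂ M'']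
    {ρ : Representation ℂ G M} {σ : Representation ℂ G M'} {τ : Representation ℂ G M''}
    (e : ρ.Equiv (σ.prod τ)) :
    (res N ρ).character = (res N σ).character + (res N τ).character := by
  ext n
  exact congr_fun ((char_iso e).trans (char_prod σ τ)) (n : G)

/-- A `G`-module whose restriction to `N` has norm one is irreducible. -/
theorem exists_irreducible_of_norm_one {d : ℕ} (P : Representation ℂ G (Fin d → ℂ))
    (hP : homDim (res N P) (res N P) = 1) :
    ∃ (k : ℕ) (ρ : Representation ℂ G (Fin k → ℂ)), ρ.IsIrreducible ∧
      (res N ρ).character = (res N P).character := by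
  have hnt : Nontrivial (Fin d → ℂ) := by
    by_contra hM
    rw [not_nontrivial_iff_subsingleton] at hM
    have h0 : homDim (res N P) (res N P) = 0 := by
      rw [homDim, Module.finrank_eq_zero_iff_of_free]
      refine ⟨fun f g => ?_⟩
      ext x
      exact congr_fun (Subsingleton.elim (_ : Fin d → ℂ) _) _
    omega
  obtain ⟨k, ρ, j, hρ, hj⟩ := exists_irreducible_injective P
  obtain ⟨k', ρ', ⟨e⟩⟩ := exists_complement j hj
  have hchar := char_res_add (N := N) e
  have h1 := homDim_of_char_add (res N P) hchar
  have h2 := homDim_of_char_add (res N ρ) hchar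
  have h3 := homDim_of_char_add (res N ρ') hchar
  have h4 : homDim (res N ρ) (res N ρ) ≠ 0 := fun h => by
    have := subsingleton_of_homDim_self _ h
    have := nontrivial_of_irreducible hρ
    exact not_subsingleton (Fin k → ℂ) ‹_›
  rw [homDim_comm (res N P) (res N ρ), homDim_comm (res N P) (res N ρ')] at h1
  -- The norm 1 is the sum of the norms of both summands and twice their pairing, and the first norm
  -- is already positive.
  have h5 : homDim (res N ρ') (res N ρ') = 0 := by omega
  have := subsingleton_of_homDim_self _ h5
  refine ⟨k, ρ, hρ, ?_⟩
  rw [hchar, left_eq_add]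
  ext n
  rw [character, Subsingleton.elim ((res N ρ') n) 0, map_zero]
  rfl

/-- Irreducible G-submodules are peeled off `U` until one shares an N-constituent with `P`. Over the
abelian quotient its restriction is that of `P`, and the other pieces are collected in `τ`. -/
theorem exists_sub_irreducible [N.Normal] (hN : ∀ g h : G, g * h * g⁻¹ * h⁻¹ ∈ N) {k : ℕ}
    {P : Representation ℂ G (Fin k → ℂ)} (hP : P.IsIrreducible) {d : ℕ}
    (U : Representation ℂ G (Fin d → ℂ)) (h : 0 < homDim (res N P) (res N U)) :
    ∃ (m : ℕ) (τ : Representation ℂ G (Fin m → ℂ)),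
      (res N U).character = (res N P).character + (res N τ).character := by
  induction d using Nat.strong_induction_on with
  | _ d ih =>
    have hnt : Nontrivial (Fin d → ℂ) := by
      by_contra hM
      rw [not_nontrivial_iff_subsingleton] at hM
      obtain ⟨f, hf⟩ := (homDim_pos_iff _ _).1 h
      exact hf (by ext x; exact congr_fun (Subsingleton.elim (_ : Fin d → ℂ) _) _)
    obtain ⟨q, Q, j, hQ, hj⟩ := exists_irreducible_injective U
    obtain ⟨m, τ, ⟨e⟩⟩ := exists_complement j hj
    have hchar := char_res_add (N := N) e
    by_cases hpos : 0 < homDim (res N P) (res N Q)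
    · obtain ⟨e'⟩ := res_equiv_of_homDim_pos N hN hP hQ hpos
      exact ⟨m, τ, by rw [hchar, char_iso e']⟩
    · have h1 := homDim_of_char_add (res N P) hchar
      have hlt : m < d := by
        have h2 := LinearEquiv.finrank_eq e.toLinearEquiv
        have := nontrivial_of_irreducible hQ
        have h3 : 0 < Module.finrank ℂ (Fin q → ℂ) := Module.finrank_pos
        simp only [Module.finrank_prod, Module.finrank_fin_fun] at h2 h3
        omega
      obtain ⟨l, τ', hτ'⟩ := ih m hlt τ (by omega)
      obtain ⟨l', σ, ⟨f⟩⟩ := exists_fin_model (Q.prod τ')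
      refine ⟨l', σ, ?_⟩
      rw [hchar, hτ', char_res_add (N := N) f.symm]
      exact add_left_comm _ _ _

/-- Removal of a constituent from a `G`-module, on the level of characters on `N`. -/
theorem exists_sub [N.Normal] [Fintype N] (hN : ∀ g h : G, g * h * g⁻¹ * h⁻¹ ∈ N) {k d : ℕ}
    (P : Representation ℂ G (Fin k → ℂ)) (U : Representation ℂ G (Fin d → ℂ))
    (hPr : ∀ n : N, P.character (n : G)⁻¹ = P.character n)
    (hP : ∑ n : N, P.character n * P.character n = Nat.card N) {c : ℕ} (hc : 0 < c)
    (hU : ∑ n : N, U.character n * P.character n = Nat.card N * c) :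
    ∃ (m : ℕ) (τ : Representation ℂ G (Fin m → ℂ)), ∀ n : N,
      τ.character n = U.character n - P.character n := by
  have h1 := card_mul_homDim (res N P) (res N P) hPr
  have h2 : homDim (res N P) (res N P) = 1 := by
    have h3 : (Nat.card N : ℂ) * homDim (res N P) (res N P) = Nat.card N * 1 := by
      rw [h1, mul_one, ← hP]
      rfl
    exact_mod_cast mul_left_cancel₀ (natCard_cast_ne_zero N) h3
  obtain ⟨l, ρ, hρ, hchar⟩ := exists_irreducible_of_norm_one P h2
  have h4 : homDim (res N ρ) (res N U) = c := by
    rw [homDim_comm, homDim_congr _ hchar]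
    have h5 := card_mul_homDim (res N U) (res N P) hPr
    have h6 : (Nat.card N : ℂ) * homDim (res N U) (res N P) = Nat.card N * c := by
      rw [h5, ← hU]
      rfl
    exact_mod_cast mul_left_cancel₀ (natCard_cast_ne_zero N) h6
  obtain ⟨m, τ, hτ⟩ := exists_sub_irreducible hN hρ U (by omega)
  refine ⟨m, τ, fun n => ?_⟩
  have h7 := congr_fun hτ n
  rw [hchar] at h7
  exact eq_sub_of_add_eq' h7.symm

end Realization

/-- The one-dimensional representation given by a multiplicative character. -/
def scalarRep {G : Type} [Group G] (χ : G →* ℂ) : Representation ℂ G (Fin 1 → ℂ) where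
  toFun g := χ g • 1
  map_one' := by simp
  map_mul' g h := by rw [map_mul, smul_mul_smul_comm, one_mul]

theorem char_scalarRep {G : Type} [Group G] (χ : G →* ℂ) (g : G) :
    (scalarRep χ).character g = χ g := by
  simp [character, scalarRep]

theorem char_mul_of_dim_one {G : Type} [Group G] (U : Representation ℂ G (Fin 1 → ℂ)) (g h : G) :
    U.character (g * h) = U.character g * U.character h := by
  have key : ∀ f : (Fin 1 → ℂ) →ₗ[ℂ] (Fin 1 → ℂ), f = LinearMap.trace ℂ _ f • LinearMap.id := by
    intro f
    refine LinearMap.pi_ext' fun i => LinearMap.ext_ring ?_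
    ext j
    rw [LinearMap.trace_eq_matrix_trace ℂ (Pi.basisFun ℂ (Fin 1)), Matrix.trace_fin_one,
      LinearMap.toMatrix_apply, Subsingleton.elim i 0, Subsingleton.elim j 0]
    simp
  rw [character, map_mul, key (U g), key (U h)]
  simp [character, Module.End.mul_eq_comp, mul_comm]

/-! ### Matrix entries and traces in SU₂. -/

section SU2

/-- For determinant 1 the conjugate transpose and the adjugate are both the inverse. Hence the first
row determines the element. -/
theorem SU2.entries (x : SU2) : x.1 1 0 = -star (x.1 0 1) ∧ x.1 1 1 = star (x.1 0 0) ∧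
    x.1 0 0 * star (x.1 0 0) + x.1 0 1 * star (x.1 0 1) = 1 := by
  obtain ⟨h1, h2⟩ := Matrix.mem_specialUnitaryGroup_iff.1 x.2
  have h3 := Matrix.mem_unitaryGroup_iff.1 h1
  have h4 : star x.1 = x.1.adjugate := by
    have := congr_arg (fun m => x.1.adjugate * m) h3
    simp only [← Matrix.mul_assoc, Matrix.adjugate_mul, h2, one_smul, Matrix.one_mul,
      Matrix.mul_one] at this
    exact this
  have h5 := congr_fun (congr_fun h4 0) 0
  have h6 := congr_fun (congr_fun h4 1) 0
  have h7 := congr_fun (congr_fun h3 0) 0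
  simp [Matrix.adjugate_fin_two, Matrix.star_apply, Matrix.mul_apply] at h5 h6 h7 ⊢
  refine ⟨by rw [h6, neg_neg], h5.symm, h7⟩

theorem SU2.ext' {x y : SU2} (h0 : x.1 0 0 = y.1 0 0) (h1 : x.1 0 1 = y.1 0 1) : x = y := by
  obtain ⟨hx1, hx2, -⟩ := SU2.entries x
  obtain ⟨hy1, hy2, -⟩ := SU2.entries y
  apply Subtype.ext
  ext i j
  fin_cases i <;> fin_cases j
  · exact h0
  · exact h1
  · change x.1 1 0 = y.1 1 0
    rw [hx1, hy1, h1]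
  · change x.1 1 1 = y.1 1 1
    rw [hx2, hy2, h0]

theorem SU2.mul_zero_zero (x y : SU2) :
    (x * y).1 0 0 = x.1 0 0 * y.1 0 0 - x.1 0 1 * star (y.1 0 1) := by
  obtain ⟨hy1, -, -⟩ := SU2.entries y
  rw [Submonoid.coe_mul, Matrix.mul_apply, Fin.sum_univ_two, hy1]
  ring

theorem SU2.mul_zero_one (x y : SU2) :
    (x * y).1 0 1 = x.1 0 0 * y.1 0 1 + x.1 0 1 * star (y.1 0 0) := by
  obtain ⟨-, hy2, -⟩ := SU2.entries y
  rw [Submonoid.coe_mul, Matrix.mul_apply, Fin.sum_univ_two, hy2]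

theorem SU2.inv_entries (x : SU2) : (x⁻¹).1 0 0 = star (x.1 0 0) ∧ (x⁻¹).1 0 1 = -x.1 0 1 := by
  obtain ⟨hx1, -, -⟩ := SU2.entries x
  have h : (x⁻¹).1 = star x.1 := rfl
  rw [h, Matrix.star_apply, Matrix.star_apply, hx1]
  simp

/-- The trace of an element of `SU₂`. -/
def SU2.tr (x : SU2) : ℂ := x.1 0 0 + star (x.1 0 0)

theorem char_natRep (G : Subgroup SU2) (g : G) : (natRep G).character g = SU2.tr g := by
  rw [character, natRep]
  change LinearMap.trace ℂ _ (Matrix.toLin' (g : SU2).1) = _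
  rw [Matrix.trace_toLin'_eq, Matrix.trace_fin_two, (SU2.entries _).2.1, SU2.tr]

theorem SU2.tr_inv (x : SU2) : SU2.tr x⁻¹ = SU2.tr x := by
  rw [SU2.tr, SU2.tr, (SU2.inv_entries x).1, star_star, add_comm]

end SU2

section Generators

variable {H : Type} [Group H]

/-- If generators of `G` normalize `N` and commute modulo `N`, then `N` is normal in `G` with
abelian quotient. -/
theorem normal_and_comm_of_closure {s : Set H} {N : Subgroup H}
    (hs : ∀ x ∈ s, ∀ n ∈ N, x * n * x⁻¹ ∈ N ∧ x⁻¹ * n * x ∈ N)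
    (hc : ∀ x ∈ s, ∀ y ∈ s, x * y * x⁻¹ * y⁻¹ ∈ N) :
    (∀ g ∈ Subgroup.closure s, ∀ n ∈ N, g * n * g⁻¹ ∈ N) ∧
      ∀ g ∈ Subgroup.closure s, ∀ h ∈ Subgroup.closure s, g * h * g⁻¹ * h⁻¹ ∈ N := by
  have hnorm : ∀ g ∈ Subgroup.closure s, ∀ n ∈ N, g * n * g⁻¹ ∈ N ∧ g⁻¹ * n * g ∈ N := by
    intro g hg
    induction hg using Subgroup.closure_induction with
    | mem x hx => exact hs x hx
    | one => simp
    | mul x y _ _ hx hy =>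
      intro n hn
      constructor
      · have := (hx _ (hy n hn).1).1
        simpa [mul_assoc] using this
      · have := (hy _ (hx n hn).2).2
        simpa [mul_assoc] using this
    | inv x _ hx =>
      intro n hn
      rw [inv_inv]
      exact ⟨(hx n hn).2, (hx n hn).1⟩
  have hswap : ∀ {g h : H}, g * h * g⁻¹ * h⁻¹ ∈ N → h * g * h⁻¹ * g⁻¹ ∈ N := by
    intro g h hgh
    have := N.inv_mem hgh
    simpa [mul_assoc] using this
  have hleft : ∀ h : H, (∀ x ∈ s, x * h * x⁻¹ * h⁻¹ ∈ N) → ∀ g ∈ Subgroup.closure s,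
      g * h * g⁻¹ * h⁻¹ ∈ N := by
    intro h hh g hg
    induction hg using Subgroup.closure_induction with
    | mem x hx => exact hh x hx
    | one => simp
    | mul x y hx _ ihx ihy =>
      -- The identity [xy, h] = x [y, h] x⁻¹ · [x, h].
      have := N.mul_mem (hnorm x hx _ ihy).1 ihx
      convert this using 1
      group
    | inv x hx ihx =>
      have := (hnorm x hx _ (N.inv_mem ihx)).2
      convert this using 1
      group
  exact ⟨fun g hg n hn => (hnorm g hg n hn).1, fun g hg h hh => hleft h (fun x hx =>
    hswap (hleft x (fun y hy => hc y hy x hx) h hh)) g hg⟩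

theorem conj_mem_closure {s : Set H} {N : Subgroup H} {x : H}
    (hx : ∀ y ∈ s, x * y * x⁻¹ ∈ N) {n : H} (hn : n ∈ Subgroup.closure s) :
    x * n * x⁻¹ ∈ N := by
  have : Subgroup.closure s ≤ N.comap (MulAut.conj x).toMonoidHom :=
    (Subgroup.closure_le _).2 fun y hy => hx y hy
  exact this hn

end Generators

/-! ### Systems for pairs of subgroups of SU₂, given by functions on SU₂. -/

open Representation

/-- A pair `N ⊲ G` of subgroups of `SU₂` with abelian quotient, and a parametrization `p` of `N`. -/
structure NormalPair (G N : Subgroup SU2) (ι : Type) where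
  p : ι → SU2
  inj : Function.Injective p
  mem : ∀ x, x ∈ N ↔ ∃ a, p a = x
  le : N ≤ G
  normal : ∀ g ∈ G, ∀ n ∈ N, g * n * g⁻¹ ∈ N
  comm : ∀ g ∈ G, ∀ h ∈ G, g * h * g⁻¹ * h⁻¹ ∈ N

namespace NormalPair

variable {G N : Subgroup SU2} {ι : Type} (P : NormalPair G N ι)

/-- The parametrization of `N` as a subgroup of `G`. -/
def param (a : ι) : N.subgroupOf G := ⟨⟨P.p a, P.le ((P.mem _).2 ⟨a, rfl⟩)⟩, (P.mem _).2 ⟨a, rfl⟩⟩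

theorem exists_param (n : N.subgroupOf G) : ∃ a, P.param a = n := by
  obtain ⟨a, ha⟩ := (P.mem (n : G)).1 n.2
  exact ⟨a, Subtype.ext (Subtype.ext ha)⟩

theorem bijective_param : Function.Bijective P.param :=
  ⟨fun _ _ h => P.inj (congr_arg (fun n : N.subgroupOf G => ((n : G) : SU2)) h), P.exists_param⟩

include P in
theorem card_subgroupOf [Fintype ι] : Nat.card (N.subgroupOf G) = Fintype.card ι := by
  rw [← Nat.card_eq_fintype_card]
  exact (Nat.card_eq_of_bijective _ P.bijective_param).symm

theorem sum_subgroupOf [Fintype ι] [Fintype (N.subgroupOf G)] (φ : SU2 → ℂ) :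
    ∑ n : N.subgroupOf G, φ (n : G) = ∑ a, φ (P.p a) :=
  (P.bijective_param.sum_comp fun n : N.subgroupOf G => φ (n : G)).symm

include P in
theorem subgroupOf_normal : (N.subgroupOf G).Normal :=
  ⟨fun n hn g => P.normal g g.2 n hn⟩

end NormalPair

/-- A McKay system for a pair of subgroups of `SU₂`, given by functions on `SU₂`. -/
structure PairData (G N : Subgroup SU2) (r : ℕ) (ι : Type) [Fintype ι] extends
    NormalPair G N ι where
  F : Fin (r + 1) → SU2 → ℂ
  ν : Fin (r + 1) → ℕ
  E : Fin (r + 1) → ℕ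
  rep : Fin (r + 1) → SU2
  A : Matrix (Fin (r + 1)) (Fin (r + 1)) ℕ
  rep_mem : ∀ i, rep i ∈ N
  F_inv : ∀ i a, F i (p a)⁻¹ = F i (p a)
  conj_rep : ∀ a, ∃ i, ∃ g ∈ G, p a = g * rep i * g⁻¹
  ν_pos : ∀ i, 0 < ν i
  orth : ∀ i j, ∑ a, F i (p a) * F j (p a) = if i = j then (Fintype.card ι : ℂ) * ν i else 0
  F_zero : ∀ a, F 0 (p a) = 1
  fusion : ∀ j a, SU2.tr (p a) * F j (p a) = ∑ i, A i j * F i (p a)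
  real : ∀ i, ∃ (d : ℕ) (U : Representation ℂ G (Fin d → ℂ)),
    ∀ n : G, (n : SU2) ∈ N → U.character n = F i n
  -- Below 4 arithmetic alone excludes proper fractions of `F i`. At norm 4 half of `F i` would be a
  -- linear character, excluded by its value -1 on a commutator.
  alternative : ∀ i, (ν i ≤ 3 ∧ E i = 1) ∨ (ν i = 4 ∧ E i = 2 ∧ F i 1 = 2 ∧
    ∃ g ∈ G, ∃ h ∈ G, F i (g * h * g⁻¹ * h⁻¹) = -2)

namespace PairData

variable {G N : Subgroup SU2} {r : ℕ} {ι : Type} [Fintype ι] (P : PairData G N r ι)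

/-- The system of restricted characters. -/
def system [Fintype (N.subgroupOf G)] : McKaySystem (N.subgroupOf G) (natRep G) r where
  f i n := P.F i (n : G)
  ν := P.ν
  rep i := ⟨⟨P.rep i, P.le (P.rep_mem i)⟩, P.rep_mem i⟩
  A := P.A
  comm g h := P.comm g g.2 h h.2
  f_inv i n := by
    obtain ⟨a, rfl⟩ := P.exists_param n
    exact P.F_inv i a
  V_inv g := by
    rw [char_natRep, char_natRep]
    exact SU2.tr_inv g
  conj_rep n := by
    obtain ⟨a, rfl⟩ := P.exists_param n
    obtain ⟨i, g, hg, h⟩ := P.conj_rep a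
    exact ⟨i, ⟨g, hg⟩, Subtype.ext h⟩
  ν_pos := P.ν_pos
  orth i j := by
    rw [P.sum_subgroupOf fun x => P.F i x * P.F j x, P.orth, P.card_subgroupOf]
  f_zero n := by
    obtain ⟨a, rfl⟩ := P.exists_param n
    exact P.F_zero a
  fusion j n := by
    obtain ⟨a, rfl⟩ := P.exists_param n
    rw [char_natRep]
    exact P.fusion j a
  real i := by
    obtain ⟨d, U, hU⟩ := P.real i
    exact ⟨d, U, fun n => hU n n.2⟩
  rigid i m d U h0 hle hdvd hval := by
    rcases P.alternative i with ⟨h3, -⟩ | ⟨h4, -, h1, g, hg, h, hh, hgh⟩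
    · have := P.ν_pos i
      generalize P.ν i = ν at *
      interval_cases ν <;> interval_cases m <;> simp_all
    · rw [h4] at hle hdvd hval ⊢
      by_contra hm
      -- Among 1, 2, 3 only 2 has its square divisible by 4.
      have hm2 : m = 2 := by
        have h5 : m ≤ 3 := by omega
        interval_cases m <;> simp_all
      subst hm2
      have hone := hval 1
      have hd : d = 1 := by
        have h6 : P.F i (((1 : N.subgroupOf G) : G) : SU2) = 2 := h1
        rw [h6, OneMemClass.coe_one, char_one, Module.finrank_fin_fun] at hone
        have : (4 * d : ℂ) = 4 := by
          push_cast at hone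
          linear_combination hone
        have h7 : 4 * d = 4 := by exact_mod_cast this
        omega
      subst hd
      set g' : G := ⟨g, hg⟩
      set h' : G := ⟨h, hh⟩
      -- A one-dimensional module is trivial on commutators, whereas `hval` demands half of -2.
      have h8 : U.character (g' * h' * g'⁻¹ * h'⁻¹) = 1 := by
        have h9 : ∀ x : G, U.character x * U.character x⁻¹ = 1 := fun x => by
          rw [← char_mul_of_dim_one, mul_inv_cancel, char_one]
          simp
        rw [char_mul_of_dim_one, char_mul_of_dim_one, char_mul_of_dim_one]
        linear_combination U.character h' * U.character h'⁻¹ * h9 g' + h9 h'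
      have h10 := hval ⟨g' * h' * g'⁻¹ * h'⁻¹, P.comm g hg h hh⟩
      have h11 : P.F i (((⟨g' * h' * g'⁻¹ * h'⁻¹, P.comm g hg h hh⟩ : N.subgroupOf G) : G) : SU2) =
        -2 := hgh
      rw [h11] at h10
      change ((4 : ℕ) : ℂ) * U.character (g' * h' * g'⁻¹ * h'⁻¹) = _ at h10
      rw [h8] at h10
      norm_num at h10

theorem isInductionData [Fintype (N.subgroupOf G)]
    {B : Matrix (Fin (r + 1)) (Fin (r + 1)) ℕ} (hB : ∀ j k, B k j * P.E k = P.A j k * P.E j) :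
    P.system.IsInductionData P.E B where
  mult i e d D hD he hle hd := by
    change e ^ 2 ≤ P.ν i at hle
    change P.ν i * d = e * D at hd
    change P.F i 1 = D at hD
    rcases P.alternative i with ⟨h3, h1⟩ | ⟨h4, h2, h1, -⟩
    · rw [h1]
      nlinarith
    · rw [h2]
      rw [h4] at hle hd
      have h5 : D = 2 := by
        rw [h1] at hD
        exact_mod_cast hD.symm
      have : e ≤ 2 := by nlinarith
      interval_cases e <;> omega
  matrix := hB

end PairData

/-! ### Adjacency matrices of paths and forks. -/

section Adjacency

/-- The adjacency matrix of the path `0 - 1 - ⋯ - n`. -/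
def pathAdj (n : ℕ) (w : ℕ → ℕ → ℕ) : Matrix (Fin (n + 1)) (Fin (n + 1)) ℕ :=
  fun i j => if i.val + 1 = j.val ∨ j.val + 1 = i.val then w i j else 0

/-- The adjacency matrix of the fork `0 - 2`, `1 - 2`, `2 - 3 - ⋯ - n`. -/
def forkAdj (n : ℕ) (w : ℕ → ℕ → ℕ) : Matrix (Fin (n + 1)) (Fin (n + 1)) ℕ :=
  fun i j => if forkBond i j ∨ forkBond j i then w i j else 0

theorem pathAdj_eq {n : ℕ} {w : ℕ → ℕ → ℕ} {w' : ℕ → ℕ → ℤ} (h : ∀ i j, (w i j : ℤ) = w' i j)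
    (i j : Fin (n + 1)) : (pathAdj n w i j : ℤ) = if i = j then 0 else -pathCartan n w' i j := by
  simp only [pathAdj, pathCartan, Fin.ext_iff]
  split_ifs <;> first | omega | simp [h]

theorem forkAdj_eq {n : ℕ} {w : ℕ → ℕ → ℕ} {w' : ℕ → ℕ → ℤ} (h : ∀ i j, (w i j : ℤ) = w' i j)
    (i j : Fin (n + 1)) : (forkAdj n w i j : ℤ) = if i = j then 0 else -forkCartan n w' i j := by
  simp only [forkAdj, forkCartan, forkBond, Fin.ext_iff]
  split_ifs <;> first | omega | simp [h]

/-- Reduces the relation between the two multiplication matrices to their bond labels: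
transposition, which reverses the arrows, followed by rescaling with `E`. -/
theorem pathAdj_swap {n : ℕ} {w v : ℕ → ℕ → ℕ} {E : ℕ → ℕ}
    (h : ∀ i j, i ≤ n → j ≤ n → i + 1 = j ∨ j + 1 = i → v j i * E j = w i j * E i)
    (i j : Fin (n + 1)) : pathAdj n v j i * E j = pathAdj n w i j * E i := by
  simp only [pathAdj]
  by_cases hij : i.val + 1 = j.val ∨ j.val + 1 = i.val
  · rw [if_pos hij, if_pos hij.symm, h i j (by omega) (by omega) hij]
  · rw [if_neg hij, if_neg fun h => hij h.symm, zero_mul, zero_mul]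

theorem forkAdj_swap {n : ℕ} {w v : ℕ → ℕ → ℕ} {E : ℕ → ℕ}
    (h : ∀ i j, i ≤ n → j ≤ n → forkBond i j ∨ forkBond j i → v j i * E j = w i j * E i)
    (i j : Fin (n + 1)) : forkAdj n v j i * E j = forkAdj n w i j * E i := by
  simp only [forkAdj]
  by_cases hij : forkBond i j ∨ forkBond j i
  · rw [if_pos hij, if_pos hij.symm, h i j (by omega) (by omega) hij]
  · rw [if_neg hij, if_neg fun h => hij h.symm, zero_mul, zero_mul]

theorem sum_path (n : ℕ) (w : ℕ → ℕ → ℕ) (g : ℕ → ℂ) (j : Fin (n + 1)) :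
    ∑ i, (pathAdj n w i j : ℂ) * g i =
      (if j.val = 0 then 0 else w (j - 1) j * g (j - 1)) +
        if j.val = n then 0 else w (j + 1) j * g (j + 1) := by
  have h1 : ∀ i : Fin (n + 1), (pathAdj n w i j : ℂ) * g i =
      (if i.val + 1 = j.val then (w (j - 1) j * g (j - 1) : ℂ) else 0) +
        if i.val = j.val + 1 then (w (j + 1) j * g (j + 1) : ℂ) else 0 := by
    intro i
    simp only [pathAdj]
    by_cases h2 : i.val + 1 = j.val
    · rw [if_pos (Or.inl h2), if_pos h2, if_neg (by omega), add_zero,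
        (by omega : j.val - 1 = i.val)]
    · by_cases h3 : i.val = j.val + 1
      · rw [if_pos (Or.inr h3.symm), if_neg h2, if_pos h3, zero_add, ← h3]
      · rw [if_neg (by omega), if_neg h2, if_neg h3]
        simp
  simp_rw [h1]
  rw [Finset.sum_add_distrib]
  congr 1
  · split_ifs with h
    · exact Finset.sum_eq_zero fun i _ => if_neg (by omega)
    · rw [Finset.sum_eq_single (⟨j.val - 1, by omega⟩ : Fin (n + 1)) (fun i _ hi => if_neg fun h2 =>
        hi (Fin.ext (by simp only; omega))) (by simp), if_pos (by simp only; omega)]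
  · split_ifs with h
    · exact Finset.sum_eq_zero fun i _ => if_neg (by omega)
    · rw [Finset.sum_eq_single (⟨j.val + 1, by omega⟩ : Fin (n + 1)) (fun i _ hi => if_neg fun h2 =>
        hi (Fin.ext (by simp only; omega))) (by simp), if_pos rfl]

theorem sum_fork (n : ℕ) (hn : 2 ≤ n) (w : ℕ → ℕ → ℕ) (g : ℕ → ℂ) (j : Fin (n + 1)) :
    ∑ i, (forkAdj n w i j : ℂ) * g i =
      if j.val = 0 then w 2 0 * g 2 else
      (if j.val = 1 then 0 else w (j - 1) j * g (j - 1)) +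
      (if j.val = n then 0 else w (j + 1) j * g (j + 1)) +
      if j.val = 2 then w 0 2 * g 0 else 0 := by
  have h1 : ∀ i : Fin (n + 1), (forkAdj n w i j : ℂ) * g i =
      (if i.val + 1 = j.val then (if 2 ≤ j.val then w (j - 1) j * g (j - 1) else 0 : ℂ) else 0) +
      (if i.val = j.val + 1 then (if 1 ≤ j.val then w (j + 1) j * g (j + 1) else 0 : ℂ) else 0) +
      (if i.val = 0 then (if j.val = 2 then w 0 2 * g 0 else 0 : ℂ) else 0) +
      (if i.val = 2 then (if j.val = 0 then w 2 0 * g 2 else 0 : ℂ) else 0) := by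
    intro i
    have key : ∀ a b : ℕ, ((if forkBond a b ∨ forkBond b a then w a b else 0 : ℕ) : ℂ) * g a =
      (if a + 1 = b then (if 2 ≤ b then w (b - 1) b * g (b - 1) else 0 : ℂ) else 0) +
      (if a = b + 1 then (if 1 ≤ b then w (b + 1) b * g (b + 1) else 0 : ℂ) else 0) +
      (if a = 0 then (if b = 2 then w 0 2 * g 0 else 0 : ℂ) else 0) +
      (if a = 2 then (if b = 0 then w 2 0 * g 2 else 0 : ℂ) else 0) := by
      intro a b
      by_cases h2 : a + 1 = b
      · subst h2
        rcases Nat.eq_zero_or_pos a with rfl | h3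
        · simp
        · rw [if_pos (Or.inl (Or.inr ⟨h3, rfl⟩)), if_pos rfl, if_pos (by omega), if_neg (by omega),
            if_neg (by omega), Nat.add_sub_cancel]
          simp
      · by_cases h3 : a = b + 1
        · subst h3
          rcases Nat.eq_zero_or_pos b with rfl | h3
          · simp
          · rw [if_pos (Or.inr (Or.inr ⟨h3, rfl⟩)), if_neg h2, if_pos rfl, if_pos (Nat.succ_le_of_lt h3)]
            have : b ≠ 0 := by omega
            simp [this]
        · rw [if_neg h2, if_neg h3]
          by_cases h4 : a = 0
          · subst h4
            by_cases h5 : b = 2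
            · subst h5
              simp
            · rw [if_neg (by simp only [forkBond]; omega)]
              simp [h5]
          · rw [if_neg h4]
            by_cases h5 : a = 2
            · subst h5
              by_cases h6 : b = 0
              · subst h6
                simp
              · rw [if_neg (by simp only [forkBond]; omega)]
                simp [h6]
            · rw [if_neg h5, if_neg (by simp only [forkBond]; omega)]
              simp
    exact key i j
  have hsel : ∀ (P : ℕ → Prop) [DecidablePred P] (c : ℂ) (k : ℕ), k < n + 1 → (∀ i, P i ↔ i = k) →
      ∑ i : Fin (n + 1), (if P i.val then c else 0) = c := by
    intro P _ c k hk hP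
    rw [Finset.sum_eq_single (⟨k, hk⟩ : Fin (n + 1)) (fun i _ hi => if_neg fun h =>
      hi (Fin.ext ((hP _).1 h))) (by simp), if_pos ((hP _).2 rfl)]
  simp_rw [h1, Finset.sum_add_distrib]
  rw [hsel (fun i => i = 0) _ 0 (by omega) (fun i => Iff.rfl),
    hsel (fun i => i = 2) _ 2 (by omega) (fun i => Iff.rfl)]
  have hj := j.2
  by_cases hj0 : j.val = 0
  · simp [hj0]
  have e1 : ∑ i : Fin (n + 1), (if i.val + 1 = j.val then
      (if 2 ≤ j.val then w (j - 1) j * g (j - 1) else 0 : ℂ) else 0) =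
        if j.val = 1 then 0 else w (j - 1) j * g (j - 1) := by
    rw [hsel (fun i => i + 1 = j.val) _ (j - 1) (by omega) (fun i => by omega)]
    split_ifs <;> first | rfl | omega
  have e2 : ∑ i : Fin (n + 1), (if i.val = j.val + 1 then
      (if 1 ≤ j.val then w (j + 1) j * g (j + 1) else 0 : ℂ) else 0) =
        if j.val = n then 0 else w (j + 1) j * g (j + 1) := by
    by_cases hjn : j.val = n
    · rw [if_pos hjn]
      exact Finset.sum_eq_zero fun i _ => if_neg (by omega)
    · rw [hsel (fun i => i = j.val + 1) _ (j + 1) (by omega) (fun i => Iff.rfl), if_neg hjn,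
        if_pos (by omega)]
  rw [e1, e2, if_neg hj0, if_neg hj0, add_zero]

end Adjacency

open Representation

/-! ### Cyclic and binary dihedral groups: normal forms. -/

section Elements

theorem θ_primitive (n : ℕ) (hn : 0 < n) : IsPrimitiveRoot (θ n) n :=
  Complex.isPrimitiveRoot_exp n hn.ne'

theorem θ_sq (n : ℕ) : θ (2 * n) ^ 2 = θ n := by
  rw [θ, θ, ← Complex.exp_nat_mul]
  congr 1
  push_cast
  rw [mul_div_assoc', mul_div_mul_left _ _ two_ne_zero]

theorem θ_pow_half (m : ℕ) (hm : 0 < m) : θ (2 * m) ^ m = -1 := by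
  have h1 := (θ_primitive (2 * m) (by omega)).pow (by omega) (show 2 * m = m * 2 by ring)
  exact h1.eq_neg_one_of_two_right

theorem elemX_pow_entries (n k : ℕ) :
    (elemX n ^ k).1 0 0 = (θ n)⁻¹ ^ k ∧ (elemX n ^ k).1 0 1 = 0 := by
  induction k with
  | zero => simp
  | succ k ih =>
    rw [pow_succ, SU2.mul_zero_zero, SU2.mul_zero_one, ih.1, ih.2]
    simp [elemX, su2, pow_succ]

theorem elemX_pow_eq_one (n : ℕ) (hn : 0 < n) : elemX n ^ n = 1 := by
  obtain ⟨h0, h1⟩ := elemX_pow_entries n n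
  refine SU2.ext' ?_ ?_
  · rw [h0, inv_pow, (θ_primitive n hn).pow_eq_one]
    simp
  · rw [h1]
    simp

theorem elemX_pow_inj {n : ℕ} (hn : 0 < n) {j k : ℕ} (hj : j < n) (hk : k < n)
    (h : elemX n ^ j = elemX n ^ k) : j = k := by
  have h1 := congr_arg (fun x : SU2 => x.1 0 0) h
  simp only [(elemX_pow_entries _ _).1] at h1
  exact (θ_primitive n hn).inv.pow_inj hj hk h1

theorem elemX_sq (n : ℕ) : elemX (2 * n) ^ 2 = elemX n := by
  obtain ⟨h0, h1⟩ := elemX_pow_entries (2 * n) 2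
  refine SU2.ext' ?_ ?_
  · rw [h0, inv_pow, θ_sq]
    rfl
  · rw [h1]
    rfl

theorem elemY_entries : elemY.1 0 0 = 0 ∧ elemY.1 0 1 = Complex.I := ⟨rfl, rfl⟩

theorem elemY_mul_elemX (n : ℕ) : elemY * elemX n = (elemX n)⁻¹ * elemY := by
  obtain ⟨h0, h1⟩ := SU2.inv_entries (elemX n)
  have h2 : (elemX n).1 0 0 = (θ n)⁻¹ := rfl
  have h3 : (elemX n).1 0 1 = 0 := rfl
  refine SU2.ext' ?_ ?_
  · rw [SU2.mul_zero_zero, SU2.mul_zero_zero, h0, h1, elemY_entries.1, elemY_entries.2, h3]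
    simp
  · rw [SU2.mul_zero_one, SU2.mul_zero_one, h0, h1, elemY_entries.1, elemY_entries.2, h3]
    simp [mul_comm]

theorem elemY_conj_elemX (n : ℕ) : elemY * elemX n * elemY⁻¹ = (elemX n)⁻¹ := by
  rw [elemY_mul_elemX, mul_inv_cancel_right]

theorem elemY_conj_zpow (n : ℕ) (k : ℤ) : elemY * elemX n ^ k * elemY⁻¹ = elemX n ^ (-k) := by
  rw [← conj_zpow, elemY_conj_elemX, inv_zpow']

theorem elemY_mul_zpow (n : ℕ) (k : ℤ) : elemY * elemX n ^ k = elemX n ^ (-k) * elemY := by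
  rw [← elemY_conj_zpow, inv_mul_cancel_right]

theorem elemY_sq (m : ℕ) (hm : 0 < m) : elemY * elemY = elemX (2 * m) ^ m := by
  obtain ⟨h0, h1⟩ := elemX_pow_entries (2 * m) m
  refine SU2.ext' ?_ ?_
  · rw [SU2.mul_zero_zero, elemY_entries.1, elemY_entries.2, h0, inv_pow, θ_pow_half m hm]
    simp
  · rw [SU2.mul_zero_one, elemY_entries.1, elemY_entries.2, h1]
    simp

theorem mem_cyclicGroup {n : ℕ} (hn : 0 < n) (x : SU2) :
    x ∈ cyclicGroup n ↔ ∃ j : Fin n, elemX n ^ (j : ℕ) = x := by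
  constructor
  · rintro ⟨k, rfl⟩
    have hn' : (n : ℤ) ≠ 0 := by omega
    refine ⟨⟨(k % n).toNat, by have := Int.emod_lt_of_pos k (by omega : (0 : ℤ) < n); omega⟩, ?_⟩
    rw [← zpow_natCast, Int.toNat_of_nonneg (Int.emod_nonneg _ hn')]
    conv_rhs => rw [← Int.emod_add_mul_ediv k n]
    simp only
    rw [zpow_add, zpow_mul, zpow_natCast, elemX_pow_eq_one n hn, one_zpow, mul_one]
  · rintro ⟨j, rfl⟩
    exact ⟨(j : ℕ), by simp⟩

theorem mem_binaryDihedral_iff_zpow {m : ℕ} (hm : 0 < m) (x : SU2) :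
    x ∈ binaryDihedral m ↔ ∃ k : ℤ, x = elemX (2 * m) ^ k ∨ x = elemX (2 * m) ^ k * elemY := by
  have hX : elemX (2 * m) ∈ binaryDihedral m := Subgroup.subset_closure (by simp)
  have hY : elemY ∈ binaryDihedral m := Subgroup.subset_closure (by simp)
  constructor
  · intro hx
    induction hx using Subgroup.closure_induction with
    | mem x hx =>
      rcases hx with rfl | rfl
      · exact ⟨1, Or.inl (by simp)⟩
      · exact ⟨0, Or.inr (by simp)⟩
    | one => exact ⟨0, Or.inl (by simp)⟩
    | mul x y _ _ hx hy =>
      obtain ⟨k, rfl | rfl⟩ := hx <;> obtain ⟨l, rfl | rfl⟩ := hy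
      · exact ⟨k + l, Or.inl (zpow_add _ _ _).symm⟩
      · exact ⟨k + l, Or.inr (by rw [zpow_add, mul_assoc])⟩
      · refine ⟨k - l, Or.inr ?_⟩
        rw [mul_assoc, elemY_mul_zpow, ← mul_assoc, ← zpow_add, sub_eq_add_neg]
      · refine ⟨k - l + m, Or.inl ?_⟩
        rw [← mul_assoc, mul_assoc _ elemY, elemY_mul_zpow, ← mul_assoc, mul_assoc, elemY_sq m hm,
          ← zpow_natCast, ← zpow_add, ← zpow_add]
        congr 1
    | inv x _ hx =>
      obtain ⟨k, rfl | rfl⟩ := hx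
      · exact ⟨-k, Or.inl (zpow_neg _ _).symm⟩
      · refine ⟨k + m, Or.inr ?_⟩
        rw [inv_eq_iff_mul_eq_one, ← mul_assoc, mul_assoc _ elemY, elemY_mul_zpow, ← mul_assoc,
          mul_assoc, elemY_sq m hm, ← zpow_natCast, ← zpow_add, ← zpow_add,
          (by ring : k + -(k + m) + m = (0 : ℤ)), zpow_zero]
  · rintro ⟨k, rfl | rfl⟩
    · exact zpow_mem hX k
    · exact mul_mem (zpow_mem hX k) hY

theorem mem_binaryDihedral {m : ℕ} (hm : 0 < m) (x : SU2) :
    x ∈ binaryDihedral m ↔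
      ∃ a : Fin (2 * m) × Fin 2, elemX (2 * m) ^ (a.1 : ℕ) * elemY ^ (a.2 : ℕ) = x := by
  have hc := fun x => mem_cyclicGroup (n := 2 * m) (by omega) x
  rw [mem_binaryDihedral_iff_zpow hm]
  constructor
  · rintro ⟨k, rfl | rfl⟩
    · obtain ⟨j, hj⟩ := (hc (elemX (2 * m) ^ k)).1 ⟨k, rfl⟩
      exact ⟨(j, 0), by simp [hj]⟩
    · obtain ⟨j, hj⟩ := (hc (elemX (2 * m) ^ k)).1 ⟨k, rfl⟩
      exact ⟨(j, 1), by simp [hj]⟩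
  · rintro ⟨⟨j, e⟩, rfl⟩
    refine ⟨(j : ℕ), ?_⟩
    fin_cases e
    · left
      simp
    · right
      simp

theorem elemX_mem_binaryDihedral (m : ℕ) : elemX (2 * m) ∈ binaryDihedral m :=
  Subgroup.subset_closure (by simp)

theorem elemY_mem_binaryDihedral (m : ℕ) : elemY ∈ binaryDihedral m :=
  Subgroup.subset_closure (by simp)

theorem finite_binaryDihedral {m : ℕ} (hm : 0 < m) : Finite (binaryDihedral m) := by
  refine Set.Finite.subset (Set.finite_range fun a : Fin (2 * m) × Fin 2 =>
    elemX (2 * m) ^ (a.1 : ℕ) * elemY ^ (a.2 : ℕ)) fun x hx => ?_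
  exact (mem_binaryDihedral hm x).1 hx

theorem dihedral_param_injective {m : ℕ} (hm : 0 < m) :
    Function.Injective fun a : Fin (2 * m) × Fin 2 =>
      elemX (2 * m) ^ (a.1 : ℕ) * elemY ^ (a.2 : ℕ) := by
  have h0 : ∀ j : ℕ, (elemX (2 * m) ^ j * elemY).1 0 0 = 0 := fun j => by
    rw [SU2.mul_zero_zero, (elemX_pow_entries _ _).2, elemY_entries.1]
    simp
  have h1 : ∀ j : ℕ, (elemX (2 * m) ^ j).1 0 0 ≠ 0 := fun j => by
    rw [(elemX_pow_entries _ _).1]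
    exact pow_ne_zero _ (inv_ne_zero (θ_ne_zero _))
  rintro ⟨j, e⟩ ⟨k, f⟩ h
  simp only at h
  have hjk : elemX (2 * m) ^ (j : ℕ) = elemX (2 * m) ^ (k : ℕ) → j = k := fun h =>
    Fin.ext (elemX_pow_inj (by omega) j.2 k.2 h)
  fin_cases e <;> fin_cases f <;> simp at h ⊢
  · exact hjk h
  · exact h1 j (by rw [h]; exact h0 k)
  · exact h1 k (by rw [← h]; exact h0 j)
  · exact hjk h

/-- Monomial elements of `SU₂`. -/
def SU2.IsMonomial (x : SU2) : Prop := x.1 0 0 = 0 ∨ x.1 0 1 = 0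

theorem isMonomial_of_mem {m : ℕ} (hm : 0 < m) {x : SU2} (hx : x ∈ binaryDihedral m) :
    x.IsMonomial := by
  obtain ⟨⟨j, e⟩, rfl⟩ := (mem_binaryDihedral hm x).1 hx
  fin_cases e
  · right
    simpa using (elemX_pow_entries (2 * m) j).2
  · left
    simp [SU2.mul_zero_zero, (elemX_pow_entries _ _).2, elemY_entries.1]

end Elements

/-! ### Modules of groups of monomial matrices. -/

section Monomial

variable {G : Subgroup SU2} (hG : ∀ x ∈ G, SU2.IsMonomial x)

-- When the left factor is monomial, every entry of the product is a single product of entries, so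
-- entrywise powers are multiplicative. The exponent 0 is excluded because 0⁰ = 1 destroys the zero
-- entries.
include hG in
theorem hadamard_mul {k : ℕ} (hk : k ≠ 0) (x y : G) :
    ((x * y : G) : SU2).1.map (· ^ k) =
      (x : SU2).1.map (· ^ k) * (y : SU2).1.map (· ^ k) := by
  obtain ⟨h1, h2, -⟩ := SU2.entries (x : SU2)
  ext i j
  rw [Matrix.mul_apply, Fin.sum_univ_two]
  simp only [Matrix.map_apply, Subgroup.coe_mul, Submonoid.coe_mul, Matrix.mul_apply,
    Fin.sum_univ_two]
  rcases hG x x.2 with h | h <;> fin_cases i <;> simp [h1, h2, h, hk, mul_pow]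
  rw [← mul_pow, neg_mul]

/-- The entrywise `k`-th power of the natural module of a group of monomial matrices. -/
def hadamardRep {k : ℕ} (hk : k ≠ 0) : Representation ℂ G (Fin 2 → ℂ) :=
  ((Matrix.toLinAlgEquiv' : Matrix (Fin 2) (Fin 2) ℂ ≃ₐ[ℂ] _) : _ →* _).comp
    { toFun := fun x : G => (x : SU2).1.map (· ^ k)
      map_one' := by
        ext i j
        fin_cases i <;> fin_cases j <;> simp [hk]
      map_mul' := hadamard_mul hG hk }

/-- The function `a ^ k + conj a ^ k`, where `a` is the upper left entry. -/
def mono (k : ℕ) (x : SU2) : ℂ := x.1 0 0 ^ k + star (x.1 0 0) ^ k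

theorem char_hadamardRep {k : ℕ} (hk : k ≠ 0) (g : G) :
    (hadamardRep hG hk).character g = mono k g := by
  rw [character, hadamardRep]
  change LinearMap.trace ℂ _ (Matrix.toLin' ((g : SU2).1.map (· ^ k))) = _
  rw [Matrix.trace_toLin'_eq, Matrix.trace_fin_two, mono, ← (SU2.entries _).2.1]
  rfl

/-- The character `|a|² - |b|²`. -/
def sgnFun (x : SU2) : ℂ := x.1 0 0 * star (x.1 0 0) - x.1 0 1 * star (x.1 0 1)

/-- The character `|a|² - |b|²` of a group of monomial matrices. -/
def sgnHom : G →* ℂ where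
  toFun x := sgnFun x
  map_one' := by simp [sgnFun]
  map_mul' x y := by
    simp only [sgnFun, Subgroup.coe_mul]
    rw [SU2.mul_zero_zero, SU2.mul_zero_one]
    rcases hG x x.2 with h | h <;> simp [h] <;> ring

/-- The character `aⁿ + bⁿ`. -/
def altFun (n : ℕ) (x : SU2) : ℂ := x.1 0 0 ^ n + x.1 0 1 ^ n

/-- The character `aⁿ + bⁿ` of a group of monomial matrices where `aⁿ` and `(ib)ⁿ` are real. -/
def altHom {n : ℕ} (hn : n ≠ 0) (h0 : ∀ x ∈ G, star (x.1 0 0) ^ n = x.1 0 0 ^ n)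
    (h1 : ∀ x ∈ G, (-star (x.1 0 1)) ^ n = x.1 0 1 ^ n) : G →* ℂ where
  toFun x := altFun n x
  map_one' := by simp [altFun, hn]
  map_mul' x y := by
    simp only [altFun, Subgroup.coe_mul]
    rw [SU2.mul_zero_zero, SU2.mul_zero_one, sub_eq_add_neg, ← mul_neg]
    rcases hG x x.2 with h | h <;>
      simp only [h, zero_mul, zero_add, add_zero, mul_pow, zero_pow hn, h0 y y.2, h1 y y.2] <;> ring

end Monomial

/-! ### Orthogonality on the cyclic subgroup. -/

section Orthogonality

theorem sum_zpow_θ (n : ℕ) (hn : 0 < n) (z : ℤ) :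
    ∑ j : Fin n, (θ n ^ z) ^ (j : ℕ) = if (n : ℤ) ∣ z then (n : ℂ) else 0 := by
  rw [Fin.sum_univ_eq_sum_range (fun j => (θ n ^ z) ^ j)]
  split_ifs with h
  · rw [((θ_primitive n hn).zpow_eq_one_iff_dvd z).2 h]
    simp
  · have h1 : θ n ^ z ≠ 1 := fun h1 => h (((θ_primitive n hn).zpow_eq_one_iff_dvd z).1 h1)
    apply mul_right_cancel₀ (sub_ne_zero.2 h1)
    rw [geom_sum_mul, zero_mul, ← zpow_natCast, ← zpow_mul, mul_comm, zpow_mul, zpow_natCast,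
      (θ_primitive n hn).pow_eq_one, one_zpow, sub_self]

theorem mono_elemX_pow (n k j : ℕ) :
    mono k (elemX n ^ j) = (θ n ^ (-k : ℤ)) ^ j + (θ n ^ (k : ℤ)) ^ j := by
  rw [mono, (elemX_pow_entries n j).1, star_pow, star_inv₀, star_θ, inv_inv, zpow_neg, zpow_natCast,
    ← pow_mul, ← pow_mul, inv_pow, inv_pow, ← pow_mul, mul_comm k]

/-- Four geometric sums with exponents ±(k + l) and ±(k - l). In the range 0..n the former survive
modulo 2n only for k = l at the two ends, where the norm is therefore doubled. -/
theorem sum_mono_mul_mono {n : ℕ} (hn : 0 < n) {k l : ℕ} (hk : k ≤ n) (hl : l ≤ n) :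
    ∑ j : Fin (2 * n), mono k (elemX (2 * n) ^ (j : ℕ)) * mono l (elemX (2 * n) ^ (j : ℕ)) =
      if k = l then (if k = 0 ∨ k = n then (8 * n : ℂ) else 4 * n) else 0 := by
  have h0 := θ_ne_zero (2 * n)
  have h1 : ∀ j : Fin (2 * n), mono k (elemX (2 * n) ^ (j : ℕ)) * mono l (elemX (2 * n) ^ (j : ℕ)) =
      (θ (2 * n) ^ (-k - l : ℤ)) ^ (j : ℕ) + (θ (2 * n) ^ (k + l : ℤ)) ^ (j : ℕ) +
        (θ (2 * n) ^ (k - l : ℤ)) ^ (j : ℕ) + (θ (2 * n) ^ (l - k : ℤ)) ^ (j : ℕ) := by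
    intro j
    rw [mono_elemX_pow, mono_elemX_pow, sub_eq_add_neg, sub_eq_add_neg, sub_eq_add_neg,
      zpow_add₀ h0, zpow_add₀ h0, zpow_add₀ h0, zpow_add₀ h0]
    simp only [mul_pow]
    ring
  simp_rw [h1, Finset.sum_add_distrib]
  rw [sum_zpow_θ _ (by omega), sum_zpow_θ _ (by omega), sum_zpow_θ _ (by omega),
    sum_zpow_θ _ (by omega)]
  have hd : ∀ z : ℤ, -(2 * n : ℕ) < z → z < (2 * n : ℕ) → (((2 * n : ℕ) : ℤ) ∣ z ↔ z = 0) := by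
    intro z hz1 hz2
    constructor
    · intro h
      exact Int.eq_zero_of_abs_lt_dvd h (abs_lt.2 ⟨hz1, hz2⟩)
    · rintro rfl
      exact dvd_zero _
  have e1 : ((2 * n : ℕ) : ℤ) ∣ (k + l : ℤ) ↔ k = l ∧ (k = 0 ∨ k = n) := by
    by_cases h : k = n ∧ l = n
    · obtain ⟨rfl, rfl⟩ := h
      simp [two_mul]
    · rw [hd _ (by omega) (by omega)]
      omega
  have e2 : ((2 * n : ℕ) : ℤ) ∣ (-k - l : ℤ) ↔ k = l ∧ (k = 0 ∨ k = n) := by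
    rw [← e1, ← dvd_neg]
    ring_nf
  have e3 : ((2 * n : ℕ) : ℤ) ∣ (k - l : ℤ) ↔ k = l := by
    rw [hd _ (by omega) (by omega)]
    omega
  have e4 : ((2 * n : ℕ) : ℤ) ∣ (l - k : ℤ) ↔ k = l := by
    rw [hd _ (by omega) (by omega)]
    omega
  simp only [e1, e2, e3, e4]
  by_cases hkl : k = l
  · by_cases h : k = 0 ∨ k = n
    · rw [if_pos hkl, if_pos h, if_pos ⟨hkl, h⟩, if_pos hkl]
      push_cast
      ring
    · rw [if_pos hkl, if_neg h, if_neg (fun h' => h h'.2), if_pos hkl]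
      push_cast
      ring
  · rw [if_neg hkl, if_neg (fun h' => hkl h'.1), if_neg hkl]
    ring

end Orthogonality

open Representation

/-! ### Systems of the cyclic subgroups. -/

section Cyclic

theorem elemX_conj_comm (m : ℕ) :
    elemX m * elemY * (elemX m)⁻¹ * elemY⁻¹ = elemX m ^ 2 ∧
      elemY * elemX m * elemY⁻¹ * (elemX m)⁻¹ = (elemX m ^ 2)⁻¹ := by
  have h := elemY_conj_zpow m (-1)
  rw [neg_neg, zpow_one, zpow_neg_one] at h
  constructor
  · rw [mul_assoc (elemX m), mul_assoc (elemX m), h, sq]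
  · rw [elemY_conj_elemX, sq, mul_inv_rev]

theorem cyclic_normal_comm {n m i : ℕ} (hi : elemX (2 * n) = elemX (2 * m) ^ i)
    (h2 : elemX (2 * m) ^ 2 ∈ cyclicGroup (2 * n)) :
    (∀ g ∈ binaryDihedral m, ∀ x ∈ cyclicGroup (2 * n), g * x * g⁻¹ ∈ cyclicGroup (2 * n)) ∧
      ∀ g ∈ binaryDihedral m, ∀ h ∈ binaryDihedral m,
        g * h * g⁻¹ * h⁻¹ ∈ cyclicGroup (2 * n) := by
  refine normal_and_comm_of_closure ?_ ?_
  · rintro x (rfl | rfl) _ ⟨k, rfl⟩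
    · have hc : Commute (elemX (2 * m)) (elemX (2 * n) ^ k) := by
        rw [hi]
        exact ((Commute.refl _).pow_right i).zpow_right k
      simp only
      rw [hc.eq, mul_inv_cancel_right, mul_assoc, ← hc.eq, inv_mul_cancel_left]
      exact ⟨⟨k, rfl⟩, ⟨k, rfl⟩⟩
    · refine ⟨⟨-k, (elemY_conj_zpow _ k).symm⟩, ⟨-k, ?_⟩⟩
      simp only
      rw [eq_comm, mul_assoc, inv_mul_eq_iff_eq_mul, elemY_mul_zpow, neg_neg]
  · obtain ⟨h3, h4⟩ := elemX_conj_comm (2 * m)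
    rintro x (rfl | rfl) y (rfl | rfl)
    · simp
    · rwa [h3]
    · rw [h4]
      exact inv_mem h2
    · simp

/-- The Chebyshev recursion, from |a| = 1; it produces the path. -/
theorem tr_mul_mono_of_diagonal {x : SU2} (hx : x.1 0 1 = 0) (k : ℕ) :
    SU2.tr x * mono (k + 1) x = mono (k + 2) x + mono k x := by
  obtain ⟨-, -, h⟩ := SU2.entries x
  rw [hx, zero_mul, add_zero] at h
  simp only [SU2.tr, mono]
  linear_combination (x.1 0 0 ^ k + star (x.1 0 0) ^ k) * h

/-- On 2n-th roots of unity n + 1 is congruent to -(n - 1); this folds the end of the path back and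
creates the last multiple bond. -/
theorem mono_reflect {n : ℕ} (hn : 0 < n) (j : ℕ) :
    mono (n + 1) (elemX (2 * n) ^ j) = mono (n - 1) (elemX (2 * n) ^ j) := by
  have h0 := θ_ne_zero (2 * n)
  have h1 : θ (2 * n) ^ ((n + 1 : ℕ) : ℤ) = θ (2 * n) ^ (-(n - 1 : ℕ) : ℤ) := by
    have h2 : ((n + 1 : ℕ) : ℤ) = -(n - 1 : ℕ) + (2 * n : ℕ) := by omega
    rw [h2, zpow_add₀ h0, zpow_natCast _ (2 * n), (θ_primitive (2 * n) (by omega)).pow_eq_one,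
      mul_one]
  rw [mono_elemX_pow, mono_elemX_pow, zpow_neg, h1, zpow_neg, inv_inv, add_comm]

theorem mono_inv (k : ℕ) (x : SU2) : mono k x⁻¹ = mono k x := by
  simp only [mono]
  rw [(SU2.inv_entries x).1, star_star, add_comm]

theorem mono_zero (x : SU2) : mono 0 x = 2 := by norm_num [mono]

/-- The McKay system of a cyclic subgroup of a binary dihedral group: the characters are multiples
of `x ↦ aᵏ + conj aᵏ`. -/
def cyclicData {n m i : ℕ} (hn : 0 < n) (hi : elemX (2 * n) = elemX (2 * m) ^ i)
    (h2 : elemX (2 * m) ^ 2 ∈ cyclicGroup (2 * n)) (c : ℕ → ℂ) (ν E : ℕ → ℕ) (w : ℕ → ℕ → ℕ)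
    (hc0 : c 0 = 1 / 2) (hν_pos : ∀ k, 0 < ν k)
    -- The factors 4 and 2 are the mean squares of `mono k` over the cyclic group.
    (hν : ∀ k ≤ n, (ν k : ℂ) = c k ^ 2 * if k = 0 ∨ k = n then 4 else 2)
    (hw1 : ∀ j < n, w (j + 1) j * c (j + 1) = c j * if j = 0 then 2 else 1)
    (hw2 : ∀ j < n, w j (j + 1) * c j = c (j + 1) * if j + 1 = n then 2 else 1)
    (hreal : ∀ k ≤ n, ∃ (d : ℕ) (U : Representation ℂ (binaryDihedral m) (Fin d → ℂ)),
      ∀ n' : binaryDihedral m, (n' : SU2) ∈ cyclicGroup (2 * n) →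
        U.character n' = c k * mono k n')
    (halt : ∀ k ≤ n, (ν k ≤ 3 ∧ E k = 1) ∨ (ν k = 4 ∧ E k = 2 ∧ c k * mono k 1 = 2 ∧
      ∃ g ∈ binaryDihedral m, ∃ h ∈ binaryDihedral m, c k * mono k (g * h * g⁻¹ * h⁻¹) = -2)) :
    PairData (binaryDihedral m) (cyclicGroup (2 * n)) n (Fin (2 * n)) where
  p j := elemX (2 * n) ^ (j : ℕ)
  inj j k h := Fin.ext (elemX_pow_inj (by omega) j.2 k.2 h)
  mem := mem_cyclicGroup (by omega)
  F k x := c k * mono k x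
  ν k := ν k
  E k := E k
  rep k := elemX (2 * n) ^ (k : ℕ)
  A := pathAdj n w
  le := Subgroup.zpowers_le.2 (hi ▸ pow_mem (elemX_mem_binaryDihedral m) i)
  normal := (cyclic_normal_comm hi h2).1
  comm := (cyclic_normal_comm hi h2).2
  rep_mem k := ⟨(k : ℕ), by simp⟩
  F_inv k j := by rw [mono_inv]
  conj_rep j := by
    by_cases hj : (j : ℕ) ≤ n
    · exact ⟨⟨j, by omega⟩, 1, one_mem _, by simp⟩
    -- Conjugation by y inverts the cyclic group, so exponents above n are reflected into 0..n.
    · refine ⟨⟨2 * n - j, by omega⟩, elemY, elemY_mem_binaryDihedral m, ?_⟩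
      simp only
      have h1 := elemX_pow_eq_one (2 * n) (by omega)
      rw [← zpow_natCast _ (2 * n - (j : ℕ)), elemY_conj_zpow, zpow_neg, eq_inv_iff_mul_eq_one,
        zpow_natCast, ← pow_add, (by omega : (j : ℕ) + (2 * n - j) = 2 * n), h1]
  ν_pos k := hν_pos k
  orth k l := by
    have h1 : ∀ j : Fin (2 * n), c k * mono k (elemX (2 * n) ^ (j : ℕ)) *
        (c l * mono l (elemX (2 * n) ^ (j : ℕ))) = c k * c l *
          (mono k (elemX (2 * n) ^ (j : ℕ)) * mono l (elemX (2 * n) ^ (j : ℕ))) := fun j => by ring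
    simp_rw [h1]
    rw [← Finset.mul_sum, sum_mono_mul_mono hn (by omega) (by omega), Fintype.card_fin]
    by_cases hkl : k = l
    · subst hkl
      rw [if_pos rfl, if_pos rfl, hν k (by omega)]
      push_cast
      split_ifs <;> ring
    · rw [if_neg (fun h => hkl (Fin.ext h)), if_neg hkl, mul_zero]
  F_zero j := by
    simp [hc0, mono_zero]
  fusion j a := by
    have hx := (elemX_pow_entries (2 * n) a).2
    have href := mono_reflect hn a
    rw [sum_path n w (fun k => c k * mono k (elemX (2 * n) ^ (a : ℕ)))]
    generalize elemX (2 * n) ^ (a : ℕ) = x at *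
    obtain ⟨j, hj⟩ := j
    simp only
    rcases Nat.eq_zero_or_pos j with rfl | hj0
    · have h1 := hw1 0 hn
      have h2 : mono (0 + 1) x = SU2.tr x := by simp [mono, SU2.tr]
      rw [if_pos rfl] at h1
      rw [if_pos rfl, if_neg hn.ne, zero_add, mono_zero, h2]
      linear_combination -(SU2.tr x) * h1
    · obtain ⟨k, rfl⟩ := Nat.exists_eq_succ_of_ne_zero hj0.ne'
      have hm := tr_mul_mono_of_diagonal hx k
      have h1 := hw2 k (by omega)
      rw [Nat.succ_eq_add_one, if_neg (by omega), Nat.add_sub_cancel]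
      by_cases hjn : k + 1 = n
      · rw [if_pos hjn] at h1 ⊢
        rw [← hjn, Nat.add_sub_cancel] at href
        rw [href] at hm
        linear_combination c (k + 1) * hm - mono k x * h1
      · have h2 := hw1 (k + 1) (by omega)
        rw [if_neg (by omega)] at h2
        rw [if_neg hjn] at h1 ⊢
        linear_combination c (k + 1) * hm - mono k x * h1 - mono (k + 2) x * h2
  real k := hreal k (by omega)
  alternative k := halt k (by omega)

theorem exists_trivial (G : Subgroup SU2) (N : Subgroup SU2) {c : ℂ} (hc : c = 1 / 2) :
    ∃ (d : ℕ) (U : Representation ℂ G (Fin d → ℂ)), ∀ x : G, (x : SU2) ∈ N →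
      U.character x = c * mono 0 x :=
  ⟨1, scalarRep 1, fun x _ => by rw [char_scalarRep, mono_zero, hc]; norm_num⟩

theorem exists_hadamard {m : ℕ} (hm : 0 < m) (N : Subgroup SU2) {k : ℕ} (hk : k ≠ 0) {c : ℂ}
    (hc : c = 1) : ∃ (d : ℕ) (U : Representation ℂ (binaryDihedral m) (Fin d → ℂ)),
      ∀ x : binaryDihedral m, (x : SU2) ∈ N → U.character x = c * mono k x :=
  ⟨2, hadamardRep (fun _ => isMonomial_of_mem hm) hk, fun x _ => by
    rw [char_hadamardRep, hc, one_mul]⟩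

/-- The n-th power of a 2n-th root of unity is ±1, hence equal to its inverse. These are the
conditions under which aⁿ + bⁿ is a linear character. -/
theorem dihedral_pow_real {n : ℕ} (hn : 0 < n) {x : SU2} (hx : x ∈ binaryDihedral n) :
    star (x.1 0 0) ^ n = x.1 0 0 ^ n ∧ (-star (x.1 0 1)) ^ n = x.1 0 1 ^ n := by
  have key : ∀ j : ℕ, (θ (2 * n) ^ j) ^ n = ((θ (2 * n))⁻¹ ^ j) ^ n := by
    intro j
    rw [← pow_mul, ← pow_mul, mul_comm j, pow_mul, pow_mul, inv_pow, θ_pow_half n hn]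
    norm_num
  have hn' := hn.ne'
  obtain ⟨⟨j, e⟩, rfl⟩ := (mem_binaryDihedral hn x).1 hx
  obtain ⟨h0, h1⟩ := elemX_pow_entries (2 * n) j
  fin_cases e
  · simp only [pow_zero, mul_one]
    rw [h0, h1, star_pow, star_inv₀, star_θ, inv_inv, key]
    simp [hn']
  · simp only [pow_one]
    rw [SU2.mul_zero_zero, SU2.mul_zero_one, h0, h1, elemY_entries.1, elemY_entries.2]
    constructor
    · simp [hn']
    · rw [zero_mul, add_zero, star_mul', star_pow, star_inv₀, star_θ, inv_inv, mul_pow, ← key,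
        ← mul_pow]
      simp

theorem exists_alt {n : ℕ} (hn : 0 < n) {c : ℂ} (hc : c = 1 / 2) :
    ∃ (d : ℕ) (U : Representation ℂ (binaryDihedral n) (Fin d → ℂ)),
      ∀ x : binaryDihedral n, (x : SU2) ∈ cyclicGroup (2 * n) → U.character x = c * mono n x := by
  refine ⟨1, scalarRep (altHom (fun _ => isMonomial_of_mem hn) hn.ne'
    (fun x hx => (dihedral_pow_real hn hx).1) fun x hx => (dihedral_pow_real hn hx).2), ?_⟩
  intro x hx
  obtain ⟨j, hj⟩ := (mem_cyclicGroup (by omega) _).1 hx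
  have h1 : (x : SU2).1 0 1 = 0 := by
    rw [← hj]
    exact (elemX_pow_entries _ _).2
  rw [char_scalarRep]
  change altFun n x = _
  rw [altFun, mono, h1, (dihedral_pow_real hn x.2).1, zero_pow hn.ne', hc]
  ring

/-- The system of `C₂ₙ ⊲ Dₙ`. -/
def dihedralCyclicData {n : ℕ} (hn : 2 ≤ n) :
    PairData (binaryDihedral n) (cyclicGroup (2 * n)) n (Fin (2 * n)) :=
  cyclicData (i := 1) (by omega) (pow_one _).symm ⟨2, rfl⟩
    -- At both ends `mono k` is twice a linear character that extends to the whole dihedral group,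
    -- so it is halved there.
    (fun k => if k = 0 ∨ k = n then 1 / 2 else 1) (fun k => if k = 0 ∨ k = n then 1 else 2)
    (fun _ => 1) (fun i j => if (i = 0 ∧ j = 1) ∨ (i = n ∧ j + 1 = n) then 2 else 1)
    (by simp) (fun k => by split_ifs <;> norm_num)
    (fun k _ => by split_ifs <;> norm_num)
    (fun j hj => by split_ifs <;> first | omega | (norm_num; done) | grind)
    (fun j hj => by split_ifs <;> first | omega | (norm_num; done) | grind)
    (fun k hk => by
      rcases Nat.eq_zero_or_pos k with rfl | hk0
      · exact exists_trivial _ _ (by simp)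
      · by_cases hkn : k = n
        · subst hkn
          exact exists_alt (by omega) (by simp)
        · exact exists_hadamard (by omega) _ hk0.ne' (by rw [if_neg (by omega)]))
    fun k hk => Or.inl ⟨by split_ifs <;> norm_num, rfl⟩

/-- The system of `C₂ₙ ⊲ D₂ₙ`. -/
def dihedralCyclicFourData {n : ℕ} (hn : 0 < n) (w : ℕ → ℕ → ℕ)
    (hw1 : ∀ j < n, w (j + 1) j = 1)
    (hw2 : ∀ j < n, w j (j + 1) = (if j = 0 then 2 else 1) * if j + 1 = n then 2 else 1) :
    PairData (binaryDihedral (2 * n)) (cyclicGroup (2 * n)) n (Fin (2 * n)) :=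
  cyclicData (i := 2) hn (elemX_sq _).symm
    (by rw [elemX_sq]; exact ⟨1, by simp⟩)
    -- At k = n the sign character does not extend to the larger group: a two-dimensional
    -- irreducible module restricts to twice it, with norm 4 and multiplicity 2.
    (fun k => if k = 0 then 1 / 2 else 1) (fun k => if k = 0 then 1 else if k = n then 4 else 2)
    (fun k => if k = n then 2 else 1) w (by simp) (fun k => by split_ifs <;> norm_num)
    (fun k _ => by split_ifs <;> first | omega | norm_num)
    (fun j hj => by rw [hw1 j hj]; split_ifs <;> first | omega | (norm_num; done) | grind)
    (fun j hj => by rw [hw2 j hj]; split_ifs <;> first | omega | (norm_num; done) | grind)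
    (fun k hk => by
      rcases Nat.eq_zero_or_pos k with rfl | hk0
      · exact exists_trivial _ _ (by simp)
      · exact exists_hadamard (by omega) _ hk0.ne' (by rw [if_neg (by omega)]))
    fun k hk => by
      by_cases hkn : k = n
      · subst hkn
        have hk0 : k ≠ 0 := hn.ne'
        refine Or.inr ⟨by simp [hk0], by simp, by norm_num [hk0, mono], elemX (2 * (2 * k)),
          elemX_mem_binaryDihedral _, elemY, elemY_mem_binaryDihedral _, ?_⟩
        -- The commutator of the two generators is the generator of the cyclic subgroup, on which
        -- the sign is -1.
        rw [(elemX_conj_comm _).1, elemX_sq, if_neg hk0, one_mul, ← pow_one (elemX (2 * k)),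
          mono_elemX_pow, zpow_neg, zpow_natCast, θ_pow_half k hn]
        norm_num
      · exact Or.inl ⟨by split_ifs <;> norm_num, by rw [if_neg hkn]⟩

end Cyclic

open Representation

/-! ### The system of a binary dihedral group inside one of twice its order. -/

section Dihedral

theorem elemX_conj_elemY (m : ℕ) (k : ℤ) :
    elemX m ^ k * elemY * (elemX m ^ k)⁻¹ = elemX m ^ (2 * k) * elemY := by
  rw [mul_assoc, ← zpow_neg, elemY_mul_zpow, neg_neg, ← mul_assoc, ← zpow_add, two_mul]

theorem dihedral_normal_comm (m : ℕ) :
    (∀ g ∈ binaryDihedral (2 * m), ∀ x ∈ binaryDihedral m, g * x * g⁻¹ ∈ binaryDihedral m) ∧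
      ∀ g ∈ binaryDihedral (2 * m), ∀ h ∈ binaryDihedral (2 * m),
        g * h * g⁻¹ * h⁻¹ ∈ binaryDihedral m := by
  have hX := elemX_mem_binaryDihedral m
  have hY := elemY_mem_binaryDihedral m
  have hsq : ∀ k : ℤ, elemX (2 * (2 * m)) ^ (2 * k) = elemX (2 * m) ^ k := fun k => by
    rw [zpow_mul, zpow_two, ← sq, elemX_sq]
  have hW : ∀ k : ℤ, ∀ x ∈ binaryDihedral m,
      elemX (2 * (2 * m)) ^ k * x * (elemX (2 * (2 * m)) ^ k)⁻¹ ∈ binaryDihedral m := by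
    intro k x hx
    refine conj_mem_closure (s := {elemX (2 * m), elemY}) ?_ hx
    rintro y (rfl | rfl)
    · have hc : Commute (elemX (2 * (2 * m)) ^ k) (elemX (2 * m)) := by
        rw [← elemX_sq (2 * m)]
        exact ((Commute.refl (elemX (2 * (2 * m)))).pow_right 2).zpow_left k
      rw [hc.eq, mul_inv_cancel_right]
      exact hX
    · rw [elemX_conj_elemY, hsq]
      exact mul_mem (zpow_mem hX k) hY
  refine normal_and_comm_of_closure ?_ ?_
  · rintro x (rfl | rfl) n hn
    · have h1 := hW 1 n hn
      have h2 := hW (-1) n hn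
      rw [zpow_one] at h1
      rw [zpow_neg_one, inv_inv] at h2
      exact ⟨h1, h2⟩
    · exact ⟨mul_mem (mul_mem hY hn) (inv_mem hY), mul_mem (mul_mem (inv_mem hY) hn) hY⟩
  · obtain ⟨h3, h4⟩ := elemX_conj_comm (2 * (2 * m))
    rintro x (rfl | rfl) y (rfl | rfl)
    · simp
    · rwa [h3, elemX_sq]
    · rw [h4, elemX_sq]
      exact inv_mem hX
    · simp

/-- The characters of `D₂ₘ` on `Dₘ`. -/
def forkFun : ℕ → SU2 → ℂ
  | 0 => fun _ => 1
  | 1 => sgnFun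
  | k + 2 => mono (k + 1)

theorem mono_of_antidiagonal {x : SU2} (hx : x.1 0 0 = 0) {k : ℕ} (hk : k ≠ 0) : mono k x = 0 := by
  simp [mono, hx, hk]

theorem sgnFun_of_diagonal {x : SU2} (hx : x.1 0 1 = 0) : sgnFun x = 1 := by
  obtain ⟨-, -, h⟩ := SU2.entries x
  rw [hx, zero_mul, add_zero] at h
  rw [sgnFun, hx, h]
  simp

theorem sgnFun_of_antidiagonal {x : SU2} (hx : x.1 0 0 = 0) : sgnFun x = -1 := by
  obtain ⟨-, -, h⟩ := SU2.entries x
  rw [hx, zero_mul, zero_add] at h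
  rw [sgnFun, hx, h]
  simp

theorem forkFun_of_diagonal {x : SU2} (hx : x.1 0 1 = 0) (k : ℕ) :
    forkFun k x = (if k ≤ 1 then 1 / 2 else 1) * mono (k - 1) x := by
  match k with
  | 0 => norm_num [forkFun, mono_zero]
  | 1 => norm_num [forkFun, mono_zero, sgnFun_of_diagonal hx]
  | k + 2 => simp [forkFun]

theorem forkFun_of_antidiagonal {x : SU2} (hx : x.1 0 0 = 0) (k : ℕ) :
    forkFun k x = if k = 0 then 1 else if k = 1 then -1 else 0 := by
  match k with
  | 0 => simp [forkFun]
  | 1 => simp [forkFun, sgnFun_of_antidiagonal hx]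
  | k + 2 => simp [forkFun, mono_of_antidiagonal hx]

theorem tr_mul_mono_of_monomial {x : SU2} (hx : x.IsMonomial) {k : ℕ} (hk : k ≠ 0) :
    SU2.tr x * mono (k + 1) x = mono (k + 2) x + mono k x := by
  rcases hx with h | h
  · simp [mono_of_antidiagonal h, hk]
  · exact tr_mul_mono_of_diagonal h k

/-- The system of `Dₘ ⊲ D₂ₘ`. -/
def dihedralDihedralData {m : ℕ} (hm : 2 ≤ m) :
    PairData (binaryDihedral (2 * m)) (binaryDihedral m) (m + 1) (Fin (2 * m) × Fin 2) where
  p a := elemX (2 * m) ^ (a.1 : ℕ) * elemY ^ (a.2 : ℕ)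
  inj := dihedral_param_injective (by omega)
  mem := mem_binaryDihedral (by omega)
  F k := forkFun k
  -- The last function is `mono m`, which on the smaller group splits into two distinct linear
  -- characters.
  ν k := if (k : ℕ) = m + 1 then 2 else 1
  E _ := 1
  rep k := if (k : ℕ) = m + 1 then elemY else elemX (2 * m) ^ (k : ℕ)
  A := forkAdj (m + 1) fun i j => if i + 1 = m + 1 ∧ j = m + 1 then 2 else 1
  le := (Subgroup.closure_le _).2 (by
    rintro x (rfl | rfl)
    · rw [← elemX_sq]
      exact pow_mem (elemX_mem_binaryDihedral _) 2
    · exact elemY_mem_binaryDihedral _)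
  normal := (dihedral_normal_comm m).1
  comm := (dihedral_normal_comm m).2
  rep_mem k := by
    split_ifs
    · exact elemY_mem_binaryDihedral m
    · exact pow_mem (elemX_mem_binaryDihedral m) _
  F_inv k a := by
    obtain ⟨k, hk⟩ := k
    simp only
    match k with
    | 0 => rfl
    | 1 =>
      obtain ⟨h0, h1⟩ := SU2.inv_entries (elemX (2 * m) ^ (a.1 : ℕ) * elemY ^ (a.2 : ℕ))
      rw [forkFun, sgnFun, sgnFun, h0, h1, star_star, star_neg, neg_mul_neg, mul_comm]
    | k + 2 => exact mono_inv _ _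
  conj_rep a := by
    obtain ⟨j, e⟩ := a
    fin_cases e
    · simp only [pow_zero, mul_one]
      by_cases hj : (j : ℕ) ≤ m
      · exact ⟨⟨j, by omega⟩, 1, one_mem _, by rw [if_neg (by simp only; omega)]; simp⟩
      · refine ⟨⟨2 * m - j, by omega⟩, elemY, elemY_mem_binaryDihedral _, ?_⟩
        rw [if_neg (by simp only; omega)]
        simp only
        have h1 := elemX_pow_eq_one (2 * m) (by omega)
        rw [← zpow_natCast _ (2 * m - (j : ℕ)), elemY_conj_zpow, zpow_neg, eq_inv_iff_mul_eq_one,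
          zpow_natCast, ← pow_add, (by omega : (j : ℕ) + (2 * m - j) = 2 * m), h1]
    -- Conjugation by a square root of the smaller generator advances an antidiagonal element by one
    -- step, so the larger group fuses all of them into the class of y.
    · refine ⟨⟨m + 1, by omega⟩, elemX (2 * (2 * m)) ^ (j : ℕ),
        pow_mem (elemX_mem_binaryDihedral _) _, ?_⟩
      simp only [if_true, pow_one]
      rw [← zpow_natCast (elemX (2 * (2 * m))), elemX_conj_elemY, zpow_mul, zpow_two, ← sq,
        elemX_sq, zpow_natCast]
  ν_pos k := by
    split_ifs <;> norm_num
  orth k l := by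
    rw [Fintype.sum_prod_type]
    have hd : ∀ j : Fin (2 * m), (elemX (2 * m) ^ (j : ℕ)).1 0 1 = 0 := fun j =>
      (elemX_pow_entries _ _).2
    have ha : ∀ j : Fin (2 * m), (elemX (2 * m) ^ (j : ℕ) * elemY).1 0 0 = 0 := fun j => by
      rw [SU2.mul_zero_zero, hd, elemY_entries.1]
      simp
    simp only [Fin.sum_univ_two, Fin.val_zero, Fin.val_one, pow_zero, pow_one, mul_one]
    rw [Finset.sum_add_distrib]
    simp only [forkFun_of_diagonal (hd _), forkFun_of_antidiagonal (ha _)]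
    have h1 : ∀ j : Fin (2 * m), (if (k : ℕ) ≤ 1 then 1 / 2 else 1 : ℂ) *
        mono (k - 1) (elemX (2 * m) ^ (j : ℕ)) * ((if (l : ℕ) ≤ 1 then 1 / 2 else 1 : ℂ) *
          mono (l - 1) (elemX (2 * m) ^ (j : ℕ))) =
        ((if (k : ℕ) ≤ 1 then 1 / 2 else 1 : ℂ) * (if (l : ℕ) ≤ 1 then 1 / 2 else 1 : ℂ)) *
          (mono (k - 1) (elemX (2 * m) ^ (j : ℕ)) * mono (l - 1) (elemX (2 * m) ^ (j : ℕ))) :=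
      fun j => by ring
    simp_rw [h1]
    rw [← Finset.mul_sum, sum_mono_mul_mono (by omega) (by omega) (by omega), Finset.sum_const,
      Finset.card_univ, Fintype.card_prod, Fintype.card_fin, Fintype.card_fin, nsmul_eq_mul]
    have hk := k.2
    have hl := l.2
    simp only [Fin.ext_iff]
    generalize (k : ℕ) = k at *
    generalize (l : ℕ) = l at *
    rcases k with _ | _ | k <;> rcases l with _ | _ | l
    · have : ¬ 0 = m + 1 := by omega
      norm_num [this]
      ring
    · norm_num
      ring
    · norm_num
    · norm_num
      ring
    · have : ¬ m = 0 := by omega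
      norm_num [this, Ne.symm this]
      ring
    · norm_num
    · norm_num
    · norm_num
    · norm_num
      split_ifs <;> first | omega | ring
  F_zero _ := rfl
  fusion j a := by
    have hx : SU2.IsMonomial (elemX (2 * m) ^ (a.1 : ℕ) * elemY ^ (a.2 : ℕ)) :=
      isMonomial_of_mem (m := m) (by omega) ((mem_binaryDihedral (by omega) _).2 ⟨a, rfl⟩)
    have href : mono (m + 1) (elemX (2 * m) ^ (a.1 : ℕ) * elemY ^ (a.2 : ℕ)) =
        mono (m - 1) (elemX (2 * m) ^ (a.1 : ℕ) * elemY ^ (a.2 : ℕ)) := by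
      obtain ⟨j, e⟩ := a
      fin_cases e
      · simp only [pow_zero, mul_one]
        exact mono_reflect (by omega) _
      · have h0 : (elemX (2 * m) ^ (j : ℕ) * elemY).1 0 0 = 0 := by
          rw [SU2.mul_zero_zero, (elemX_pow_entries _ _).2, elemY_entries.1]
          simp
        simp only [pow_one]
        rw [mono_of_antidiagonal h0 (by omega), mono_of_antidiagonal h0 (by omega)]
    rw [sum_fork (m + 1) (by omega) _
      (fun k => forkFun k (elemX (2 * m) ^ (a.1 : ℕ) * elemY ^ (a.2 : ℕ)))]
    generalize elemX (2 * m) ^ (a.1 : ℕ) * elemY ^ (a.2 : ℕ) = x at *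
    have hone : mono 1 x = SU2.tr x := by simp [mono, SU2.tr]
    obtain ⟨j, hj⟩ := j
    simp only
    match j with
    | 0 =>
      rw [if_pos rfl, if_neg (by omega)]
      simp [forkFun, hone]
    | 1 =>
      rw [if_neg (by omega), if_pos rfl, if_neg (by omega), if_neg (by omega), if_neg (by omega)]
      rcases hx with h | h
      · simp [forkFun, hone, SU2.tr, h]
      · simp [forkFun, hone, sgnFun_of_diagonal h]
    | 2 =>
      rw [if_neg (by omega), if_neg (by omega), if_neg (by omega), if_pos rfl, if_neg (by omega),
        if_neg (by omega), if_neg (by omega)]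
      -- The branching: tr² = a² + ā² + 2|a|², where 2|a|² = 1 + (|a|² - |b|²) because |a|² + |b|² =
      -- 1.
      obtain ⟨-, -, h⟩ := SU2.entries x
      simp only [forkFun, mono, SU2.tr]
      have hs : sgnFun x = x.1 0 0 * star (x.1 0 0) - x.1 0 1 * star (x.1 0 1) := rfl
      push_cast
      linear_combination h - hs
    | k + 3 =>
      have hrec := tr_mul_mono_of_monomial hx (k := k + 1) (by omega)
      rw [if_neg (by omega), if_neg (by omega), if_neg (by omega : ¬ k + 3 = 2), add_zero]
      by_cases hk : k + 3 = m + 1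
      · rw [if_pos hk, if_pos (by omega)]
        have h1 : mono (k + 1 + 2) x = mono (k + 1) x := by
          rw [(by omega : k + 1 + 2 = m + 1), href, (by omega : k + 1 = m - 1)]
        rw [h1] at hrec
        simp only [forkFun, (by omega : k + 3 - 1 = k + 2)]
        push_cast
        linear_combination hrec
      · rw [if_neg hk, if_neg (by omega), if_neg (by omega)]
        simp only [forkFun, (by omega : k + 3 - 1 = k + 2)]
        push_cast
        linear_combination hrec
  real k := by
    have hmon : ∀ x ∈ binaryDihedral (2 * m), SU2.IsMonomial x := fun _ =>
      isMonomial_of_mem (by omega)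
    obtain ⟨k, hk⟩ := k
    simp only
    match k with
    | 0 => exact ⟨1, scalarRep 1, fun x _ => char_scalarRep _ _⟩
    | 1 => exact ⟨1, scalarRep (sgnHom hmon), fun x _ => char_scalarRep _ _⟩
    | k + 2 => exact ⟨2, hadamardRep hmon k.succ_ne_zero, fun x _ => char_hadamardRep _ _ _⟩
  alternative k := Or.inl ⟨by split_ifs <;> norm_num, rfl⟩

end Dihedral

/-! ### Groups given by generators: membership, normality and finiteness. -/

section Generation

variable {H : Type} [Group H]

/-- A subset of a group that is closed under right multiplication by generators, and whose elements
are reached from the identity by right multiplication by generators, is the whole group. -/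
theorem mem_closure_iff_of_reachable {n k : ℕ} {s : Set H} (q : Fin n → H) (gen : Fin k → H)
    (hgen : ∀ a, gen a ∈ Subgroup.closure s)
    (hs : ∀ g ∈ s, (∃ a, gen a = g) ∧ ∃ a, gen a = g⁻¹) (hone : ∃ i, q i = 1)
    (hmul : ∀ i a, ∃ j, q i * gen a = q j)
    (hreach : ∀ i, q i = 1 ∨ ∃ j < i, ∃ a, q i = q j * gen a) (x : H) :
    x ∈ Subgroup.closure s ↔ ∃ i, q i = x := by
  constructor
  · intro hx
    induction hx using Subgroup.closure_induction_right with
    | one => exact hone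
    | mul_right x _ y hy ih =>
      obtain ⟨i, rfl⟩ := ih
      obtain ⟨a, rfl⟩ := (hs y hy).1
      obtain ⟨j, hj⟩ := hmul i a
      exact ⟨j, hj.symm⟩
    | mul_inv_cancel x _ y hy ih =>
      obtain ⟨i, rfl⟩ := ih
      obtain ⟨a, ha⟩ := (hs y hy).2
      obtain ⟨j, hj⟩ := hmul i a
      exact ⟨j, by rw [← ha, hj]⟩
  · rintro ⟨i, rfl⟩
    induction i using WellFoundedLT.induction with
    | ind i ih =>
      rcases hreach i with h | ⟨j, hj, a, h⟩
      · rw [h]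
        exact one_mem _
      · rw [h]
        exact mul_mem (ih j hj) (hgen a)

/-- If `w` normalizes `N`, then the group generated by `w` and elements of `N` normalizes `N`, with
abelian quotient. -/
theorem normal_and_comm_of_insert {s : Set H} {N : Subgroup H} {w : H}
    (hs : ∀ x ∈ s, x = w ∨ x ∈ N) (hw : ∀ n ∈ N, w * n * w⁻¹ ∈ N ∧ w⁻¹ * n * w ∈ N) :
    (∀ g ∈ Subgroup.closure s, ∀ n ∈ N, g * n * g⁻¹ ∈ N) ∧
      ∀ g ∈ Subgroup.closure s, ∀ h ∈ Subgroup.closure s, g * h * g⁻¹ * h⁻¹ ∈ N := by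
  refine normal_and_comm_of_closure (fun x hx n hn => ?_) fun x hx y hy => ?_
  · rcases hs x hx with rfl | h
    · exact hw n hn
    · exact ⟨mul_mem (mul_mem h hn) (inv_mem h), mul_mem (mul_mem (inv_mem h) hn) h⟩
  · rcases hs x hx with rfl | h <;> rcases hs y hy with rfl | h'
    · simp
    · exact mul_mem (hw y h').1 (inv_mem h')
    · have := mul_mem h (hw x⁻¹ (inv_mem h)).1
      simpa only [mul_assoc] using this
    · exact mul_mem (mul_mem (mul_mem h h') (inv_mem h)) (inv_mem h')

/-- As w normalizes N and w² lies in N, the two cosets N and Nw exhaust the generated group. -/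
theorem finite_closure_of_insert {s : Set H} {N : Subgroup H} [Finite N] {w : H}
    (hs : ∀ x ∈ s, x = w ∨ x ∈ N) (hw : ∀ n ∈ N, w * n * w⁻¹ ∈ N ∧ w⁻¹ * n * w ∈ N)
    (hw2 : w * w ∈ N) : Finite (Subgroup.closure s) := by
  have key : ∀ x ∈ Subgroup.closure s, x ∈ N ∨ x * w⁻¹ ∈ N := by
    intro x hx
    induction hx using Subgroup.closure_induction_right with
    | one => exact Or.inl (one_mem N)
    | mul_right x _ y hy ih =>
      rcases hs y hy with rfl | hy' <;> rcases ih with h | h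
      · exact Or.inr (by rwa [mul_inv_cancel_right])
      · refine Or.inl ?_
        have := mul_mem h hw2
        rwa [← mul_assoc, inv_mul_cancel_right] at this
      · exact Or.inl (mul_mem h hy')
      · refine Or.inr ?_
        have := mul_mem h (hw y hy').1
        simpa [mul_assoc] using this
    | mul_inv_cancel x _ y hy ih =>
      rcases hs y hy with rfl | hy' <;> rcases ih with h | h
      · refine Or.inr ?_
        have := mul_mem h (inv_mem hw2)
        rwa [mul_inv_rev, ← mul_assoc] at this
      · exact Or.inl h
      · exact Or.inl (mul_mem h (inv_mem hy'))
      · refine Or.inr ?_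
        have := mul_mem h (hw y⁻¹ (inv_mem hy')).1
        simpa [mul_assoc] using this
  have hN : (N : Set H).Finite := Set.toFinite _
  have : ((Subgroup.closure s : Subgroup H) : Set H) ⊆ N ∪ (fun x => x * w) '' N := by
    intro x hx
    rcases key x hx with h | h
    · exact Or.inl h
    · exact Or.inr ⟨_, h, by simp⟩
  exact ((hN.union (hN.image _)).subset this).to_subtype

end Generation

/-! ### The quaternion, binary tetrahedral and binary octahedral groups in integral coordinates. -/

section Quaternions

/-- Twice the coordinates of a quaternion. -/
abbrev Quad : Type := ℤ × ℤ × ℤ × ℤ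

/-- Four times the product of two quaternions, in doubled coordinates. -/
def Quad.mul (v w : Quad) : Quad :=
  (v.1 * w.1 - v.2.1 * w.2.1 - v.2.2.1 * w.2.2.1 - v.2.2.2 * w.2.2.2,
    v.1 * w.2.1 + v.2.1 * w.1 - v.2.2.2 * w.2.2.1 + v.2.2.1 * w.2.2.2,
    v.1 * w.2.2.1 - v.2.1 * w.2.2.2 + v.2.2.1 * w.1 + v.2.2.2 * w.2.1,
    v.1 * w.2.2.2 + v.2.1 * w.2.2.1 + v.2.2.2 * w.1 - v.2.2.1 * w.2.1)

/-- Conjugation by `diag (θ₈, θ₈⁻¹)`. -/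
def Quad.twist (v : Quad) : Quad := (v.1, v.2.1, -v.2.2.2, v.2.2.1)

/-- The coordinates of `x` are half of those in `v`. -/
def IsQuad (x : SU2) (v : Quad) : Prop :=
  x.1 0 0 = (v.1 + v.2.1 * Complex.I) / 2 ∧ x.1 0 1 = (v.2.2.1 + v.2.2.2 * Complex.I) / 2

/-- The product of doubled coordinates carries a factor 4, the target only a factor 2. All
multiplications thus become decidable integer identities. -/
theorem IsQuad.mul {x y : SU2} {v w u : Quad} (hx : IsQuad x v) (hy : IsQuad y w)
    (h : v.mul w = 2 * u) : IsQuad (x * y) u := by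
  obtain ⟨hx0, hx1⟩ := hx
  obtain ⟨hy0, hy1⟩ := hy
  obtain ⟨p, q, r, s⟩ := v
  obtain ⟨P, Q, R, S⟩ := w
  obtain ⟨a, b, c, d⟩ := u
  simp only [Quad.mul, Prod.ext_iff, Prod.fst_mul, Prod.snd_mul, Prod.fst_ofNat,
    Prod.snd_ofNat] at h
  obtain ⟨h1, h2, h3, h4⟩ := h
  have h1' : (p * P - q * Q - r * R - s * S : ℂ) = 2 * a := by exact_mod_cast h1
  have h2' : (p * Q + q * P - s * R + r * S : ℂ) = 2 * b := by exact_mod_cast h2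
  have h3' : (p * R - q * S + r * P + s * Q : ℂ) = 2 * c := by exact_mod_cast h3
  have h4' : (p * S + q * R + s * P - r * Q : ℂ) = 2 * d := by exact_mod_cast h4
  constructor
  · rw [SU2.mul_zero_zero, hx0, hx1, hy0, hy1]
    simp
    linear_combination h1' / 4 + Complex.I * h2' / 4 + (q * Q + s * S) / 4 * Complex.I_sq
  · rw [SU2.mul_zero_one, hx0, hx1, hy0, hy1]
    simp
    linear_combination h3' / 4 + Complex.I * h4' / 4 + (q * S - s * Q) / 4 * Complex.I_sq

theorem IsQuad.eq {x y : SU2} {v : Quad} (hx : IsQuad x v) (hy : IsQuad y v) : x = y :=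
  SU2.ext' (hx.1.trans hy.1.symm) (hx.2.trans hy.2.symm)

theorem IsQuad.unique {x : SU2} {v w : Quad} (hv : IsQuad x v) (hw : IsQuad x w) : v = w := by
  have key : ∀ a b c d : ℤ, ((a + b * Complex.I) / 2 : ℂ) = (c + d * Complex.I) / 2 →
      a = c ∧ b = d := by
    intro a b c d h
    rw [div_left_inj' two_ne_zero] at h
    have h1 := congr_arg Complex.re h
    have h2 := congr_arg Complex.im h
    simp at h1 h2
    exact ⟨h1, h2⟩
  obtain ⟨h1, h2⟩ := key _ _ _ _ (hv.1.symm.trans hw.1)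
  obtain ⟨h3, h4⟩ := key _ _ _ _ (hv.2.symm.trans hw.2)
  exact Prod.ext h1 (Prod.ext h2 (Prod.ext h3 h4))

theorem IsQuad.tr {x : SU2} {v : Quad} (h : IsQuad x v) : SU2.tr x = v.1 := by
  rw [SU2.tr, h.1]
  simp
  ring

theorem IsQuad.inv {x : SU2} {v : Quad} (h : IsQuad x v) :
    IsQuad x⁻¹ (v.1, -v.2.1, -v.2.2.1, -v.2.2.2) := by
  obtain ⟨h0, h1⟩ := SU2.inv_entries x
  constructor
  · rw [h0, h.1]
    simp
  · rw [h1, h.2]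
    push_cast
    ring

theorem isQuad_one : IsQuad 1 (2, 0, 0, 0) := by
  constructor <;> simp

theorem θ_four : θ 4 = Complex.I := by
  rw [θ, show 2 * (Real.pi : ℂ) * Complex.I / (4 : ℕ) = Real.pi / 2 * Complex.I by push_cast; ring]
  exact Complex.exp_pi_div_two_mul_I

theorem θ_eight : ((Real.sqrt 2 : ℝ) : ℂ)⁻¹ * θ 8 = (1 + Complex.I) / 2 := by
  have h : θ 8 = ((Real.sqrt 2 / 2 : ℝ) : ℂ) + ((Real.sqrt 2 / 2 : ℝ) : ℂ) * Complex.I := by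
    rw [θ, show 2 * (Real.pi : ℂ) * Complex.I / (8 : ℕ) = ((Real.pi / 4 : ℝ) : ℂ) * Complex.I by
      push_cast; ring, Complex.exp_mul_I, ← Complex.ofReal_cos, ← Complex.ofReal_sin,
      Real.cos_pi_div_four, Real.sin_pi_div_four]
  have h2 : ((Real.sqrt 2 : ℝ) : ℂ) ≠ 0 := by
    rw [Complex.ofReal_ne_zero]
    positivity
  rw [h]
  push_cast
  field_simp

theorem isQuad_elemX_four : IsQuad (elemX 4) (0, -2, 0, 0) := by
  have h : (elemX 4).1 0 0 = (θ 4)⁻¹ := rfl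
  have h' : (elemX 4).1 0 1 = 0 := rfl
  constructor
  · rw [h, θ_four, Complex.inv_I]
    push_cast
    ring
  · rw [h']
    simp

theorem isQuad_elemY : IsQuad elemY (0, 0, 0, 2) := by
  constructor
  · rw [elemY_entries.1]
    simp
  · rw [elemY_entries.2]
    simp

theorem isQuad_elemZ : IsQuad elemZ (1, -1, 1, -1) := by
  have h : ((Real.sqrt 2 : ℝ) : ℂ)⁻¹ * (θ 8)⁻¹ = (1 - Complex.I) / 2 := by
    have h1 := congr_arg star θ_eight
    rw [star_mul', star_inv₀, star_θ, Complex.star_def, Complex.conj_ofReal] at h1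
    rw [h1]
    simp [map_div₀, Complex.conj_ofNat, sub_eq_add_neg]
  have h0 : elemZ.1 0 0 = ((Real.sqrt 2 : ℝ) : ℂ)⁻¹ * (θ 8)⁻¹ := rfl
  have h1 : elemZ.1 0 1 = ((Real.sqrt 2 : ℝ) : ℂ)⁻¹ * (θ 8)⁻¹ := rfl
  constructor
  · rw [h0, h]
    push_cast
    ring
  · rw [h1, h]
    push_cast
    ring

/-- Conjugation fixes the diagonal entry and multiplies the other by θ₈² = i. This has order 4, so
the inverse is the third iterate. It permits reasoning about the octahedral group without listing
its other coset. -/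
theorem IsQuad.twist {x : SU2} {v : Quad} (h : IsQuad x v) :
    IsQuad ((elemX 8)⁻¹ * x * elemX 8) v.twist ∧
      IsQuad (elemX 8 * x * (elemX 8)⁻¹) v.twist.twist.twist := by
  obtain ⟨h0, h1⟩ := SU2.inv_entries (elemX 8)
  have e0 : (elemX 8).1 0 0 = (θ 8)⁻¹ := rfl
  have e1 : (elemX 8).1 0 1 = 0 := rfl
  have hθ := θ_ne_zero 8
  have h4 : θ 8 * θ 8 = Complex.I := by rw [← sq, θ_sq 4, θ_four]
  have h5 : (θ 8)⁻¹ * (θ 8)⁻¹ = -Complex.I := by rw [← mul_inv, h4, Complex.inv_I]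
  simp only [IsQuad, Quad.twist, SU2.mul_zero_zero, SU2.mul_zero_one, h0, h1, e0, e1, star_inv₀,
    star_θ, inv_inv, h.1, h.2]
  refine ⟨⟨?_, ?_⟩, ?_, ?_⟩
  · field_simp
    simp
  · simp
    linear_combination ((v.2.2.1 + v.2.2.2 * Complex.I) / 2) * h4 + v.2.2.2 / 2 * Complex.I_sq
  · field_simp
    simp
  · simp
    linear_combination ((v.2.2.1 + v.2.2.2 * Complex.I) / 2) * h5 - v.2.2.2 / 2 * Complex.I_sq

/-- The coordinates of the elements of the binary tetrahedral group. -/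
def tetraQuad : Fin 24 → Quad :=
  ![(2, 0, 0, 0), (0, 2, 0, 0), (0, 0, 0, 2), (-2, 0, 0, 0), (0, 0, -2, 0), (0, 0, 2, 0),
    (0, -2, 0, 0), (0, 0, 0, -2), (1, -1, 1, -1), (1, 1, 1, 1), (1, -1, -1, 1), (-1, 1, -1, 1),
    (1, 1, -1, -1), (-1, -1, 1, 1), (-1, -1, -1, -1), (-1, 1, 1, -1), (-1, -1, 1, -1),
    (1, -1, 1, 1), (1, -1, -1, -1), (1, 1, -1, 1), (1, 1, 1, -1), (-1, -1, -1, 1),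
    (-1, 1, -1, -1), (-1, 1, 1, 1)]

theorem tetraQuad_norm : ∀ i, (tetraQuad i).1 ^ 2 + (tetraQuad i).2.1 ^ 2 +
    (tetraQuad i).2.2.1 ^ 2 + (tetraQuad i).2.2.2 ^ 2 = 4 := by
  decide

theorem tetraQuad_injective : Function.Injective tetraQuad := by
  decide +kernel

/-- The elements of the binary tetrahedral group; the first eight form the quaternion group. -/
def tetra (i : Fin 24) : SU2 :=
  su2 (((tetraQuad i).1 + (tetraQuad i).2.1 * Complex.I) / 2)
    (((tetraQuad i).2.2.1 + (tetraQuad i).2.2.2 * Complex.I) / 2) (by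
      have h : (((tetraQuad i).1 ^ 2 + (tetraQuad i).2.1 ^ 2 + (tetraQuad i).2.2.1 ^ 2 +
        (tetraQuad i).2.2.2 ^ 2 : ℤ) : ℂ) = (4 : ℤ) := congr_arg _ (tetraQuad_norm i)
      push_cast at h
      simp
      linear_combination h / 4 -
        ((tetraQuad i).2.1 ^ 2 + (tetraQuad i).2.2.2 ^ 2 : ℂ) / 4 * Complex.I_sq)

theorem isQuad_tetra (i : Fin 24) : IsQuad (tetra i) (tetraQuad i) := ⟨rfl, rfl⟩

theorem tetra_injective : Function.Injective tetra := fun i j h =>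
  tetraQuad_injective ((isQuad_tetra i).unique (h ▸ isQuad_tetra j))

theorem tetra_mul {i j k : Fin 24} (h : (tetraQuad i).mul (tetraQuad j) = 2 * tetraQuad k) :
    tetra i * tetra j = tetra k :=
  ((isQuad_tetra i).mul (isQuad_tetra j) h).eq (isQuad_tetra k)

theorem tetra_zero : tetra 0 = 1 := (isQuad_tetra 0).eq isQuad_one

theorem tetra_one : tetra 1 = (elemX 4)⁻¹ := (isQuad_tetra 1).eq isQuad_elemX_four.inv

theorem tetra_two : tetra 2 = elemY := (isQuad_tetra 2).eq isQuad_elemY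

theorem tetra_six : tetra 6 = elemX 4 := (isQuad_tetra 6).eq isQuad_elemX_four

theorem tetra_seven : tetra 7 = elemY⁻¹ := (isQuad_tetra 7).eq isQuad_elemY.inv

theorem tetra_eight : tetra 8 = elemZ := (isQuad_tetra 8).eq isQuad_elemZ

theorem tetra_nineteen : tetra 19 = elemZ⁻¹ := (isQuad_tetra 19).eq isQuad_elemZ.inv

theorem mem_binaryTetrahedral (x : SU2) : x ∈ binaryTetrahedral ↔ ∃ i, tetra i = x := by
  have h1 : (elemX 4)⁻¹ ∈ binaryTetrahedral := Subgroup.subset_closure (by simp)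
  have h2 : elemY ∈ binaryTetrahedral := Subgroup.subset_closure (by simp)
  have h3 : elemZ ∈ binaryTetrahedral := Subgroup.subset_closure (by simp)
  -- The six indices are the three generators and their inverses; the list of elements is ordered so
  -- that each one is reached from an earlier one.
  have hmul : ∀ i : Fin 24, ∀ a : Fin 6, ∃ j, (tetraQuad i).mul
      (tetraQuad ((![1, 6, 2, 7, 8, 19] : Fin 6 → Fin 24) a)) = 2 * tetraQuad j := by
    decide +kernel
  have hreach : ∀ i : Fin 24, i = 0 ∨ ∃ j < i, ∃ a : Fin 6, (tetraQuad j).mul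
      (tetraQuad ((![1, 6, 2, 7, 8, 19] : Fin 6 → Fin 24) a)) = 2 * tetraQuad i := by
    decide +kernel
  refine mem_closure_iff_of_reachable tetra
    (fun a => tetra ((![1, 6, 2, 7, 8, 19] : Fin 6 → Fin 24) a)) ?_ ?_ ⟨0, tetra_zero⟩ ?_ ?_ x
  · intro a
    fin_cases a
    · exact Set.mem_of_eq_of_mem tetra_one h1
    · exact Set.mem_of_eq_of_mem tetra_six (inv_mem_iff.1 h1)
    · exact Set.mem_of_eq_of_mem tetra_two h2
    · exact Set.mem_of_eq_of_mem tetra_seven (inv_mem h2)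
    · exact Set.mem_of_eq_of_mem tetra_eight h3
    · exact Set.mem_of_eq_of_mem tetra_nineteen (inv_mem h3)
  · rintro g (rfl | rfl | rfl)
    · exact ⟨⟨0, tetra_one⟩, 1, by rw [inv_inv]; exact tetra_six⟩
    · exact ⟨⟨2, tetra_two⟩, 3, tetra_seven⟩
    · exact ⟨⟨4, tetra_eight⟩, 5, tetra_nineteen⟩
  · intro i a
    obtain ⟨j, hj⟩ := hmul i a
    exact ⟨j, tetra_mul hj⟩
  · intro i
    rcases hreach i with rfl | ⟨j, hj, a, h⟩
    · exact Or.inl tetra_zero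
    · exact Or.inr ⟨j, hj, a, (tetra_mul h).symm⟩

/-- The elements of the quaternion group. -/
def quaternion (i : Fin 8) : SU2 := tetra (i.castLE (by norm_num))

theorem mem_binaryDihedral_two (x : SU2) : x ∈ binaryDihedral 2 ↔ ∃ i, quaternion i = x := by
  have h1 : elemX 4 ∈ binaryDihedral 2 := Subgroup.subset_closure (by simp)
  have h2 : elemY ∈ binaryDihedral 2 := Subgroup.subset_closure (by simp)
  have hmul : ∀ i : Fin 8, ∀ a : Fin 4, ∃ j : Fin 8, (tetraQuad (i.castLE (by norm_num))).mul
      (tetraQuad ((![1, 6, 2, 7] : Fin 4 → Fin 24) a)) =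
        2 * tetraQuad (j.castLE (by norm_num)) := by
    decide +kernel
  have hreach : ∀ i : Fin 8, i = 0 ∨ ∃ j < i, ∃ a : Fin 4,
      (tetraQuad (j.castLE (by norm_num))).mul
      (tetraQuad ((![1, 6, 2, 7] : Fin 4 → Fin 24) a)) =
        2 * tetraQuad (i.castLE (by norm_num)) := by
    decide +kernel
  refine mem_closure_iff_of_reachable quaternion
    (fun a => tetra ((![1, 6, 2, 7] : Fin 4 → Fin 24) a)) ?_ ?_ ⟨0, tetra_zero⟩ ?_ ?_ x
  · intro a
    fin_cases a
    · exact Set.mem_of_eq_of_mem tetra_one (inv_mem h1)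
    · exact Set.mem_of_eq_of_mem tetra_six h1
    · exact Set.mem_of_eq_of_mem tetra_two h2
    · exact Set.mem_of_eq_of_mem tetra_seven (inv_mem h2)
  · rintro g (rfl | rfl)
    · exact ⟨⟨1, tetra_six⟩, 0, tetra_one⟩
    · exact ⟨⟨2, tetra_two⟩, 3, tetra_seven⟩
  · intro i a
    obtain ⟨j, hj⟩ := hmul i a
    exact ⟨j, tetra_mul hj⟩
  · intro i
    rcases hreach i with rfl | ⟨j, hj, a, h⟩
    · exact Or.inl tetra_zero
    · exact Or.inr ⟨j, hj, a, (tetra_mul h).symm⟩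

instance finite_binaryTetrahedral : Finite binaryTetrahedral :=
  (Set.finite_range tetra).subset (fun x hx => (mem_binaryTetrahedral x).1 hx)

/-- Conjugacies are written as equalities of two products, so that no inverse has to be computed. -/
theorem conj_mul_of_mul_eq {i j a b : Fin 24}
    (h : (tetraQuad a).mul (tetraQuad i) = (tetraQuad j).mul (tetraQuad b)) :
    tetra a * tetra i = tetra j * tetra b := by
  have hk : ∀ a i : Fin 24, ∃ k, (tetraQuad a).mul (tetraQuad i) = 2 * tetraQuad k := by
    decide +kernel
  obtain ⟨k, hk⟩ := hk a i
  rw [tetra_mul hk, tetra_mul (h.symm.trans hk)]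

theorem conj_quaternion (n : SU2) (hn : n ∈ binaryDihedral 2) :
    elemZ * n * elemZ⁻¹ ∈ binaryDihedral 2 ∧ elemZ⁻¹ * n * elemZ ∈ binaryDihedral 2 := by
  have h : ∀ a : Fin 8,
      (∃ b : Fin 8, (tetraQuad 8).mul (tetraQuad (a.castLE (by norm_num))) =
        (tetraQuad (b.castLE (by norm_num))).mul (tetraQuad 8)) ∧
      ∃ b : Fin 8, (tetraQuad (a.castLE (by norm_num))).mul (tetraQuad 8) =
        (tetraQuad 8).mul (tetraQuad (b.castLE (by norm_num))) := by
    decide +kernel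
  obtain ⟨a, rfl⟩ := (mem_binaryDihedral_two n).1 hn
  obtain ⟨⟨b, hb⟩, c, hc⟩ := h a
  rw [mem_binaryDihedral_two, mem_binaryDihedral_two, ← tetra_eight]
  exact ⟨⟨b, eq_mul_inv_of_mul_eq (conj_mul_of_mul_eq hb).symm⟩, c, by
    rw [mul_assoc]
    exact eq_inv_mul_of_mul_eq (conj_mul_of_mul_eq hc).symm⟩

theorem twist_tetra (n : SU2) (hn : n ∈ binaryTetrahedral) :
    (elemX 8)⁻¹ * n * (elemX 8)⁻¹⁻¹ ∈ binaryTetrahedral ∧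
      (elemX 8)⁻¹⁻¹ * n * (elemX 8)⁻¹ ∈ binaryTetrahedral := by
  have h : ∀ a : Fin 24, (∃ b : Fin 24, (tetraQuad a).twist = tetraQuad b) ∧
      ∃ b : Fin 24, (tetraQuad a).twist.twist.twist = tetraQuad b := by
    decide +kernel
  obtain ⟨a, rfl⟩ := (mem_binaryTetrahedral n).1 hn
  obtain ⟨⟨b, hb⟩, c, hc⟩ := h a
  obtain ⟨h1, h2⟩ := (isQuad_tetra a).twist
  rw [hb] at h1
  rw [hc] at h2
  rw [mem_binaryTetrahedral, mem_binaryTetrahedral, inv_inv]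
  exact ⟨⟨b, (isQuad_tetra b).eq h1⟩, c, (isQuad_tetra c).eq h2⟩

/-- The quaternion group in the binary tetrahedral group. -/
def tetrahedralPair : NormalPair binaryTetrahedral (binaryDihedral 2) (Fin 8) :=
  have key := normal_and_comm_of_insert (s := {(elemX 4)⁻¹, elemY, elemZ}) (w := elemZ) (by
    rintro x (rfl | rfl | rfl)
    · exact Or.inr (inv_mem (elemX_mem_binaryDihedral 2))
    · exact Or.inr (elemY_mem_binaryDihedral 2)
    · exact Or.inl rfl) conj_quaternion
  { p := quaternion
    inj := fun _ _ h => Fin.castLE_injective _ (tetra_injective h)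
    mem := mem_binaryDihedral_two
    le := fun x hx => by
      obtain ⟨i, rfl⟩ := (mem_binaryDihedral_two x).1 hx
      exact (mem_binaryTetrahedral _).2 ⟨_, rfl⟩
    normal := key.1
    comm := key.2 }

theorem octahedral_generators :
    ∀ x ∈ ({(elemX 8)⁻¹, elemY, elemZ} : Set SU2), x = (elemX 8)⁻¹ ∨ x ∈ binaryTetrahedral := by
  rintro x (rfl | rfl | rfl)
  · exact Or.inl rfl
  · exact Or.inr (Subgroup.subset_closure (by simp))
  · exact Or.inr (Subgroup.subset_closure (by simp))

theorem elemX_eight_sq : (elemX 8)⁻¹ * (elemX 8)⁻¹ = (elemX 4)⁻¹ := by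
  rw [← mul_inv_rev, ← sq, elemX_sq 4]

instance finite_binaryOctahedral : Finite binaryOctahedral :=
  finite_closure_of_insert octahedral_generators twist_tetra
    (elemX_eight_sq ▸ Subgroup.subset_closure (by simp))

/-- The binary tetrahedral group in the binary octahedral group. -/
def octahedralPair : NormalPair binaryOctahedral binaryTetrahedral (Fin 24) :=
  have key := normal_and_comm_of_insert octahedral_generators twist_tetra
  { p := tetra
    inj := tetra_injective
    mem := mem_binaryTetrahedral
    le := by
      refine (Subgroup.closure_le _).2 ?_
      rintro x (rfl | rfl | rfl)
      · have h : (elemX 8)⁻¹ ∈ binaryOctahedral := Subgroup.subset_closure (by simp)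
        have := mul_mem h h
        rwa [elemX_eight_sq] at this
      · exact Subgroup.subset_closure (by simp)
      · exact Subgroup.subset_closure (by simp)
    normal := key.1
    comm := key.2 }

/-- Representatives of the classes of the binary tetrahedral group under the binary octahedral
group. -/
def tetraRep : Fin 5 → Fin 24 := ![0, 3, 1, 8, 11]

theorem exists_conj_octahedral (a : Fin 24) : ∃ i : Fin 5, ∃ g ∈ binaryOctahedral,
    tetra a = g * tetra (tetraRep i) * g⁻¹ := by
  -- Conjugation inside T separates some elements that O fuses; one application of the twist covers
  -- the other coset of T in O.
  have h : ∀ a : Fin 24, ∃ i : Fin 5, ∃ b : Fin 24,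
      (tetraQuad a).mul (tetraQuad b) = (tetraQuad b).mul (tetraQuad (tetraRep i)) ∨
      ∃ c : Fin 24, (tetraQuad (tetraRep i)).twist = tetraQuad c ∧
        (tetraQuad a).mul (tetraQuad b) = (tetraQuad b).mul (tetraQuad c) := by
    decide +kernel
  obtain ⟨i, b, hb | ⟨c, hc, hb⟩⟩ := h a
  · exact ⟨i, tetra b, octahedralPair.le ((mem_binaryTetrahedral _).2 ⟨b, rfl⟩),
      eq_mul_inv_of_mul_eq (conj_mul_of_mul_eq hb)⟩
  · refine ⟨i, tetra b * (elemX 8)⁻¹, mul_mem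
      (octahedralPair.le ((mem_binaryTetrahedral _).2 ⟨b, rfl⟩))
      (Subgroup.subset_closure (by simp)), ?_⟩
    have h1 := (isQuad_tetra (tetraRep i)).twist.1
    rw [hc] at h1
    have h2 := conj_mul_of_mul_eq hb
    rw [← h1.eq (isQuad_tetra c)] at h2
    rw [mul_inv_rev, inv_inv]
    have h3 := eq_mul_inv_of_mul_eq h2
    simpa only [mul_assoc] using h3

theorem exists_conj_tetrahedral (a : Fin 8) : ∃ i : Fin 3, ∃ g ∈ binaryTetrahedral,
    quaternion a = g * tetra (tetraRep (i.castLE (by norm_num))) * g⁻¹ := by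
  have h : ∀ a : Fin 8, ∃ i : Fin 3, ∃ b : Fin 24,
      (tetraQuad (a.castLE (by norm_num))).mul (tetraQuad b) =
        (tetraQuad b).mul (tetraQuad (tetraRep (i.castLE (by norm_num)))) := by
    decide +kernel
  obtain ⟨i, b, hb⟩ := h a
  exact ⟨i, tetra b, (mem_binaryTetrahedral _).2 ⟨b, rfl⟩,
      eq_mul_inv_of_mul_eq (conj_mul_of_mul_eq hb)⟩

end Quaternions

open Representation

/-! ### Closure properties of characters restricted from G. -/

section Restrictions

variable {G N : Subgroup SU2}

/-- `f` is the character on `N` of a `G`-module. -/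
def IsRestriction (G N : Subgroup SU2) (f : SU2 → ℂ) : Prop :=
  ∃ (d : ℕ) (U : Representation ℂ G (Fin d → ℂ)), ∀ x : G, (x : SU2) ∈ N → U.character x = f x

theorem isRestriction_one : IsRestriction G N fun _ => 1 :=
  ⟨1, scalarRep 1, fun x _ => by rw [char_scalarRep, MonoidHom.one_apply]⟩

theorem isRestriction_tr : IsRestriction G N SU2.tr :=
  ⟨2, natRep G, fun x _ => char_natRep G x⟩

theorem IsRestriction.tr_mul {f : SU2 → ℂ} (hf : IsRestriction G N f) :
    IsRestriction G N fun x => SU2.tr x * f x := by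
  obtain ⟨d, U, hU⟩ := hf
  obtain ⟨k, τ, ⟨e⟩⟩ := exists_fin_model ((natRep G).tprod U)
  refine ⟨k, τ, fun x hx => ?_⟩
  rw [← char_iso e, char_tensor, Pi.mul_apply, char_natRep, hU x hx]

theorem IsRestriction.sub [Finite G] {ι : Type} [Fintype ι] (P : NormalPair G N ι)
    {f g : SU2 → ℂ} (hf : IsRestriction G N f) (hg : IsRestriction G N g)
    (hinv : ∀ x, f x⁻¹ = f x) (hff : ∑ a, f (P.p a) * f (P.p a) = Fintype.card ι) {c : ℕ}
    (hc : 0 < c) (hgf : ∑ a, g (P.p a) * f (P.p a) = Fintype.card ι * c) :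
    IsRestriction G N fun x => g x - f x := by
  obtain ⟨d, U, hU⟩ := hf
  obtain ⟨k, W, hW⟩ := hg
  have := P.subgroupOf_normal
  let _ : Fintype (N.subgroupOf G) := Fintype.ofFinite _
  obtain ⟨m, τ, hτ⟩ := exists_sub (N := N.subgroupOf G) (fun g h => P.comm g g.2 h h.2) U W
    (fun n => by
      rw [hU _ n.2, hU (n : G)⁻¹ (N.inv_mem n.2), Subgroup.coe_inv, hinv])
    (by
      rw [P.card_subgroupOf, ← hff, ← P.sum_subgroupOf fun x => f x * f x]
      exact Finset.sum_congr rfl fun n _ => by rw [hU _ n.2]) hc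
    (by
      rw [P.card_subgroupOf, ← hgf, ← P.sum_subgroupOf fun x => g x * f x]
      exact Finset.sum_congr rfl fun n _ => by rw [hU _ n.2, hW _ n.2])
  exact ⟨m, τ, fun x hx => by rw [hτ ⟨x, hx⟩, hU x hx, hW x hx]⟩

end Restrictions

/-! ### Tetrahedral and octahedral characters as polynomials in the trace. -/

section Characters

theorem tr_tetra (i : Fin 24) : SU2.tr (tetra i) = (tetraQuad i).1 := (isQuad_tetra i).tr

theorem tr_quaternion (i : Fin 8) :
    SU2.tr (quaternion i) = (tetraQuad (i.castLE (by norm_num))).1 := tr_tetra _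

theorem sum_tetra (φ : ℂ → ℂ) : ∑ i, φ (SU2.tr (tetra i)) =
    φ 2 + φ (-2) + 6 * φ 0 + 8 * φ 1 + 8 * φ (-1) := by
  simp only [tr_tetra, Fin.sum_univ_succ, tetraQuad]
  simp
  ring

theorem sum_quaternion (φ : ℂ → ℂ) : ∑ i, φ (SU2.tr (quaternion i)) =
    φ 2 + φ (-2) + 6 * φ 0 := by
  simp only [tr_quaternion, Fin.sum_univ_succ, tetraQuad]
  simp [Fin.castLE]
  ring

/-- The traces are 0, ±1, ±2. This relation of degree 5 terminates the chain of five characters at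
the last vertex of the path. -/
theorem tr_tetra_cases (i : Fin 24) : SU2.tr (tetra i) ^ 5 - 5 * SU2.tr (tetra i) ^ 3 +
    4 * SU2.tr (tetra i) = 0 := by
  have h : ∀ i, (tetraQuad i).1 ^ 5 - 5 * (tetraQuad i).1 ^ 3 + 4 * (tetraQuad i).1 = 0 := by
    decide +kernel
  rw [tr_tetra]
  exact_mod_cast h i

theorem tr_quaternion_cases (i : Fin 8) : SU2.tr (quaternion i) ^ 3 = 4 * SU2.tr (quaternion i) := by
  have h : ∀ i : Fin 8, (tetraQuad (i.castLE (by norm_num))).1 ^ 3 =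
      4 * (tetraQuad (i.castLE (by norm_num))).1 := by
    decide +kernel
  rw [tr_quaternion]
  exact_mod_cast h i

/-- The restricted characters as polynomials in the trace. -/
def polyChar : ℕ → ℂ → ℂ
  | 0, _ => 1
  | 1, t => t
  | 2, t => t ^ 2 - 1
  | 3, t => t ^ 3 - 2 * t
  | _, t => t ^ 4 - 4 * t ^ 2 + 2

variable {G N : Subgroup SU2}

theorem isRestriction_polyChar_two [Finite G] {ι : Type} [Fintype ι] (P : NormalPair G N ι)
    (h : ∑ a, SU2.tr (P.p a) * SU2.tr (P.p a) = Fintype.card ι) :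
    IsRestriction G N fun x => polyChar 2 (SU2.tr x) := by
  have := IsRestriction.sub P isRestriction_one isRestriction_tr.tr_mul (fun _ => rfl)
    (by simp) one_pos (by simpa using h)
  convert this using 2
  simp only [polyChar]
  ring

/-- Each character is obtained by multiplying the preceding one by the trace and removing known
constituents of norm one. For the last one the constituent `polyChar 2` has pairing 2 and is removed
twice, which accounts for the double bond. -/
theorem isRestriction_octahedral (k : Fin 5) :
    IsRestriction binaryOctahedral binaryTetrahedral fun x => polyChar k (SU2.tr x) := by
  have hsum : ∀ φ : ℂ → ℂ, ∑ a, φ (SU2.tr (octahedralPair.p a)) = _ := sum_tetra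
  have h2 := isRestriction_polyChar_two octahedralPair (by
    rw [hsum fun t => t * t]
    norm_num)
  have h3 : IsRestriction binaryOctahedral binaryTetrahedral
      fun x => polyChar 3 (SU2.tr x) := by
    have := IsRestriction.sub octahedralPair isRestriction_tr h2.tr_mul SU2.tr_inv
      (by rw [hsum fun t => t * t]; norm_num) one_pos
      (by rw [hsum fun t => t * polyChar 2 t * t]; norm_num [polyChar])
    convert this using 2
    simp only [polyChar]
    ring
  have hinv : ∀ x, polyChar 2 (SU2.tr x⁻¹) = polyChar 2 (SU2.tr x) := fun x => by rw [SU2.tr_inv]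
  have hnorm : ∑ a, polyChar 2 (SU2.tr (octahedralPair.p a)) *
      polyChar 2 (SU2.tr (octahedralPair.p a)) = Fintype.card (Fin 24) := by
    rw [hsum fun t => polyChar 2 t * polyChar 2 t]
    norm_num [polyChar]
  have h4 := IsRestriction.sub octahedralPair h2 h3.tr_mul hinv hnorm two_pos (by
    rw [hsum fun t => t * polyChar 3 t * polyChar 2 t]
    norm_num [polyChar])
  have h5 := IsRestriction.sub octahedralPair h2 h4 hinv hnorm one_pos (by
    rw [hsum fun t => (t * polyChar 3 t - polyChar 2 t) * polyChar 2 t]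
    norm_num [polyChar])
  fin_cases k
  · exact isRestriction_one
  · exact isRestriction_tr
  · exact h2
  · exact h3
  · convert h5 using 2
    simp only [polyChar]
    ring

theorem isRestriction_tetrahedral (k : Fin 3) :
    IsRestriction binaryTetrahedral (binaryDihedral 2) fun x => polyChar k (SU2.tr x) := by
  have hsum : ∀ φ : ℂ → ℂ, ∑ a, φ (SU2.tr (tetrahedralPair.p a)) = _ := sum_quaternion
  fin_cases k
  · exact isRestriction_one
  · exact isRestriction_tr
  · exact isRestriction_polyChar_two tetrahedralPair (by
      rw [hsum fun t => t * t]
      norm_num)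

/-- The system of the quaternion group in the binary tetrahedral group. -/
def tetrahedralData : PairData binaryTetrahedral (binaryDihedral 2) 2 (Fin 8) where
  toNormalPair := tetrahedralPair
  F k x := polyChar k (SU2.tr x)
  ν k := if (k : ℕ) = 2 then 3 else 1
  E _ := 1
  rep k := tetra (tetraRep (k.castLE (by norm_num)))
  A := pathAdj 2 fun i j => if i = 1 ∧ j = 2 then 3 else 1
  rep_mem k := by
    rw [mem_binaryDihedral_two]
    fin_cases k
    · exact ⟨0, rfl⟩
    · exact ⟨3, rfl⟩
    · exact ⟨1, rfl⟩
  F_inv k a := by rw [SU2.tr_inv]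
  conj_rep := exists_conj_tetrahedral
  ν_pos k := by split_ifs <;> norm_num
  orth i j := by
    refine (sum_quaternion fun t => polyChar i t * polyChar j t).trans ?_
    fin_cases i <;> fin_cases j <;> norm_num [polyChar]
  F_zero _ := rfl
  fusion j a := by
    rw [sum_path 2 _ fun k => polyChar k (SU2.tr (tetrahedralPair.p a))]
    have h : SU2.tr (tetrahedralPair.p a) ^ 3 = 4 * SU2.tr (tetrahedralPair.p a) :=
      tr_quaternion_cases a
    generalize SU2.tr (tetrahedralPair.p a) = t at *
    fin_cases j
    · norm_num [polyChar]
    · norm_num [polyChar]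
      ring
    · norm_num [polyChar]
      linear_combination h
  real := isRestriction_tetrahedral
  alternative k := Or.inl ⟨by split_ifs <;> norm_num, rfl⟩

/-- The system of the binary tetrahedral group in the binary octahedral group. -/
def octahedralData : PairData binaryOctahedral binaryTetrahedral 4 (Fin 24) where
  toNormalPair := octahedralPair
  F k x := polyChar k (SU2.tr x)
  ν k := if 3 ≤ (k : ℕ) then 2 else 1
  E _ := 1
  rep k := tetra (tetraRep k)
  A := pathAdj 4 fun i j => if i = 2 ∧ j = 3 then 2 else 1
  rep_mem k := (mem_binaryTetrahedral _).2 ⟨_, rfl⟩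
  F_inv k a := by rw [SU2.tr_inv]
  conj_rep := exists_conj_octahedral
  ν_pos k := by split_ifs <;> norm_num
  orth i j := by
    refine (sum_tetra fun t => polyChar i t * polyChar j t).trans ?_
    fin_cases i <;> fin_cases j <;> norm_num [polyChar]
  F_zero _ := rfl
  fusion j a := by
    rw [sum_path 4 _ fun k => polyChar k (SU2.tr (octahedralPair.p a))]
    have h : SU2.tr (octahedralPair.p a) ^ 5 - 5 * SU2.tr (octahedralPair.p a) ^ 3 +
      4 * SU2.tr (octahedralPair.p a) = 0 := tr_tetra_cases a
    generalize SU2.tr (octahedralPair.p a) = t at *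
    fin_cases j
    · norm_num [polyChar]
    · norm_num [polyChar]
      ring
    · norm_num [polyChar]
      ring
    · norm_num [polyChar]
      ring
    · norm_num [polyChar]
      linear_combination h
  real := isRestriction_octahedral
  alternative k := Or.inl ⟨by split_ifs <;> norm_num, rfl⟩

end Characters

/-! ### Removal of the special vertex. -/

section Removal

theorem succ_B1 {n : ℕ} (hn : 3 ≤ n) (i j : Fin n) :
    (AffineType.B1 n).cartan i.succ j.succ = (FiniteType.B n).cartan i j := by
  rw [FiniteType.pathEntry_B]
  simp only [AffineType.cartan, forkCartan, pathEntry, forkBond, Fin.ext_iff, Fin.val_succ]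
  split_ifs <;> first | rfl | (simp only [false_and, false_or] at *; omega) | omega

theorem succ_A2odd {n : ℕ} (hn : 3 ≤ n) (i j : Fin n) :
    (AffineType.A2odd n).cartan i.succ j.succ = (FiniteType.C n).cartan i j := by
  rw [FiniteType.pathEntry_C]
  simp only [AffineType.cartan, forkCartan, pathEntry, forkBond, Fin.ext_iff, Fin.val_succ]
  split_ifs <;> first | rfl | (simp only [false_and, false_or] at *; omega) | omega

theorem succ_D2 {n : ℕ} (i j : Fin n) :
    (AffineType.D2 n).cartan i.succ j.succ = (FiniteType.B n).cartan i j := by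
  rw [FiniteType.pathEntry_B]
  simp only [AffineType.cartan, pathCartan, pathEntry, Fin.ext_iff, Fin.val_succ]
  split_ifs <;> first | rfl | (simp only [false_and, false_or] at *; omega) | omega

theorem succ_C1 {n : ℕ} (i j : Fin n) :
    (AffineType.C1 n).cartan i.succ j.succ = (FiniteType.C n).cartan i j := by
  rw [FiniteType.pathEntry_C]
  simp only [AffineType.cartan, pathCartan, pathEntry, Fin.ext_iff, Fin.val_succ]
  split_ifs <;> first | rfl | (simp only [and_false, false_or] at *; omega) | omega

theorem succ_A2even {n : ℕ} (i j : Fin n) :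
    (AffineType.A2even n).cartan i.succ j.succ = (FiniteType.C n).cartan i j := by
  rw [FiniteType.pathEntry_C]
  simp only [AffineType.cartan, pathCartan, pathEntry, Fin.ext_iff, Fin.val_succ]
  split_ifs <;> first | rfl | (simp only [false_and, false_or] at *; omega) | omega

/-- The double arrow of the twisted type points opposite to that of `F41`, so the remaining diagram
is F₄ read from the other end. -/
theorem succ_E62 (i j : Fin 4) :
    AffineType.E62.cartan i.succ j.succ = FiniteType.F4.cartan (Fin.revPerm i) (Fin.revPerm j) := by
  fin_cases i <;> fin_cases j <;> rfl

theorem succ_F41 (i j : Fin 4) :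
    AffineType.F41.cartan i.succ j.succ = FiniteType.F4.cartan i j := by
  fin_cases i <;> fin_cases j <;> rfl

theorem succ_D43 (i j : Fin 2) :
    AffineType.D43.cartan i.succ j.succ = FiniteType.G2.cartan (Fin.revPerm i) (Fin.revPerm j) := by
  fin_cases i <;> fin_cases j <;> rfl

theorem succ_G21 (i j : Fin 2) :
    AffineType.G21.cartan i.succ j.succ = FiniteType.G2.cartan i j := by
  fin_cases i <;> fin_cases j <;> rfl

theorem succ_A22 (i j : Fin 1) :
    AffineType.A22.cartan i.succ j.succ = FiniteType.A1.cartan i j := by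
  fin_cases i; fin_cases j; rfl

theorem succ_A11 (i j : Fin 1) :
    AffineType.A11.cartan i.succ j.succ = FiniteType.A1.cartan i j := by
  fin_cases i; fin_cases j; rfl

end Removal

theorem pathAdj_ite_eq (n : ℕ) (p : ℕ → ℕ → Prop) [∀ i j, Decidable (p i j)] (a b : ℕ)
    (i j : Fin (n + 1)) : (pathAdj n (fun i j => if p i j then a else b) i j : ℤ) =
      if i = j then 0 else -pathCartan n (fun i j => if p i j then a else b) i j :=
  pathAdj_eq (fun i j => by split_ifs <;> rfl) i j

theorem forkAdj_ite_eq (n : ℕ) (p : ℕ → ℕ → Prop) [∀ i j, Decidable (p i j)] (a b : ℕ)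
    (i j : Fin (n + 1)) : (forkAdj n (fun i j => if p i j then a else b) i j : ℤ) =
      if i = j then 0 else -forkCartan n (fun i j => if p i j then a else b) i j :=
  forkAdj_eq (fun i j => by split_ifs <;> rfl) i j

/-- The only pair in which the exponents on the two sides differ; the ratios m/h are the same. -/
theorem cosProduct_A22 : cosProduct {0, 2} 2 = cosProduct {0, 1} 1 := by
  simp [cosProduct]

end McKaySlodowy

end

/-! ### Assembly of the six families. -/

open McKaySlodowy in
theorem mainTheorem6 (G N : Subgroup SU2) (X : AffineType) (X₀ : FiniteType) (Y : AffineType)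
    (Y₀ : FiniteType) (hp : DistinguishedPair G N X X₀ Y Y₀) :
    -- `N` is a normal subgroup of the finite group `G`
    (Finite G ∧ N ≤ G ∧ (N.subgroupOf G).Normal) ∧
    -- the exponents and Coxeter numbers of the affine and finite types
    (IsExponents X.cartan X.exponents X.coxeterNumber ∧
      IsExponents Y.cartan Y.exponents Y.coxeterNumber ∧
      IsExponents X₀.cartan X₀.exponents X₀.coxeterNumber ∧
      orderOf (coxeterTransformation X₀.cartan) = X₀.coxeterNumber ∧
      IsExponents Y₀.cartan Y₀.exponents Y₀.coxeterNumber ∧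
      orderOf (coxeterTransformation Y₀.cartan) = Y₀.coxeterNumber) ∧
    -- the representation graphs exist
    (Nonempty (RestrictionGraph (N.subgroupOf G) (natRep G) (Fin (X.rank + 1))) ∧
      Nonempty (InductionGraph (N.subgroupOf G) (natRep G) (Fin (Y.rank + 1)))) ∧
    -- the representation graph of restrictions is the affine Dynkin diagram of type `X`, with the
    -- trivial module as special vertex; its removal leaves the finite Dynkin diagram of type `X₀`
    (∀ (I : Type) [Fintype I] [DecidableEq I]
      (R : RestrictionGraph (N.subgroupOf G) (natRep G) I),
      (∃ e : I ≃ Fin (X.rank + 1), e R.zero = 0 ∧ IsDynkin R.adj X.cartan e) ∧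
      (∃ e₀ : {i // i ≠ R.zero} ≃ Fin X₀.rank,
        IsDynkin (removeVertex R.adj R.zero) X₀.cartan e₀)) ∧
    -- the same for the induced modules and the types `Y`, `Y₀`
    (∀ (J : Type) [Fintype J] [DecidableEq J]
      (S : InductionGraph (N.subgroupOf G) (natRep G) J),
      (∃ e : J ≃ Fin (Y.rank + 1), e S.zero = 0 ∧ IsDynkin S.adj Y.cartan e) ∧
      (∃ e₀ : {i // i ≠ S.zero} ≃ Fin Y₀.rank,
        IsDynkin (removeVertex S.adj S.zero) Y₀.cartan e₀)) ∧
    -- the Poincaré series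
    ∀ (I J : Type) [Fintype I] [DecidableEq I] [Fintype J] [DecidableEq J]
      (R : RestrictionGraph (N.subgroupOf G) (natRep G) I)
      (S : InductionGraph (N.subgroupOf G) (natRep G) J)
      (Υ : Finset G), IsConjRepresentatives Υ →
      -- numerators and denominators
      (detSeries (removeVertex R.adj R.zero) = cosProduct X₀.exponents X₀.coxeterNumber ∧
        detSeries R.adj = characterProduct (N.subgroupOf G) (natRep G) Υ ∧
        detSeries R.adj = cosProduct X.exponents X.coxeterNumber) ∧
      (detSeries (removeVertex S.adj S.zero) = cosProduct Y₀.exponents Y₀.coxeterNumber ∧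
        detSeries S.adj = characterProduct (N.subgroupOf G) (natRep G) Υ ∧
        detSeries S.adj = cosProduct Y.exponents Y.coxeterNumber) ∧
      -- both series are the Poincaré series of the `N`-invariants in the tensor algebra
      R.series R.zero = invariantSeries (res (N.subgroupOf G) (natRep G)) ∧
      R.series R.zero = S.series S.zero ∧
      -- the closed formulas
      R.series R.zero = detSeries (removeVertex R.adj R.zero) * (detSeries R.adj)⁻¹ ∧
      R.series R.zero = detSeries (removeVertex R.adj R.zero) *
        (characterProduct (N.subgroupOf G) (natRep G) Υ)⁻¹ ∧
      R.series R.zero = cosProduct X₀.exponents X₀.coxeterNumber *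
        (cosProduct X.exponents X.coxeterNumber)⁻¹ ∧
      S.series S.zero = detSeries (removeVertex S.adj S.zero) * (detSeries S.adj)⁻¹ ∧
      S.series S.zero = detSeries (removeVertex S.adj S.zero) *
        (characterProduct (N.subgroupOf G) (natRep G) Υ)⁻¹ ∧
      S.series S.zero = cosProduct Y₀.exponents Y₀.coxeterNumber *
        (cosProduct Y.exponents Y.coxeterNumber)⁻¹ := by
  cases hp with
  | dihedral_dihedral n hn =>
    obtain ⟨m, rfl⟩ : ∃ m, n = m + 1 := ⟨n - 1, by omega⟩
    have := finite_binaryDihedral (m := 2 * m) (by omega)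
    let P := dihedralDihedralData (m := m) (by omega)
    have := P.subgroupOf_normal
    let _ : Fintype ((binaryDihedral m).subgroupOf (binaryDihedral (2 * m))) := Fintype.ofFinite _
    have hB := FiniteType.hasProfile_B (n := m + 1) (by omega)
    have hC := FiniteType.hasProfile_C (n := m + 1) (by omega)
    have hX := AffineType.hasProfile_A2odd hn
    have hY := AffineType.hasProfile_B1 hn
    have hS := P.isInductionData
      (B := forkAdj (m + 1) fun i j => if i = m + 1 ∧ j + 1 = m + 1 then 2 else 1)
      (forkAdj_swap (w := fun i j => if i + 1 = m + 1 ∧ j = m + 1 then 2 else 1)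
        (E := fun _ => 1) fun i j _ _ _ => by split_ifs <;> first | rfl | omega)
    exact ⟨⟨‹_›, P.le, ‹_›⟩, ⟨hX.isExponents, hY.isExponents, hC.isExponents,
      FiniteType.orderOf_odd (Nat.le_add_left 1 m) hC.isExponents, hB.isExponents,
      FiniteType.orderOf_odd (Nat.le_add_left 1 m) hB.isExponents⟩,
      P.system.correspondence hS hX hC hY hB
        (forkAdj_ite_eq (m + 1) (fun i j => i + 1 = m + 1 ∧ j = m + 1) 2 1)
        (forkAdj_ite_eq (m + 1) (fun i j => i = m + 1 ∧ j + 1 = m + 1) 2 1)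
        (Equiv.refl _) (succ_A2odd hn) (succ_B1 hn) rfl rfl⟩
  | dihedral_cyclic n hn =>
    have hn1 : 1 ≤ n := by omega
    have := finite_binaryDihedral hn1
    let P := dihedralCyclicData hn
    have := P.subgroupOf_normal
    let _ : Fintype ((cyclicGroup (2 * n)).subgroupOf (binaryDihedral n)) := Fintype.ofFinite _
    have hB := FiniteType.hasProfile_B hn
    have hC := FiniteType.hasProfile_C hn
    have hX := AffineType.hasProfile_D2 hn
    have hY := AffineType.hasProfile_C1 hn
    have hS := P.isInductionData
      (B := pathAdj n fun i j => if (i = 1 ∧ j = 0) ∨ (i + 1 = n ∧ j = n) then 2 else 1)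
      (pathAdj_swap (w := fun i j => if (i = 0 ∧ j = 1) ∨ (i = n ∧ j + 1 = n) then 2 else 1)
        (E := fun _ => 1) fun i j _ _ _ => by split_ifs <;> first | rfl | omega)
    exact ⟨⟨‹_›, P.le, ‹_›⟩, ⟨hX.isExponents, hY.isExponents, hB.isExponents,
      FiniteType.orderOf_odd hn1 hB.isExponents, hC.isExponents,
      FiniteType.orderOf_odd hn1 hC.isExponents⟩,
      P.system.correspondence hS hX hB hY hC
        (pathAdj_ite_eq n (fun i j => (i = 0 ∧ j = 1) ∨ (i = n ∧ j + 1 = n)) 2 1)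
        (pathAdj_ite_eq n (fun i j => (i = 1 ∧ j = 0) ∨ (i + 1 = n ∧ j = n)) 2 1)
        (Equiv.refl _) succ_D2 succ_C1 rfl rfl⟩
  | dihedral_cyclic_index_four n hn =>
    have hn1 : 1 ≤ n := by omega
    have := finite_binaryDihedral (m := 2 * n) (by omega)
    let P := dihedralCyclicFourData hn1
      (fun i j => if (i = 0 ∧ j = 1) ∨ (i + 1 = n ∧ j = n) then 2 else 1)
      (fun j hj => by rw [if_neg (by omega)])
      (fun j hj => by split_ifs <;> omega)
    have := P.subgroupOf_normal
    let _ : Fintype ((cyclicGroup (2 * n)).subgroupOf (binaryDihedral (2 * n))) :=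
      Fintype.ofFinite _
    have hC := FiniteType.hasProfile_C hn
    have hX := AffineType.hasProfile_A2even hn
    have hY := AffineType.hasProfile_C1 hn
    have ho := FiniteType.orderOf_odd hn1 hC.isExponents
    have hS := P.isInductionData
      (B := pathAdj n fun i j => if (i = 1 ∧ j = 0) ∨ (i + 1 = n ∧ j = n) then 2 else 1)
      (pathAdj_swap (w := fun i j => if (i = 0 ∧ j = 1) ∨ (i + 1 = n ∧ j = n) then 2 else 1)
        -- The multiplicity 2 at the last vertex is why induction yields `C1` and not merely the
        -- transpose of `A2even`.
        (E := fun k => if k = n then 2 else 1) fun i j _ _ _ => by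
          split_ifs <;> first | rfl | omega)
    exact ⟨⟨‹_›, P.le, ‹_›⟩, ⟨hX.isExponents, hY.isExponents, hC.isExponents, ho, hC.isExponents,
      ho⟩, P.system.correspondence hS hX hC hY hC
        (pathAdj_ite_eq n (fun i j => (i = 0 ∧ j = 1) ∨ (i + 1 = n ∧ j = n)) 2 1)
        (pathAdj_ite_eq n (fun i j => (i = 1 ∧ j = 0) ∨ (i + 1 = n ∧ j = n)) 2 1)
        (Equiv.refl _) succ_A2even succ_C1 rfl rfl⟩
  | octahedral_tetrahedral =>
    let P := octahedralData
    have := P.subgroupOf_normal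
    let _ : Fintype (binaryTetrahedral.subgroupOf binaryOctahedral) := Fintype.ofFinite _
    have hF := FiniteType.hasProfile_F4
    have hX := AffineType.hasProfile_E62
    have hY := AffineType.hasProfile_F41
    have ho := orderOf_coxeterTransformation hF.isExponents (by decide) (by decide) (by decide)
    have hS := P.isInductionData (B := pathAdj 4 fun i j => if i = 3 ∧ j = 2 then 2 else 1)
      (pathAdj_swap (w := fun i j => if i = 2 ∧ j = 3 then 2 else 1) (E := fun _ => 1)
        fun i j _ _ _ => by split_ifs <;> first | rfl | omega)
    exact ⟨⟨inferInstance, P.le, ‹_›⟩, ⟨hX.isExponents, hY.isExponents, hF.isExponents, ho,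
      hF.isExponents, ho⟩, P.system.correspondence hS hX hF hY hF
        (pathAdj_ite_eq 4 (fun i j => i = 2 ∧ j = 3) 2 1)
        (pathAdj_ite_eq 4 (fun i j => i = 3 ∧ j = 2) 2 1) Fin.revPerm succ_E62 succ_F41 rfl rfl⟩
  | tetrahedral_dihedral =>
    let P := tetrahedralData
    have := P.subgroupOf_normal
    let _ : Fintype ((binaryDihedral 2).subgroupOf binaryTetrahedral) := Fintype.ofFinite _
    have hG := FiniteType.hasProfile_G2
    have hX := AffineType.hasProfile_D43
    have hY := AffineType.hasProfile_G21
    have ho := orderOf_coxeterTransformation hG.isExponents (by decide) (by decide) (by decide)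
    have hS := P.isInductionData (B := pathAdj 2 fun i j => if i = 2 ∧ j = 1 then 3 else 1)
      (pathAdj_swap (w := fun i j => if i = 1 ∧ j = 2 then 3 else 1) (E := fun _ => 1)
        fun i j _ _ _ => by split_ifs <;> first | rfl | omega)
    exact ⟨⟨inferInstance, P.le, ‹_›⟩, ⟨hX.isExponents, hY.isExponents, hG.isExponents, ho,
      hG.isExponents, ho⟩, P.system.correspondence hS hX hG hY hG
        (pathAdj_ite_eq 2 (fun i j => i = 1 ∧ j = 2) 3 1)
        (pathAdj_ite_eq 2 (fun i j => i = 2 ∧ j = 1) 3 1) Fin.revPerm succ_D43 succ_G21 rfl rfl⟩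
  | dihedral_two_cyclic_two =>
    have := finite_binaryDihedral two_pos
    -- The index-four family at n = 1: both end conditions fall on the single bond, and the labels 2
    -- · 2 combine to 4.
    let P : PairData (binaryDihedral 2) (cyclicGroup 2) 1 (Fin (2 * 1)) :=
      dihedralCyclicFourData (n := 1) one_pos (fun i _ => if i = 0 then 4 else 1)
        (fun j hj => by rw [if_neg (by omega)])
        (fun j hj => by split_ifs <;> omega)
    have := P.subgroupOf_normal
    let _ : Fintype ((cyclicGroup 2).subgroupOf (binaryDihedral 2)) := Fintype.ofFinite _
    have hA := FiniteType.hasProfile_A1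
    have hX := AffineType.hasProfile_A22
    have hY := AffineType.hasProfile_A11
    have ho := orderOf_coxeterTransformation hA.isExponents (by decide) (by decide) (by decide)
    have hS := P.isInductionData (B := pathAdj 1 fun _ _ => 2)
      (pathAdj_swap (w := fun i _ => if i = 0 then 4 else 1) (E := fun k => if k = 1 then 2 else 1)
        fun i j _ _ _ => by split_ifs <;> first | rfl | omega)
    exact ⟨⟨‹_›, P.le, ‹_›⟩, ⟨hX.isExponents, hY.isExponents, hA.isExponents, ho, hA.isExponents,
      ho⟩, P.system.correspondence hS hX hA hY hA
        (pathAdj_ite_eq 1 (fun i _ => i = 0) 4 1)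
        (pathAdj_eq (w := fun _ _ => 2) (w' := fun _ _ => 2) fun _ _ => rfl) (Equiv.refl _)
        succ_A22 succ_A11 cosProduct_A22 rfl⟩
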